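/- Let $N\ge 2$ and let $\mathfrak g_N$ be $\mathfrak{gl}_N$, $\mathfrak o_N$ or $\mathfrak{sp}_N$ ($N$ even in the last case). Put $i'=N-i+1$, let $\varepsilon_i=1$ for $\mathfrak o_N$, and $\varepsilon_i=1$ for $i\le N/2$, $\varepsilon_i=-1$ for $i>N/2$ for $\mathfrak{sp}_N$; let $\kappa=N/2-1$ for $\mathfrak o_N$ and $\kappa=N/2+1$ for $\mathfrak{sp}_N$. Let $P=\sum e_{ij}\otimes e_{ji}$, $Q=\sum\varepsilon_i\varepsilon_j\,e_{ij}\otimes e_{i'j'}$, $(A')_{ij}=\varepsilon_i\varepsilon_jA_{j'i'}$, and $$\widehat R(u)=u-hP\ \ (\mathfrak{gl}_N),\qquad \widehat R(u)=u(u-h\kappa)-h(u-h\kappa)P+huQ\ \ (\mathfrak o_N,\mathfrak{sp}_N).$$ Negative powers of sums of variables are expanded in nonnegative powers of all variables (including $h$) but the first. The generalized Yangian $\widetilde{\mathcal Y}(\mathfrak g_N)$ is the topological $\mathbb C[[h]]$-algebra generated by $\lambda_{ij}^{(r)}$ ($1\le i,j\le N$, $r\in\mathbb Z$), complete with respect to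 the topology $\tau$ whose neighbourhoods of $0$ are the (closed) two-sided ideals generated by $h^p$ and all $\lambda_{ij}^{(-r)}$ with $r\ge p$ ($p\ge 0$), and subject to the relations $$\widehat R(u-v)\,\mathcal L_1(u)\mathcal L_2(v)=\mathcal L_2(v)\mathcal L_1(u)\,\widehat R(u-v),\qquad \mathcal L(u)=\Big(\delta_{ij}-h\sum_{r\in\mathbb Z}\lambda_{ij}^{(-r)}u^r\Big)_{i,j},$$ and, for $\mathfrak o_N$ and $\mathfrak{sp}_N$, also $\mathcal L(u)\,\mathcal L(u+h\kappa)'=1$. As usual, the common factors $h^2$ and $h$, respectively, of all coefficients of these relations are cancelled. The double Yangian ${\rm DY}(\mathfrak g_N)$ at level $c\in\mathbb C$ is the $h$-adically completed $\mathbb C[[h]]$-algebra generated by $t_{ij}^{(\pm r)}$ ($1\le i,j\le N$, $r\ge1$) subject to, for $T^-(u)=(\delta_{ij}+h\sum_{r\ge1}t_{ij}^{(r)}u^{-r})_{i,j}$ and $T^+(u)=(\delta_{ij}-h\sum_{r\ge1}t_{ij}^{(-r)}u^{r-1})_{i,j}$, the relations $$\widehat R(u-v)\,T^\pm_1(u)T^\pm_2(v)=T^\pm_2(v)T^\pm_1(u)\,\widehat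 R(u-v),\qquad \overline R(u-v+h\epsilon c/2)\,T^-_1(u)T^+_2(v)=T^+_2(v)T^-_1(u)\,\overline R(u-v-h\epsilon c/2),$$ and, for $\mathfrak o_N,\mathfrak{sp}_N$, also $T^\pm(u)T^\pm(u+h\kappa)'=1$, again with the common factors $h^2$, resp. $h$, cancelled. Here $\epsilon=2$ for $\mathfrak{sp}_N$ and $\epsilon=1$ otherwise, and $\overline R(u)=f(u/h)\big(1-\frac huP\big)$ for $\mathfrak{gl}_N$, $\overline R(u)=f(u/h)\big(1-\frac huP+\frac h{u-h\kappa}Q\big)$ for $\mathfrak o_N,\mathfrak{sp}_N$, where $f$ is the unique series in $1+u^{-1}\mathbb C[[u^{-1}]]$ with $f(u)f(u+N)^{-1}=f(u)f(-u)=(1-u^{-2})^{-1}$ for $\mathfrak{gl}_N$, resp. in $1+u^{-2}\mathbb C[[u^{-1}]]$ with $f(u)f(u+\kappa)=f(u)f(-u)=(1-u^{-2})^{-1}$ for $\mathfrak o_N,\mathfrak{sp}_N$. The vacuum module $\mathcal V^{\rm crit}(\mathfrak g_N)$ is the $h$-adically completed quotient of this algebra at the critical level $c$ ($-N$ for $\mathfrak{gl}_N$,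 $-N+2$ for $\mathfrak o_N$, $-N/2-1$ for $\mathfrak{sp}_N$) by the left ideal generated by all $t_{ij}^{(r)}$ with $r\ge1$; let $\mathbf 1$ be the class of $1$. Let $Y(\cdot,z)$ be the $\mathbb C[[h]]$-module map from $\mathcal V^{\rm crit}(\mathfrak g_N)$ to series in $z^{\pm1}$ of operators on $\widetilde{\mathcal Y}(\mathfrak g_N)$ such that, for all $m$, $Y\big(T_1^+(u_1)\cdots T_m^+(u_m)\mathbf 1,z\big)$ is the left multiplication by $\mathcal L_1(z+u_1)\cdots\mathcal L_m(z+u_m)$. Let $1\le n\le N$ for $\mathfrak{gl}_N,\mathfrak o_N$ and $1\le n\le N/2$ for $\mathfrak{sp}_N$. Let $\mathcal E_{[n]}$ be, on $(\mathbb C^N)^{\otimes n}$, the antisymmetrizer for $\mathfrak{gl}_N$; for $\mathfrak o_N$ (resp. $\mathfrak{sp}_N$) let it be the action of the idempotent of the Brauer algebra corresponding to its one-dimensional representation $s_{ij}\mapsto1$, $\varepsilon_{ij}\mapsto0$, where $s_{ij},\varepsilon_{ij}$ act as $P_{ij},Q_{ij}$ (resp. $-P_{ij},-Q_{ij}$).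 Let $(d_1,\dots,d_n)=(0,-1,\dots,-(n-1))$ for $\mathfrak{gl}_N,\mathfrak{sp}_N$ and $(-(n-1),\dots,-1,0)$ for $\mathfrak o_N$. Put $$\mathbb T^+_{[n]}(0)=\operatorname{tr}_{1,\dots,n}\mathcal E_{[n]}\,T^+_1(d_1h)\cdots T^+_n(d_nh)\,\mathbf 1\in\mathcal V^{\rm crit}(\mathfrak g_N),\qquad \mathbb L_{[n]}(z)=\operatorname{tr}_{1,\dots,n}\mathcal E_{[n]}\,\mathcal L_1(z+d_1h)\cdots\mathcal L_n(z+d_nh)\in\widetilde{\mathcal Y}(\mathfrak g_N)[[z^{\pm1}]].$$ Then $Y\big(\mathbb T^+_{[n]}(0),z\big)$ is the left multiplication by $\mathbb L_{[n]}(z)$, i.e. $\mathbb L_{[n]}(z)=Y\big(\mathbb T^+_{[n]}(0),z\big)$, and the following holds. (a) The coefficients of all the series $\mathbb L_{[n]}(z)$ generate a commutative subalgebra of $\widetilde{\mathcal Y}(\mathfrak g_N)$. (b) For $\mathfrak g_N=\mathfrak{gl}_N$, the coefficients of $\mathbb L_{[N]}(z)$ belong to the center of $\widetilde{\mathcal Y}(\mathfrak{gl}_N)$.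 -/

import Mathlib

noncomputable section

namespace GenYangian

/-! ## Data attached to the classical Lie algebras -/

/-- The three families `gl_N`, `o_N`, `sp_N`. -/
inductive LieType
  | gl
  | o
  | sp

/-- The ground ring `ℂ[[h]]`. -/
abbrev Coef : Type := PowerSeries ℂ

/-- The formal parameter `h`. -/
def h : Coef := PowerSeries.X

/-- The inclusion of the constants `ℂ → ℂ[[h]]`. -/
def cst (a : ℂ) : Coef := PowerSeries.C a

/-- The signs `ε_1, …, ε_N` (the index is shifted by one). -/
def sgn (g : LieType) (N : ℕ) (i : Fin N) : ℂ :=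
  match g with
  | .sp => if i.val < N / 2 then 1 else -1
  | _ => 1

/-- The scalar `κ`; it plays no role for `gl_N`. -/
def kappa (g : LieType) (N : ℕ) : ℂ :=
  match g with
  | .gl => 0
  | .o => N / 2 - 1
  | .sp => N / 2 + 1

/-- The scalar `ε`. -/
def epsLevel (g : LieType) : ℂ :=
  match g with
  | .sp => 2
  | _ => 1

/-- The critical level `c_crit`. -/
def critLevel (g : LieType) (N : ℕ) : ℂ :=
  match g with
  | .gl => -N
  | .o => -N + 2
  | .sp => -(N / 2) - 1

/-- `P = ∑ e_{ij} ⊗ e_{ji}`. -/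
def permOp (N : ℕ) : Matrix (Fin N × Fin N) (Fin N × Fin N) ℂ :=
  fun a b => if a.1 = b.2 ∧ a.2 = b.1 then 1 else 0

/-- `Q = ∑ ε_i ε_j e_{ij} ⊗ e_{i'j'}`, where `i' = N - i + 1` is `Fin.rev i`. -/
def brauerOp (g : LieType) (N : ℕ) : Matrix (Fin N × Fin N) (Fin N × Fin N) ℂ :=
  fun a b => if a.2 = a.1.rev ∧ b.2 = b.1.rev then sgn g N a.1 * sgn g N b.1 else 0

/-- The transposition `A' = (ε_i ε_j a_{j'i'})` on matrices over a `ℂ[[h]]`-algebra. -/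
def prime (g : LieType) {N : ℕ} {B : Type*} [Ring B] [Algebra Coef B]
    (A : Matrix (Fin N) (Fin N) B) : Matrix (Fin N) (Fin N) B :=
  fun i j => cst (sgn g N i * sgn g N j) • A j.rev i.rev

/-- The polynomial `R`-matrix: `u R(u) = u - h P` for `gl_N`, and
`u (u - h κ) R(u) = u (u - h κ) - h (u - h κ) P + h u Q` for `o_N`, `sp_N`. -/
def Rhat (g : LieType) (N : ℕ) :
    Matrix (Fin N × Fin N) (Fin N × Fin N) (Polynomial Coef) :=
  let u : Polynomial Coef := Polynomial.X
  let hh : Polynomial Coef := Polynomial.C h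
  let hk : Polynomial Coef := Polynomial.C (h * cst (kappa g N))
  let P := (permOp N).map (fun a => Polynomial.C (cst a))
  let Q := (brauerOp g N).map (fun a => Polynomial.C (cst a))
  match g with
  | .gl => u • 1 - hh • P
  | _ => (u * (u - hk)) • 1 - (hh * (u - hk)) • P + (hh * u) • Q

/-! ## Completed algebras presented by generators and relations -/

section Completion

variable {A : Type*} [Ring A] [Algebra Coef A]

/-- The inverse limit `lim A / G_p` along a decreasing sequence of two-sided ideals: families of
classes such that the first components, up to any `p`, have a common representative. -/
def limAlg (G : ℕ → TwoSidedIdeal A) : Subalgebra Coef (∀ p, (G p).ringCon.Quotient) where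
  carrier := {x | ∀ p, ∃ a : A, ∀ q ≤ p, x q = (G q).ringCon.mk' a}
  mul_mem' := by
    intro x y hx hy p
    obtain ⟨a, ha⟩ := hx p
    obtain ⟨b, hb⟩ := hy p
    exact ⟨a * b, fun q hq => by simp [ha q hq, hb q hq]⟩
  add_mem' := by
    intro x y hx hy p
    obtain ⟨a, ha⟩ := hx p
    obtain ⟨b, hb⟩ := hy p
    exact ⟨a + b, fun q hq => by simp [ha q hq, hb q hq]⟩
  algebraMap_mem' := fun r _ => ⟨algebraMap Coef A r, fun _ _ => rfl⟩

/-- The completion of `A` with respect to `G`. -/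
abbrev Compl (G : ℕ → TwoSidedIdeal A) : Type _ := limAlg G

/-- The projection of the completion to the quotient `A / G_p`. -/
def proj (G : ℕ → TwoSidedIdeal A) (p : ℕ) (x : Compl G) : (G p).ringCon.Quotient := x.1 p

/-- The inverse limit topology, each `A / G_p` being discrete. All infinite sums in a completion
refer to it. -/
instance (G : ℕ → TwoSidedIdeal A) : TopologicalSpace (Compl G) :=
  ⨅ p, TopologicalSpace.induced (proj G p) ⊥

/-- The canonical map from `A` to its completion. -/
def toCompl (G : ℕ → TwoSidedIdeal A) (a : A) : Compl G :=
  ⟨fun p => (G p).ringCon.mk' a, fun _ => ⟨a, fun _ _ => rfl⟩⟩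

/-- The closure of the two-sided ideal of a completion generated by `S`. -/
def closedIdeal (G : ℕ → TwoSidedIdeal A) (S : Set (Compl G)) : TwoSidedIdeal (Compl G) :=
  ⨅ p, TwoSidedIdeal.span (S ∪ {x | proj G p x = 0})

/-- The closure of the left ideal of a completion generated by `S`. -/
def closedLeftIdeal (G : ℕ → TwoSidedIdeal A) (S : Set (Compl G)) : Ideal (Compl G) :=
  ⨅ p, Ideal.span (S ∪ {x | proj G p x = 0})

end Completion

/-! ## Relations for matrices of formal series

A matrix of formal series `∑_k S_k u^k` is encoded by the family `S` of its coefficients. -/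

section Relations

variable {B : Type*} [Ring B] [Algebra Coef B]

open scoped Kronecker

/-- `S` placed in the first tensor factor of `End ℂ^N ⊗ End ℂ^N`. -/
def leg1 {N : ℕ} (S : Matrix (Fin N) (Fin N) B) : Matrix (Fin N × Fin N) (Fin N × Fin N) B :=
  S ⊗ₖ (1 : Matrix (Fin N) (Fin N) B)

/-- `S` placed in the second tensor factor of `End ℂ^N ⊗ End ℂ^N`. -/
def leg2 {N : ℕ} (S : Matrix (Fin N) (Fin N) B) : Matrix (Fin N × Fin N) (Fin N × Fin N) B :=
  (1 : Matrix (Fin N) (Fin N) B) ⊗ₖ S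

/-- The coefficient of `u^k v^l` in `R̂(u-v) S_1(u) S_2(v) - S_2(v) S_1(u) R̂(u-v)`, obtained from
`(u-v)^e = ∑_s (-1)^s (e choose s) u^{e-s} v^s`; the degree of `R̂` is at most two. -/
def rttDefect (g : LieType) {N : ℕ} (S : ℤ → Matrix (Fin N) (Fin N) B) (k l : ℤ) :
    Matrix (Fin N × Fin N) (Fin N × Fin N) B :=
  ∑ e ∈ Finset.range 3, ∑ s ∈ Finset.range (e + 1),
    ((-1) ^ s * (e.choose s : ℤ)) •
      let Re := (Rhat g N).map (fun q => algebraMap Coef B (q.coeff e))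
      let S1 := leg1 (S (k - ((e : ℤ) - s)))
      let S2 := leg2 (S (l - s))
      Re * S1 * S2 - S2 * S1 * Re

/-- The coefficient of `u^k` in the matrix `S(u) S(u + hκ)' - 1`. Here
`(u + hκ)^b = ∑_j (b choose j) (hκ)^j u^{b-j}`, also for negative `b`, and the sum
runs over the power `a` of `u` in the first factor and over `j`. -/
def crossDefect (g : LieType) {N : ℕ} [TopologicalSpace B] (S : ℤ → Matrix (Fin N) (Fin N) B)
    (k : ℤ) (i m : Fin N) : B :=
  (∑' q : ℤ × ℕ,
    ((Ring.choose (k - q.1 + q.2) q.2 : ℤ) : Coef) • (h * cst (kappa g N)) ^ q.2 •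
      (S q.1 * prime g (S (k - q.1 + q.2))) i m)
  - if k = 0 ∧ i = m then 1 else 0

/-- `divided e d` consists of the elements `x` with `h^e x = d`. In the completed free algebras
below, which are `h`-torsion free, there is at most one. -/
def divided (e : ℕ) (d : B) : Set B := {x | h ^ e • x = d}

/-- The relation `R̂(u-v) S_1(u) S_2(v) = S_2(v) S_1(u) R̂(u-v)`. The series `S` has the form
`1 + O(h)`, so that every coefficient of the difference of the two sides is divisible by `h^2`;
as usual, the common factor `h^2` is cancelled. -/
def rttRel (g : LieType) {N : ℕ} (S : ℤ → Matrix (Fin N) (Fin N) B) : Set B :=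
  {x | ∃ k l a b, x ∈ divided 2 (rttDefect g S k l a b)}

/-- The relation `S(u) S(u + hκ)' = 1`, imposed for `o_N` and `sp_N` only, with the common
factor `h` cancelled. -/
def crossRel (g : LieType) {N : ℕ} [TopologicalSpace B] (S : ℤ → Matrix (Fin N) (Fin N) B) :
    Set B :=
  match g with
  | .gl => ∅
  | _ => {x | ∃ k i m, x ∈ divided 1 (crossDefect g S k i m)}

end Relations

/-! ## The generalized Yangian -/

/-- The free algebra on the symbols `λ_{ij}^{(r)}`, `r ∈ ℤ`. -/
abbrev FreeY (N : ℕ) : Type := FreeAlgebra Coef (Fin N × Fin N × ℤ)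

/-- The filtration defining the topology `τ`: the ideal `G_p` is generated by `h^p` and the
`λ_{ij}^{(-r)}` with `r ≥ p`. -/
def filY (N : ℕ) (p : ℕ) : TwoSidedIdeal (FreeY N) :=
  TwoSidedIdeal.span ({algebraMap Coef (FreeY N) (h ^ p)} ∪
    {x | ∃ (i j : Fin N) (r : ℤ), (p : ℤ) ≤ r ∧ x = FreeAlgebra.ι Coef (i, j, -r)})

/-- The `τ`-completed free algebra. -/
abbrev ComplY (N : ℕ) : Type := Compl (filY N)

/-- The coefficient of `u^k` in the generator matrix `L(u)`, where
`λ_{ij}(u) = δ_{ij} - h ∑_{r ∈ ℤ} λ_{ij}^{(-r)} u^r`. -/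
def serL (N : ℕ) (k : ℤ) : Matrix (Fin N) (Fin N) (ComplY N) :=
  fun i j => (if k = 0 ∧ i = j then 1 else 0)
    - h • toCompl (filY N) (FreeAlgebra.ι Coef (i, j, -k))

/-- The closed two-sided ideal of the defining relations of the generalized Yangian. -/
def idealY (g : LieType) (N : ℕ) : TwoSidedIdeal (ComplY N) :=
  closedIdeal (filY N) (rttRel g (serL N) ∪ crossRel g (serL N))

/-- The generalized Yangian `Ỹ(g_N)`. As every `G_p` contains `h^p`, completing the free
algebra `h`-adically and then with respect to `τ` is the same as completing it with respect
to `τ`, and imposing the relations before or after the completion makes no difference, as long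
as the ideal is closed. -/
abbrev Yang (g : LieType) (N : ℕ) : Type := (idealY g N).ringCon.Quotient

/-- The class in `Ỹ(g_N)` of an element of the completed free algebra. -/
def toYang (g : LieType) (N : ℕ) : ComplY N →+* Yang g N := (idealY g N).ringCon.mk'

/-! ## The double Yangian and its vacuum module -/

/-- The free algebra on the symbols `t_{ij}^{(r)}`, `r ∈ ℤ`, `r ≠ 0`. -/
abbrev FreeD (N : ℕ) : Type := FreeAlgebra Coef (Fin N × Fin N × {r : ℤ // r ≠ 0})

/-- The `h`-adic filtration. -/
def filD (N : ℕ) (p : ℕ) : TwoSidedIdeal (FreeD N) :=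
  TwoSidedIdeal.span {algebraMap Coef (FreeD N) (h ^ p)}

/-- The `h`-adically completed free algebra. -/
abbrev ComplD (N : ℕ) : Type := Compl (filD N)

/-- The generator `t_{ij}^{(r)}`. -/
def genD {N : ℕ} (i j : Fin N) (r : ℤ) (hr : r ≠ 0) : ComplD N :=
  toCompl (filD N) (FreeAlgebra.ι Coef (i, j, ⟨r, hr⟩))

/-- The coefficient of `u^k` in `T^-(u)`: `t^-_{ij}(u) = δ_{ij} + h ∑_{r ≥ 1} t_{ij}^{(r)} u^{-r}`. -/
def serTminus (N : ℕ) (k : ℤ) : Matrix (Fin N) (Fin N) (ComplD N) :=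
  fun i j => (if k = 0 ∧ i = j then 1 else 0)
    + if hk : k < 0 then h • genD i j (-k) (by omega) else 0

/-- The coefficient of `u^k` in `T^+(u)`:
`t^+_{ij}(u) = δ_{ij} - h ∑_{r ≥ 1} t_{ij}^{(-r)} u^{r-1}`. -/
def serTplus (N : ℕ) (k : ℤ) : Matrix (Fin N) (Fin N) (ComplD N) :=
  fun i j => (if k = 0 ∧ i = j then 1 else 0)
    - if hk : 0 ≤ k then h • genD i j (-k - 1) (by omega) else 0

/-- For a series `F(y)` in `y^{-1}`, the expansion of `F(y + s)` in `y^{-1}`. Series in `y^{-1}`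
are power series whose variable stands for `y^{-1}`; here
`(y + s)^{-l} = ∑_j (-l choose j) s^j y^{-l-j}`. -/
def shift (s : ℂ) (F : PowerSeries ℂ) : PowerSeries ℂ :=
  PowerSeries.mk fun k => ∑ l ∈ Finset.range (k + 1),
    PowerSeries.coeff l F * ((Ring.choose (-(l : ℤ)) (k - l) : ℤ) : ℂ) * s ^ (k - l)

/-- The defining properties of the normalizing series `f(y) ∈ 1 + y^{-1} ℂ[[y^{-1}]]`;
they determine it uniquely. -/
def IsNormalizing (g : LieType) (N : ℕ) (f : PowerSeries ℂ) : Prop :=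
  let y : PowerSeries ℂ := PowerSeries.X
  PowerSeries.constantCoeff f = 1 ∧
    f * PowerSeries.rescale (-1) f = (1 - y ^ 2)⁻¹ ∧
    match g with
    | .gl => f * (shift (N : ℂ) f)⁻¹ = (1 - y ^ 2)⁻¹
    | _ => PowerSeries.coeff 1 f = 0 ∧ f * shift (kappa g N) f = (1 - y ^ 2)⁻¹

/-- The normalized `R`-matrix `f(u/h) R(u)` as a series in `(u/h)^{-1}`, i.e.
`f(y) (1 - y^{-1} P + (y - κ)^{-1} Q)` with `y = u/h`, the term with `Q` being absent
for `gl_N`. -/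
def normR (g : LieType) (N : ℕ) (f : PowerSeries ℂ) :
    Matrix (Fin N × Fin N) (Fin N × Fin N) (PowerSeries ℂ) :=
  let w : PowerSeries ℂ := PowerSeries.X
  let P := (permOp N).map (fun a => (PowerSeries.C a : PowerSeries ℂ))
  let Q := (brauerOp g N).map (fun a => (PowerSeries.C a : PowerSeries ℂ))
  match g with
  | .gl => f • (1 - w • P)
  | _ => f • (1 - w • P + (w * (1 - PowerSeries.C (kappa g N) * w)⁻¹) • Q)

/-- The coefficient of `u^{-a} v^b` in the normalized `R`-matrix evaluated at `u - v + h s` and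
expanded in nonnegative powers of `v` and `h`; here
`(u-v)^{-k} = ∑_b (-k choose b) (-1)^b u^{-k-b} v^b`. -/
def rbarCoeff (g : LieType) (N : ℕ) (f : PowerSeries ℂ) (s : ℂ) (a b : ℕ) :
    Matrix (Fin N × Fin N) (Fin N × Fin N) Coef :=
  fun p q => if b ≤ a then
    (Ring.choose (-((a - b : ℕ) : ℤ)) b * (-1) ^ b : ℤ) •
      (h ^ (a - b) * cst (PowerSeries.coeff (a - b) (shift s (normR g N f p q))))
  else 0

/-- The coefficient of `u^{-k} v^l` in
`R̄(u-v+hεc/2) T_1^-(u) T_2^+(v) - T_2^+(v) T_1^-(u) R̄(u-v-hεc/2)`. -/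
def mixedDefect (g : LieType) (N : ℕ) (c : ℂ) (f : PowerSeries ℂ) (k l : ℕ) :
    Matrix (Fin N × Fin N) (Fin N × Fin N) (ComplD N) :=
  ∑ a ∈ Finset.range (k + 1), ∑ b ∈ Finset.range (l + 1),
    let T1 := leg1 (serTminus N (-((k - a : ℕ) : ℤ)))
    let T2 := leg2 (serTplus N ((l - b : ℕ) : ℤ))
    (rbarCoeff g N f (epsLevel g * c / 2) a b).map (algebraMap Coef (ComplD N)) * T1 * T2
      - T2 * T1 * (rbarCoeff g N f (-(epsLevel g * c / 2)) a b).map (algebraMap Coef (ComplD N))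

/-- The mixed relation, with the common factor `h^2` of the coefficients cancelled. -/
def mixedRel (g : LieType) (N : ℕ) (c : ℂ) : Set (ComplD N) :=
  {x | ∃ f, IsNormalizing g N f ∧ ∃ k l p q, x ∈ divided 2 (mixedDefect g N c f k l p q)}

/-- The defining relations of the double Yangian at the level `c`, the central generator being
specialized to `c`. For the series `T^±` the relations written with `R̂(u-v)` are equivalent to
those written with `R(u-v)`. -/
def relD (g : LieType) (N : ℕ) (c : ℂ) : Set (ComplD N) :=
  rttRel g (serTminus N) ∪ rttRel g (serTplus N) ∪ mixedRel g N c
    ∪ crossRel g (serTminus N) ∪ crossRel g (serTplus N)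

/-- The preimage in the completed free algebra of the closed left ideal of the double Yangian at
the level `c` generated by the `t_{ij}^{(r)}` with `r ≥ 1`. -/
def vacIdeal (g : LieType) (N : ℕ) (c : ℂ) : Ideal (ComplD N) :=
  closedLeftIdeal (filD N)
    ({x | x ∈ TwoSidedIdeal.span (relD g N c)} ∪
      {x | ∃ (i j : Fin N) (r : ℤ) (hr : r ≠ 0), 1 ≤ r ∧ x = genD i j r hr})

/-- The vacuum module `V^c(g_N)`, a `ℂ[[h]]`-module. -/
abbrev Vac (g : LieType) (N : ℕ) (c : ℂ) : Type :=
  ComplD N ⧸ (vacIdeal g N c).restrictScalars Coef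

/-- The action `x ↦ x 1` on the vacuum vector. -/
def onVac (g : LieType) (N : ℕ) (c : ℂ) : ComplD N →ₗ[Coef] Vac g N c :=
  ((vacIdeal g N c).restrictScalars Coef).mkQ

/-! ## Idempotents on tensor powers -/

/-- The operator on `(ℂ^N)^{⊗n}` acting as `M` on the tensor factors `a` and `b` and as the
identity on the others. -/
def onLegs {N n : ℕ} (a b : Fin n) (M : Matrix (Fin N × Fin N) (Fin N × Fin N) ℂ) :
    Matrix (Fin n → Fin N) (Fin n → Fin N) ℂ :=
  fun I J => if ∀ c, c ≠ a → c ≠ b → I c = J c then M (I a, I b) (J a, J b) else 0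

/-- The subspace of `(ℂ^N)^{⊗n}` on which all `s_{ab}` act as the identity and all `ε_{ab}` act
as zero, where `s_{ab} ↦ P_{ab}`, `ε_{ab} ↦ Q_{ab}` for `o_N` and `s_{ab} ↦ -P_{ab}`,
`ε_{ab} ↦ -Q_{ab}` for `sp_N`. -/
def brauerInvariants (g : LieType) (N n : ℕ) :
    Submodule ℂ (EuclideanSpace ℂ (Fin n → Fin N)) :=
  let η : ℂ := match g with
    | .sp => -1
    | _ => 1
  ⨅ (a : Fin n) (b : Fin n) (_ : a < b),
    LinearMap.ker (Matrix.toEuclideanLin (η • onLegs a b (permOp N) - 1)) ⊓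
      LinearMap.ker (Matrix.toEuclideanLin (η • onLegs a b (brauerOp g N)))

/-- The operator `E_[n]` on `(ℂ^N)^{⊗n}`. For `gl_N` it is the antisymmetrizer
`(1/n!) ∑_p sgn(p) p`. For `o_N`, `sp_N` it is the action of the idempotent `s^{(n)}` of the Brauer
algebra with `s_{ab} s^{(n)} = s^{(n)} s_{ab} = s^{(n)}` and
`ε_{ab} s^{(n)} = s^{(n)} ε_{ab} = 0`: the projection onto the subspace where `s_{ab} = 1`,
`ε_{ab} = 0`, along the sum of the images of all `1 - s_{ab}` and `ε_{ab}`. The matrices of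
`s_{ab}` and `ε_{ab}` are real and symmetric, so this is the orthogonal projection. -/
def fusionOp (g : LieType) (N n : ℕ) : Matrix (Fin n → Fin N) (Fin n → Fin N) ℂ :=
  match g with
  | .gl => fun I J => (n.factorial : ℂ)⁻¹ *
      ∑ p : Equiv.Perm (Fin n), if I = J ∘ (p⁻¹ : Equiv.Perm (Fin n)) then
        ((Equiv.Perm.sign p : ℤ) : ℂ) else 0
  | _ => fun I J => (brauerInvariants g N n).starProjection (EuclideanSpace.single J (1 : ℂ)) I

/-- The numbers `d_1, …, d_n` with `u_[n] = (u + d_1 h, …, u + d_n h)`: the tuple is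
`(u, u - h, …, u - (n-1)h)` for `gl_N`, `sp_N` and `(u - (n-1)h, …, u - h, u)` for `o_N`. -/
def offset (g : LieType) (n : ℕ) (i : Fin n) : ℂ :=
  match g with
  | .o => -((n : ℂ) - 1 - (i.val : ℂ))
  | _ => -(i.val : ℂ)

/-- The admissible values of `n`: `1 ≤ n ≤ N` for `gl_N`, `o_N` and `1 ≤ n ≤ N/2` for `sp_N`. -/
def Admissible (g : LieType) (N n : ℕ) : Prop :=
  match g with
  | .sp => 1 ≤ n ∧ n ≤ N / 2
  | _ => 1 ≤ n ∧ n ≤ N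

/-- For a series `M(u_1, …, u_n)` with coefficients in `(End ℂ^N)^{⊗n} ⊗ B`, where `M b I J` is the
entry `(I, J)` of the coefficient of `u_1^{b_1} ⋯ u_n^{b_n}`, this is
`tr_{1,…,n} E_[n] M(u_[n])` at `u = 0`. -/
def fusedTrace (g : LieType) (N n : ℕ) {B : Type*} [Ring B] [Algebra Coef B] [TopologicalSpace B]
    (M : (Fin n → ℕ) → Matrix (Fin n → Fin N) (Fin n → Fin N) B) : B :=
  ∑' b : Fin n → ℕ, ∑ I : Fin n → Fin N, ∑ J : Fin n → Fin N,
    (cst (fusionOp g N n I J) * ∏ i, (cst (offset g n i) * h) ^ b i) • M b J I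

/-! ## The module map and the fused series -/

/-- The coefficient of `u_1^{b_1} ⋯ u_m^{b_m}` in `T^+_[m](u) = T_1^+(u_1) ⋯ T_m^+(u_m)`. -/
def multiT (N m : ℕ) (b : Fin m → ℕ) : Matrix (Fin m → Fin N) (Fin m → Fin N) (ComplD N) :=
  fun I J => (List.ofFn fun i => serTplus N (b i) (I i) (J i)).prod

/-- The coefficient of `u_1^{b_1} ⋯ u_m^{b_m} z^k` in
`L_[m](u|z) = L_1(z + u_1) ⋯ L_m(z + u_m)`, where
`(z + u)^a = ∑_b (a choose b) z^{a-b} u^b` also for negative `a`. -/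
def multiL (N m : ℕ) (k : ℤ) (b : Fin m → ℕ) :
    Matrix (Fin m → Fin N) (Fin m → Fin N) (ComplY N) :=
  fun I J => ∑' a : Fin m → ℤ, if ∑ i, (a i - b i) = k then
    ((∏ i, Ring.choose (a i) (b i) : ℤ) : Coef) •
      (List.ofFn fun i => serL N (a i) (I i) (J i)).prod
  else 0

/-- The vector `𝕋^+_[n](0) = tr_{1,…,n} E_[n] T^+_[n](u_[n]) 1` at `u = 0` in `V^crit(g_N)`. -/
def vecT (g : LieType) (N n : ℕ) : Vac g N (critLevel g N) :=
  onVac g N (critLevel g N) (fusedTrace g N n (multiT N n))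

/-- The coefficient of `z^k` in `𝕃_[n](z) = tr_{1,…,n} E_[n] L_[n](u_[n]|z)` at `u = 0`, an element
of the generalized Yangian. -/
def serLL (g : LieType) (N n : ℕ) (k : ℤ) : Yang g N :=
  toYang g N (fusedTrace g N n (multiL N n k))

/-- A `ℂ[[h]]`-module map `Y(·, z)` from `V^crit(g_N)` to the series in `z^{±1}` of operators on
`Ỹ(g_N)`, with `Y v w k` the coefficient of `z^k` in `Y(v, z) w`, is the module map of the
generalized Yangian if `Y(T^+_[m](u) 1, z) = L_[m](u|z)` for all `m`. -/
def IsModuleMap (g : LieType) (N : ℕ)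
    (Y : Vac g N (critLevel g N) →ₗ[Coef] Yang g N →ₗ[Coef] (ℤ → Yang g N)) : Prop :=
  ∀ (m : ℕ) (b : Fin m → ℕ) (I J : Fin m → Fin N) (w : Yang g N) (k : ℤ),
    Y (onVac g N (critLevel g N) (multiT N m b I J)) w k = toYang g N (multiL N m k b I J) * w

end GenYangian

end

/-!
The series `𝕃_[n](z)` is compared with its reduction modulo the ideals `G_p`. Since the ideal of
relations is closed, an identity in the generalized Yangian can be checked in each of the quotients
by `G_p`. In such a quotient `h^p = 0` and `λ_{ij}^{(-r)} = 0` for `r ≥ p`, so `L(u)` becomes a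
Laurent series in `u⁻¹`, all the infinite sums become finite, and the series `L(z + d h)`,
`L(w + d' h)` can be multiplied inside the ring of series in `w⁻¹` with coefficients in the series
in `z⁻¹`. There `z - w + r` with a constant `r` is a regular element (`zw_regular`), although `h` is
nilpotent. The relations with the common factor `h^2` cancelled (`rttDiv`) give three consequences:

* the exchange relation `R̂(a - b) L_1(a) L_2(b) = L_2(b) L_1(a) R̂(a - b)` (`Evaluation.rtt`);
* with `η = 1` for `o_N` and `η = -1` otherwise, the relation
  `e L_1(a) L_2(a + η h) = L_2(a + η h) L_1(a) e` for the idempotent `e = (1 + η P)/2 - Q/N`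
  (the term with `Q` being absent for `gl_N`), obtained at a point where the `R`-matrix degenerates
  (`Evaluation.fused_rtt`);
* for `gl_N`, the exchange relation of `L(a)` and `h⁻¹ (1 - L(b))`, with a commutator as an
  additional term (`Evaluation.rtt_divided`).

The shifts `d_i` increase by `η`, so that a product `L_1(z + d_1 h) ⋯ L_n(z + d_n h)` following
`E_[n]` absorbs the idempotents `e` of adjacent legs, and hence `E_[n]` itself
(`embed_fuseK_legProd`): the operator `E_[n]` is characterized by its relations to these
idempotents (`fusionOp_mul_fuseIdem`, `mul_map_fusionOp`). By the fused Yang–Baxter equation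
(`fused_pair_RK`) the same holds for the products of `R`-matrices which intertwine two such products.
The unitarity `R(x) R(-x) = c(x)` and the cyclicity of the trace for operators with central entries
then show that `c` times the commutator of the traces is zero, with a regular element `c`
(`commute_fused_traces`). This gives part (a).

For part (b) let `n = N` and let one more leg carry `μ(v) = h⁻¹ (1 - L(v))`. The product of the
`R`-matrices between this leg and the others acts on the image of `E_[N]` as a regular scalar, since
the antisymmetrizer on `N + 1` legs vanishes (`embed_fusionOp_mul_sum`), and the additional
commutator terms cancel for the same reason (`mul_divDiff_range`). Thus the quantum determinant
commutes with `μ(v)` itself (`commute_quantum_determinant`), that is, with all generators.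

The identity `Y(𝕋^+_[n](0), z) = 𝕃_[n](z)` holds modulo every `h^p`, where it is a finite linear
combination of instances of the definition of `Y` (`moduleMap_vecT`).
-/

noncomputable section

set_option linter.unusedSectionVars false

namespace GenYangian

/-! ### Completions and the module map -/

section Completion

variable {A : Type*} [Ring A] [Algebra Coef A] (G : ℕ → TwoSidedIdeal A)

/-- The projection of a completion to `A / G_p` as a homomorphism of algebras. -/
def projHom (p : ℕ) : Compl G →ₐ[Coef] (G p).ringCon.Quotient :=
  (Pi.evalAlgHom Coef (fun p => (G p).ringCon.Quotient) p).comp (limAlg G).val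

theorem projHom_apply (p : ℕ) (x : Compl G) : projHom G p x = proj G p x := rfl

theorem compl_ext {x y : Compl G} (hxy : ∀ p, proj G p x = proj G p y) : x = y :=
  Subtype.ext (funext hxy)

/-- Convergence in a completion is eventual equality in every quotient `A / G_p`. -/
theorem tendsto_compl_iff {β : Type*} {F : Filter β} {f : β → Compl G} {x : Compl G} :
    Filter.Tendsto f F (nhds x) ↔ ∀ p, ∀ᶠ b in F, proj G p (f b) = proj G p x := by
  have e : nhds x = ⨅ p, Filter.comap (proj G p) (pure (proj G p x)) := by
    rw [nhds_iInf]
    refine iInf_congr fun p => ?_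
    let _ : TopologicalSpace (G p).ringCon.Quotient := ⊥
    have : DiscreteTopology (G p).ringCon.Quotient := ⟨rfl⟩
    rw [nhds_induced, nhds_discrete]
  rw [e, Filter.tendsto_iInf]
  simp

/-- A family of elements of a completion that tends to zero: all but finitely many members vanish
in every quotient `A / G_p`. -/
def IsNull {β : Type*} (f : β → Compl G) : Prop := ∀ p, {b | proj G p (f b) ≠ 0}.Finite

variable {G}

theorem IsNull.hasSum_aux {β : Type*} {f : β → Compl G} (hf : IsNull G f) :
    ∃ s, HasSum f s := by
  classical
  let T : ℕ → Finset β := fun p => (Finset.range (p + 1)).biUnion fun q => (hf q).toFinset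
  have hT : ∀ p q, q ≤ p → ∀ S, T p ⊆ S → proj G q (∑ b ∈ S, f b) = proj G q (∑ b ∈ T p, f b) := by
    intro p q hq S hS
    simp only [← projHom_apply, map_sum]
    refine (Finset.sum_subset hS fun b _ hb => ?_).symm
    by_contra hne
    exact hb (Finset.mem_biUnion.2 ⟨q, by simpa using Nat.lt_succ_of_le hq,
      (hf q).mem_toFinset.2 hne⟩)
  have hmono : Monotone T := fun p q hpq =>
    Finset.biUnion_subset_biUnion_of_subset_left _ (by simpa using hpq)
  let s : Compl G := ⟨fun p => proj G p (∑ b ∈ T p, f b), by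
    intro p
    obtain ⟨a, ha⟩ := (∑ b ∈ T p, f b).2 p
    exact ⟨a, fun q hq => (hT q q le_rfl _ (hmono hq)).symm.trans (ha q hq)⟩⟩
  refine ⟨s, (tendsto_compl_iff G).2 fun p => ?_⟩
  simp only [SummationFilter.unconditional_filter]
  filter_upwards [Filter.eventually_ge_atTop (T p)] with S hS
  exact hT p p le_rfl S hS

theorem IsNull.hasSum {β : Type*} {f : β → Compl G} (hf : IsNull G f) : HasSum f (∑' b, f b) := by
  obtain ⟨s, hs⟩ := hf.hasSum_aux
  exact hs.summable.hasSum

theorem IsNull.proj_tsum {β : Type*} {f : β → Compl G} (hf : IsNull G f) (p : ℕ) (T : Finset β)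
    (hT : ∀ b ∉ T, proj G p (f b) = 0) : proj G p (∑' b, f b) = proj G p (∑ b ∈ T, f b) := by
  classical
  have h1 := (tendsto_compl_iff G).1 hf.hasSum p
  simp only [SummationFilter.unconditional_filter] at h1
  obtain ⟨S, hS⟩ := (h1.and (Filter.eventually_ge_atTop T)).exists
  rw [← hS.1]
  simp only [← projHom_apply, map_sum]
  exact (Finset.sum_subset hS.2 fun b _ hb => hT b hb).symm

/-- The filtration contains the `h`-adic one. -/
def HAdic (G : ℕ → TwoSidedIdeal A) : Prop := ∀ p, algebraMap Coef A (h ^ p) ∈ G p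

theorem HAdic.proj_smul (hG : HAdic G) {p q : ℕ} (hpq : p ≤ q) (x : Compl G) :
    proj G p (h ^ q • x) = 0 := by
  have h1 : (algebraMap Coef (G p).ringCon.Quotient (h ^ p)) = 0 :=
    (RingCon.eq _).2 ((TwoSidedIdeal.mem_iff _ _).1 (hG p))
  rw [← projHom_apply, map_smul, Algebra.smul_def, ← Nat.sub_add_cancel hpq, pow_add, map_mul, h1]
  simp

/-- A null family whose members outside of a finite set are divisible by `h^p` has a sum which
differs from a finite sum by a multiple of `h^p`; the quotients have to form a null family as well. -/
theorem IsNull.tsum_eq_sum_add_smul {β : Type*} {f g : β → Compl G}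
    (hf : IsNull G f) (hg : IsNull G g) (p : ℕ) (T : Finset β) (h1 : ∀ b ∈ T, g b = 0)
    (h2 : ∀ b ∉ T, f b = h ^ p • g b) : ∑' b, f b = ∑ b ∈ T, f b + h ^ p • ∑' b, g b := by
  classical
  refine compl_ext G fun q => ?_
  let S := T ∪ (hf q).toFinset ∪ (hg q).toFinset
  have e1 := hf.proj_tsum q S (fun b hb => by
    by_contra hne; exact hb (by simp only [S, Finset.mem_union]; left; right; simpa using hne))
  have e2 := hg.proj_tsum q S (fun b hb => by
    by_contra hne; exact hb (by simp only [S, Finset.mem_union]; right; simpa using hne))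
  rw [← projHom_apply, ← projHom_apply, map_add, map_smul, projHom_apply, projHom_apply,
    projHom_apply, e1, e2]
  have e3 : ∑ b ∈ S, f b = ∑ b ∈ T, f b + h ^ p • ∑ b ∈ S, g b := by
    rw [← Finset.sum_sdiff (show T ⊆ S by intro b hb; simp [S, hb]), add_comm,
      ← Finset.sum_sdiff (show T ⊆ S by intro b hb; simp [S, hb]), Finset.sum_eq_zero (s := T) h1,
      add_zero, Finset.smul_sum]
    congr 1
    exact Finset.sum_congr rfl fun b hb => h2 b (Finset.mem_sdiff.1 hb).2
  rw [e3]
  simp only [← projHom_apply, map_add, map_smul]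

end Completion

section FusedTrace

variable {A : Type*} [Ring A] [Algebra Coef A] {G : ℕ → TwoSidedIdeal A}

/-- The multi-indices of total degree less than `p`. -/
def degBox (n p : ℕ) : Finset (Fin n → ℕ) :=
  (Fintype.piFinset fun _ => Finset.range p).filter fun b => ∑ i, b i < p

theorem mem_degBox {n p : ℕ} {b : Fin n → ℕ} : b ∈ degBox n p ↔ ∑ i, b i < p := by
  simp only [degBox, Finset.mem_filter, Fintype.mem_piFinset, Finset.mem_range, and_iff_right_iff_imp]
  exact fun hb i => (Finset.single_le_sum (fun _ _ => Nat.zero_le _) (Finset.mem_univ i)).trans_lt hb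

/-- The summand of `fusedTrace` with index `b`. -/
def fusedTerm (g : LieType) (N n : ℕ) {B : Type*} [Ring B] [Algebra Coef B]
    (M : (Fin n → ℕ) → Matrix (Fin n → Fin N) (Fin n → Fin N) B) (b : Fin n → ℕ) : B :=
  ∑ I : Fin n → Fin N, ∑ J : Fin n → Fin N,
    (cst (fusionOp g N n I J) * ∏ i, (cst (offset g n i) * h) ^ b i) • M b J I

theorem prod_offset_pow (g : LieType) (n : ℕ) (b : Fin n → ℕ) :
    ∏ i, (cst (offset g n i) * h) ^ b i = h ^ (∑ i, b i) * ∏ i, cst (offset g n i) ^ b i := by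
  simp only [mul_pow, Finset.prod_mul_distrib, Finset.prod_pow_eq_pow_sum]
  ring

theorem isNull_of_smul (hG : HAdic G) {n : ℕ} (e : ℕ) (f : (Fin n → ℕ) → Compl G)
    (hf : ∀ b, ∃ x, f b = h ^ (∑ i, b i - e) • x) : IsNull G f := by
  intro p
  refine (degBox n (p + e)).finite_toSet.subset fun b hb => ?_
  rw [Finset.mem_coe, mem_degBox]
  by_contra hlt
  obtain ⟨x, hx⟩ := hf b
  exact hb (by rw [hx]; exact hG.proj_smul (by omega) _)

theorem isNull_fusedTerm (hG : HAdic G) (g : LieType) (N n : ℕ)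
    (M : (Fin n → ℕ) → Matrix (Fin n → Fin N) (Fin n → Fin N) (Compl G)) :
    IsNull G (fusedTerm g N n M) := by
  refine isNull_of_smul hG 0 _ fun b => ⟨∑ I, ∑ J,
    (cst (fusionOp g N n I J) * ∏ i, cst (offset g n i) ^ b i) • M b J I, ?_⟩
  simp only [fusedTerm, Finset.smul_sum, smul_smul, prod_offset_pow, Nat.sub_zero]
  simp only [mul_left_comm]

/-- Modulo `h^p`, only finitely many summands contribute to `fusedTrace`. -/
theorem fusedTrace_eq_sum_add (hG : HAdic G) (g : LieType) (N n : ℕ)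
    (M : (Fin n → ℕ) → Matrix (Fin n → Fin N) (Fin n → Fin N) (Compl G)) (p : ℕ) :
    ∃ y, fusedTrace g N n M = ∑ b ∈ degBox n p, fusedTerm g N n M b + h ^ p • y := by
  classical
  let c : (Fin n → ℕ) → Compl G := fun b => ∑ I, ∑ J,
    (cst (fusionOp g N n I J) * ∏ i, cst (offset g n i) ^ b i) • M b J I
  let y : (Fin n → ℕ) → Compl G := fun b =>
    if b ∈ degBox n p then 0 else h ^ (∑ i, b i - p) • c b
  have e : fusedTrace g N n M = ∑' b, fusedTerm g N n M b := rfl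
  rw [e]
  refine ⟨∑' b, y b, IsNull.tsum_eq_sum_add_smul (isNull_fusedTerm hG g N n M)
    (isNull_of_smul hG p y fun b => ?_) p _ (fun b hb => if_pos hb) fun b hb => ?_⟩
  · by_cases hb : b ∈ degBox n p
    · exact ⟨0, by rw [smul_zero]; exact if_pos hb⟩
    · exact ⟨c b, if_neg hb⟩
  · simp only [y, hb, if_false, smul_smul, ← pow_add]
    rw [mem_degBox, not_lt] at hb
    rw [Nat.add_sub_cancel' hb]
    simp only [c, fusedTerm, Finset.smul_sum, smul_smul, prod_offset_pow]
    simp only [mul_left_comm]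

end FusedTrace

section ModuleMap

theorem hAdic_filY (N : ℕ) : HAdic (filY N) := fun _ =>
  TwoSidedIdeal.subset_span (Or.inl rfl)

theorem hAdic_filD (N : ℕ) : HAdic (filD N) := fun _ =>
  TwoSidedIdeal.subset_span rfl

/-- The quotient of the completed free algebra by the relations and the elements vanishing
modulo `G_p`. -/
def truncIdeal (g : LieType) (N p : ℕ) : TwoSidedIdeal (ComplY N) :=
  TwoSidedIdeal.span ((rttRel g (serL N) ∪ crossRel g (serL N)) ∪ {x | proj (filY N) p x = 0})

/-- Equality in the generalized Yangian can be tested modulo every `G_p`. -/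
theorem toYang_eq_iff (g : LieType) (N : ℕ) {x y : ComplY N} :
    toYang g N x = toYang g N y ↔ ∀ p, x - y ∈ truncIdeal g N p := by
  have : toYang g N x = toYang g N y ↔ x - y ∈ idealY g N :=
    (RingCon.eq _).trans (TwoSidedIdeal.rel_iff _ _ _)
  rw [this, idealY, closedIdeal, TwoSidedIdeal.mem_iInf]
  rfl

theorem toYang_smul (g : LieType) (N : ℕ) (r : Coef) (x : ComplY N) :
    toYang g N (r • x) = r • toYang g N x := rfl

theorem toYang_add (g : LieType) (N : ℕ) (x y : ComplY N) :
    toYang g N (x + y) = toYang g N x + toYang g N y := RingHom.map_add _ x y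

theorem toYang_sub (g : LieType) (N : ℕ) (x y : ComplY N) :
    toYang g N (x - y) = toYang g N x - toYang g N y := RingHom.map_sub _ x y

theorem toYang_mul (g : LieType) (N : ℕ) (x y : ComplY N) :
    toYang g N (x * y) = toYang g N x * toYang g N y := RingHom.map_mul _ x y

theorem toYang_surjective (g : LieType) (N : ℕ) : Function.Surjective (toYang g N) :=
  RingCon.mk'_surjective _

/-- The generalized Yangian is `h`-adically separated. -/
theorem yang_separated (g : LieType) (N : ℕ) {x y : Yang g N}
    (hxy : ∀ p, ∃ z, x - y = h ^ p • z) : x = y := by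
  obtain ⟨x, rfl⟩ := toYang_surjective g N x
  obtain ⟨y, rfl⟩ := toYang_surjective g N y
  refine (toYang_eq_iff g N).2 fun p => ?_
  obtain ⟨z, hz⟩ := hxy p
  obtain ⟨z, rfl⟩ := toYang_surjective g N z
  rw [← toYang_sub, ← toYang_smul] at hz
  have h1 := (toYang_eq_iff g N).1 hz p
  have h2 : h ^ p • z ∈ truncIdeal g N p :=
    TwoSidedIdeal.subset_span (Or.inr ((hAdic_filY N).proj_smul le_rfl z))
  simpa using TwoSidedIdeal.add_mem _ h1 h2

/-- A module map is only assumed to be `ℂ[[h]]`-linear, without continuity. The infinite sum defining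
`𝕋^+_[n](0)` is a finite one modulo each `h^p`, and the Yangian is `h`-adically separated. -/
theorem moduleMap_vecT (g : LieType) (N : ℕ)
    (Y : Vac g N (critLevel g N) →ₗ[Coef] Yang g N →ₗ[Coef] (ℤ → Yang g N))
    (hY : IsModuleMap g N Y) (n : ℕ) (w : Yang g N) (k : ℤ) :
    Y (vecT g N n) w k = serLL g N n k * w := by
  refine yang_separated g N fun p => ?_
  obtain ⟨y, hy⟩ := fusedTrace_eq_sum_add (hAdic_filD N) g N n (multiT N n) p
  obtain ⟨y', hy'⟩ := fusedTrace_eq_sum_add (hAdic_filY N) g N n (multiL N n k) p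
  refine ⟨Y (onVac g N (critLevel g N) y) w k - toYang g N y' * w, ?_⟩
  rw [vecT, serLL, hy, hy']
  simp only [LinearMap.map_add, LinearMap.map_smul, toYang_add, toYang_smul, LinearMap.add_apply, LinearMap.smul_apply,
    Pi.add_apply, Pi.smul_apply, add_mul, smul_mul_assoc, smul_sub]
  have key : Y (onVac g N (critLevel g N) (∑ b ∈ degBox n p, fusedTerm g N n (multiT N n) b)) w k
      = toYang g N (∑ b ∈ degBox n p, fusedTerm g N n (multiL N n k) b) * w := by
    simp only [fusedTerm, map_sum, LinearMap.map_smul, toYang_smul, LinearMap.sum_apply,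
      LinearMap.smul_apply, Finset.sum_apply, Pi.smul_apply, Finset.sum_mul, smul_mul_assoc]
    refine Finset.sum_congr rfl fun b _ => Finset.sum_congr rfl fun I _ =>
      Finset.sum_congr rfl fun J _ => ?_
    rw [hY]
  rw [key]
  abel

end ModuleMap

/-! ### Laurent series and shifts of the variable -/

section

open HahnSeries

section Sequences

variable {V : Type*} [AddCommGroup V] [Module Coef V]

/-- The shift of a sequence; on the series `∑ f_k z^k` it is the multiplication by `z`. -/
def sh : (ℤ → V) →ₗ[Coef] (ℤ → V) where
  toFun f k := f (k - 1)
  map_add' _ _ := rfl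
  map_smul' _ _ := rfl

/-- The coefficients of `∑ f_k (z + t)^k`, when `t^p` acts as zero. -/
def sig (p : ℕ) (t : Coef) : (ℤ → V) →ₗ[Coef] (ℤ → V) where
  toFun f k := ∑ b ∈ Finset.range p, ((Ring.choose (k + b) b : ℤ) : Coef) • t ^ b • f (k + b)
  map_add' f g := by
    ext k
    simp [smul_add, Finset.sum_add_distrib]
  map_smul' r f := by
    ext k
    simp only [Pi.smul_apply, Finset.smul_sum, RingHom.id_apply]
    refine Finset.sum_congr rfl fun b _ => ?_
    simp only [smul_smul]
    ring_nf

theorem sh_apply (f : ℤ → V) (k : ℤ) : sh f k = f (k - 1) := rfl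

theorem sig_apply (p : ℕ) (t : Coef) (f : ℤ → V) (k : ℤ) : sig p t f k =
    ∑ b ∈ Finset.range p, ((Ring.choose (k + b) b : ℤ) : Coef) • t ^ b • f (k + b) := rfl

/-- The substitution `u = z + t` turns the multiplication by `u` into that by `z + t`. -/
theorem sig_sh (p : ℕ) (t : Coef) (ht : ∀ v : V, t ^ p • v = 0) (f : ℤ → V) :
    sig p t (sh f) = sh (sig p t f) + t • sig p t f := by
  ext k
  simp only [Pi.add_apply, Pi.smul_apply, sig_apply, sh_apply]
  cases p with
  | zero => simp
  | succ p =>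
    rw [Finset.sum_range_succ' _ p, Finset.sum_range_succ' _ p, Finset.sum_range_succ _ p,
      smul_add, Finset.smul_sum, smul_comm t, smul_smul t, ← pow_succ', ht, smul_zero, add_zero,
      add_right_comm, ← Finset.sum_add_distrib]
    congr 1
    · refine Finset.sum_congr rfl fun b _ => ?_
      have e : Ring.choose (k + ((b + 1 : ℕ) : ℤ)) (b + 1)
          = Ring.choose (k + (b : ℤ)) b + Ring.choose (k - 1 + ((b + 1 : ℕ) : ℤ)) (b + 1) := by
        have h1 := Ring.choose_succ_succ (k + (b : ℤ)) b
        rw [show k + ((b + 1 : ℕ) : ℤ) = k + b + 1 by push_cast; ring,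
          show k - 1 + ((b + 1 : ℕ) : ℤ) = k + b by push_cast; ring, h1]
      rw [e, show k + ((b + 1 : ℕ) : ℤ) - 1 = k + b by push_cast; ring,
        show k - 1 + ((b + 1 : ℕ) : ℤ) = k + b by push_cast; ring, Int.cast_add, add_smul, add_comm,
        pow_succ', smul_comm t, smul_smul t]
    · simp

/-- A sequence whose members with index at least `n` vanish. -/
def Bd (n : ℤ) (f : ℤ → V) : Prop := ∀ k, n ≤ k → f k = 0

theorem Bd.sig {n : ℤ} {f : ℤ → V} (hf : Bd n f) (p : ℕ) (t : Coef) : Bd n (sig p t f) :=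
  fun k hk => by
    rw [sig_apply]
    exact Finset.sum_eq_zero fun b _ => by rw [hf _ (by omega), smul_zero, smul_zero]

/-- A double sequence whose members with one index at least `n` vanish. -/
def Bd₂ (n : ℤ) (c : ℤ → ℤ → V) : Prop := ∀ k l, n ≤ k ∨ n ≤ l → c k l = 0

/-- `∑_{k < P} f_k z^k` as a Hahn series in `z⁻¹`. -/
def lau (P : ℤ) : (ℤ → V) →ₗ[Coef] HahnSeries ℤ V where
  toFun f := ofSuppBddBelow (fun n => if -n < P then f (-n) else 0) ⟨-P, fun n hn => by
    by_contra hlt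
    exact hn (if_neg (by omega))⟩
  map_add' f g := by
    ext n
    simp only [coeff_add, Pi.add_apply, ofSuppBddBelow]
    split_ifs <;> simp
  map_smul' r f := by
    ext n
    simp only [coeff_smul, Pi.smul_apply, ofSuppBddBelow, RingHom.id_apply]
    split_ifs <;> simp

theorem coeff_lau (P : ℤ) (f : ℤ → V) (n : ℤ) :
    (lau P f).coeff n = if -n < P then f (-n) else 0 := rfl

theorem coeff_lau_of_bd {P : ℤ} {f : ℤ → V} (hf : Bd P f) (n : ℤ) :
    (lau P f).coeff n = f (-n) := by
  rw [coeff_lau]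
  split_ifs with hn
  · rfl
  · rw [hf _ (by omega)]

end Sequences

section Variable

variable {B : Type*} [Ring B]

/-- The variable `z` in the ring of series in `z⁻¹`. -/
def zvar (B : Type*) [Ring B] : HahnSeries ℤ B := single (-1) 1

theorem coeff_zvar_mul (x : HahnSeries ℤ B) (n : ℤ) : (zvar B * x).coeff n = x.coeff (n + 1) := by
  have := coeff_single_mul (r := (1 : B)) (x := x) (a := n) (b := -1)
  rw [zvar, this, one_mul, sub_neg_eq_add]

theorem zvar_comm (x : HahnSeries ℤ B) : zvar B * x = x * zvar B := by
  ext n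
  have := coeff_mul_single (r := (1 : B)) (x := x) (a := n) (b := -1)
  rw [coeff_zvar_mul, zvar, this, mul_one, sub_neg_eq_add]

end Variable

section Laurent

variable {B : Type*} [Ring B] [Algebra Coef B]

theorem lau_sh {P : ℤ} {f : ℤ → B} (hf : Bd (P - 1) f) : lau P (sh f) = zvar B * lau P f := by
  ext n
  rw [coeff_zvar_mul, coeff_lau, coeff_lau, sh_apply, show -(n + 1) = -n - 1 by ring]
  by_cases h1 : -n < P
  · rw [if_pos h1, if_pos (by omega)]
  · rw [if_neg h1]
    split_ifs
    · rw [hf _ (by omega)]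
    · rfl

theorem lau_single {P : ℤ} (hP : 0 < P) (b : B) :
    lau P (fun k => if k = 0 then b else 0) = C b := by
  ext n
  rw [coeff_lau, C_apply, coeff_single]
  by_cases hn : n = 0 <;> simp [hn, hP]

/-- The coefficients of a product of two series bounded above in `z`, as finite sums. -/
theorem coeff_lau_mul (P Q : ℤ) (f g : ℤ → B) (n : ℤ) : (lau P f * lau Q g).coeff n =
    ∑ k ∈ Finset.Ioo (-n - Q) P, f k * g (-n - k) := by
  have hs : (Set.Ioi (-P)).IsPWO := by
    have : (Set.Ioi (-P)).IsWF := (Set.wellFoundedOn_iff_no_descending_seq.2 fun F hF => by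
      have h1 : ∀ i : ℕ, F i ≤ F 0 - i := by
        intro i
        induction i with
        | zero => simp
        | succ i ih =>
          have := F.map_rel_iff.2 (show i + 1 > i by omega)
          push_cast; omega
      have h2 := h1 (F 0 + P).toNat
      have h3 := hF (F 0 + P).toNat
      have h4 := hF 0
      simp only [Set.mem_Ioi] at h3 h4
      omega)
    exact this.isPWO
  rw [coeff_mul_left' hs]
  · symm
    refine Finset.sum_bij_ne_zero (fun k _ _ => (-k, n + k)) ?_ ?_ ?_ ?_
    · intro k hk hne
      rw [Finset.mem_Ioo] at hk
      rw [Finset.mem_antidiagonal]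
      refine ⟨by simpa using hk.2, ?_, by simp⟩
      rw [mem_support, coeff_lau, if_pos (by omega), show -(n + k) = -n - k by ring]
      exact fun h0 => hne (by rw [h0, mul_zero])
    · intro a _ _ b _ _ hab
      simpa using (Prod.mk.inj hab).1
    · rintro ⟨i, j⟩ hij hne
      rw [Finset.mem_antidiagonal] at hij
      obtain ⟨hi, hj, hs⟩ := hij
      simp only [Set.mem_Ioi] at hi
      simp only [coeff_lau] at hne
      have hj' : -j < Q := by
        by_contra h0
        rw [if_neg h0, mul_zero] at hne
        exact hne rfl
      rw [if_pos (by omega), if_pos hj'] at hne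
      simp only at hs
      refine ⟨-i, Finset.mem_Ioo.2 ⟨by omega, by omega⟩, ?_, ?_⟩
      · rwa [show -n - -i = -j by omega]
      · rw [Prod.mk.injEq]; omega
    · intro k hk _
      rw [Finset.mem_Ioo] at hk
      rw [coeff_lau, coeff_lau, if_pos (by omega), if_pos (by omega), neg_neg,
        show -(n + k) = -n - k by ring]
  · intro m hm
    rw [mem_support, coeff_lau] at hm
    by_contra h0
    exact hm (if_neg (by simpa [neg_lt] using h0))

/-- The series `∑_{k, l < P} c_{kl} z^{k+l}`. -/
def diag2 (P : ℤ) : (ℤ → ℤ → B) →ₗ[Coef] HahnSeries ℤ B where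
  toFun c := ofSuppBddBelow (fun n => ∑ k ∈ Finset.Ioo (-n - P) P, c k (-n - k)) ⟨-2 * P,
    fun n hn => by
      by_contra hlt
      refine hn (Finset.sum_eq_zero fun k hk => ?_)
      rw [Finset.mem_Ioo] at hk
      omega⟩
  map_add' c c' := by
    ext n
    simp [ofSuppBddBelow, Finset.sum_add_distrib]
  map_smul' r c := by
    ext n
    simp [ofSuppBddBelow, Finset.smul_sum]

theorem coeff_diag2 (P : ℤ) (c : ℤ → ℤ → B) (n : ℤ) :
    (diag2 P c).coeff n = ∑ k ∈ Finset.Ioo (-n - P) P, c k (-n - k) := rfl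

theorem diag2_mul (P : ℤ) (f g : ℤ → B) :
    diag2 P (fun k l => f k * g l) = lau P f * lau P g := by
  ext n
  rw [coeff_diag2, coeff_lau_mul]

theorem diag2_mul' (P : ℤ) (f g : ℤ → B) :
    diag2 P (fun k l => g l * f k) = lau P g * lau P f := by
  ext n
  rw [coeff_diag2, coeff_lau_mul]
  refine Finset.sum_bij (fun k _ => -n - k) ?_ ?_ ?_ ?_
  · intro k hk
    rw [Finset.mem_Ioo] at *
    omega
  · intro a _ b _ hab
    omega
  · intro l hl
    rw [Finset.mem_Ioo] at hl
    exact ⟨-n - l, by rw [Finset.mem_Ioo]; omega, by ring⟩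
  · intro k _
    rw [sub_sub_cancel]

theorem diag2_sh_left {P : ℤ} {c : ℤ → ℤ → B} (hc : Bd₂ (P - 1) c) :
    diag2 P (sh c) = zvar B * diag2 P c := by
  ext n
  rw [coeff_zvar_mul, coeff_diag2, coeff_diag2]
  symm
  refine Finset.sum_bij_ne_zero (fun k _ _ => k + 1) ?_ ?_ ?_ ?_
  · intro k hk hne
    rw [Finset.mem_Ioo] at *
    have : ¬ (P - 1 ≤ k) := fun h0 => hne (hc _ _ (Or.inl h0))
    omega
  · intro a _ _ b _ _ hab
    omega
  · intro k hk hne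
    rw [Finset.mem_Ioo] at hk
    rw [sh_apply] at hne
    have : ¬ (P - 1 ≤ -n - k) := fun h0 => hne (hc _ _ (Or.inr h0))
    refine ⟨k - 1, by rw [Finset.mem_Ioo]; omega, ?_, by ring⟩
    rwa [show -(n + 1) - (k - 1) = -n - k by ring]
  · intro k _ _
    rw [sh_apply, add_sub_cancel_right, show -n - (k + 1) = -(n + 1) - k by ring]

theorem diag2_sh_right {P : ℤ} {c : ℤ → ℤ → B} (hc : Bd₂ (P - 1) c) :
    diag2 P (fun k => sh (c k)) = zvar B * diag2 P c := by
  ext n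
  rw [coeff_zvar_mul, coeff_diag2, coeff_diag2]
  simp only [sh_apply]
  refine Finset.sum_subset_zero_on_sdiff ?_ ?_ ?_
  · intro k hk
    rw [Finset.mem_Ioo] at *
    omega
  · intro k hk
    rw [Finset.mem_sdiff, Finset.mem_Ioo, Finset.mem_Ioo] at hk
    exact hc _ _ (Or.inr (by omega))
  · intro k _
    rw [show -n - k - 1 = -(n + 1) - k by ring]

/-- The series `∑_{k, l < P} c_{kl} z^k w^l`. -/
def mix2 (P : ℤ) : (ℤ → ℤ → B) →ₗ[Coef] HahnSeries ℤ (HahnSeries ℤ B) where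
  toFun c := lau P fun l => lau P fun k => c k l
  map_add' c c' := by
    rw [← map_add]
    congr 1
    ext1 l
    exact map_add (lau P) (fun k => c k l) (fun k => c' k l)
  map_smul' r c := by
    rw [← map_smul]
    congr 1
    ext1 l
    exact map_smul (lau P) r (fun k => c k l)

theorem mix2_apply (P : ℤ) (c : ℤ → ℤ → B) : mix2 P c = lau P fun l => lau P fun k => c k l := rfl

/-- The series `∑_{l < P} g_l w^l`, as a series in `w⁻¹` over the series in `z⁻¹`. -/
def wlau (P : ℤ) (g : ℤ → B) : HahnSeries ℤ (HahnSeries ℤ B) := lau P fun l => C (g l)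

theorem coeff_C_mul' {A : Type*} [Ring A] (a : A) (x : HahnSeries ℤ A) (n : ℤ) :
    (C a * x).coeff n = a * x.coeff n := by
  rw [C_apply, coeff_single_zero_mul]

theorem coeff_mul_C' {A : Type*} [Ring A] (a : A) (x : HahnSeries ℤ A) (n : ℤ) :
    (x * C a).coeff n = x.coeff n * a := by
  rw [C_apply, coeff_mul_single_zero]

theorem mix2_mul (P : ℤ) (f g : ℤ → B) :
    mix2 P (fun k l => f k * g l) = C (lau P f) * wlau P g := by
  ext n m
  rw [coeff_C_mul', mix2_apply, wlau, coeff_lau, coeff_lau]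
  by_cases hn : -n < P
  · rw [if_pos hn, if_pos hn, coeff_mul_C', coeff_lau, coeff_lau, ite_mul, zero_mul]
  · rw [if_neg hn, if_neg hn, mul_zero]

theorem mix2_mul' (P : ℤ) (f g : ℤ → B) :
    mix2 P (fun k l => g l * f k) = wlau P g * C (lau P f) := by
  ext n m
  rw [coeff_mul_C', mix2_apply, wlau, coeff_lau, coeff_lau]
  by_cases hn : -n < P
  · rw [if_pos hn, if_pos hn, coeff_C_mul', coeff_lau, coeff_lau, mul_ite, mul_zero]
  · rw [if_neg hn, if_neg hn, zero_mul]

theorem mix2_sh_left {P : ℤ} {c : ℤ → ℤ → B} (hc : Bd₂ (P - 1) c) :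
    mix2 P (sh c) = C (zvar B) * mix2 P c := by
  ext1; ext1 n
  rw [coeff_C_mul', mix2_apply, mix2_apply, coeff_lau, coeff_lau, mul_ite, mul_zero]
  congr 1
  exact lau_sh fun k hk => hc _ _ (Or.inl hk)

theorem mix2_sh_right {P : ℤ} {c : ℤ → ℤ → B} (hc : Bd₂ (P - 1) c) :
    mix2 P (fun k => sh (c k)) = zvar _ * mix2 P c := by
  rw [mix2_apply, mix2_apply, ← lau_sh]
  · rfl
  · intro l hl
    have : (fun k => c k l) = 0 := funext fun k => hc _ _ (Or.inr hl)
    change lau P (fun k => c k l) = 0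
    rw [this, map_zero]

end Laurent

end

/-! ### The divided relation -/

section

open HahnSeries

section DividedRelation

/-- Complex matrices as matrices over a `ℂ[[h]]`-algebra. -/
def cmat {m : Type*} [Fintype m] [DecidableEq m] (B : Type*) [Ring B] [Algebra Coef B] :
    Matrix m m ℂ →+* Matrix m m B :=
  ((algebraMap Coef B).comp (PowerSeries.C : ℂ →+* Coef)).mapMatrix

theorem cmat_apply {m : Type*} [Fintype m] [DecidableEq m] (B : Type*) [Ring B] [Algebra Coef B]
    (A : Matrix m m ℂ) (i j : m) : cmat B A i j = algebraMap Coef B (cst (A i j)) := rfl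

variable {B : Type*} [Ring B] [Algebra Coef B] {N : ℕ}

/-- The multiplication of a double series by `u - v`. -/
def mulDiff {V : Type*} [AddCommGroup V] (c : ℤ → ℤ → V) (k l : ℤ) : V := c (k - 1) l - c k (l - 1)

/-- The coefficients of `[μ_1(u), μ_2(v)]`. -/
def legComm (μ : ℤ → Matrix (Fin N) (Fin N) B) (k l : ℤ) :
    Matrix (Fin N × Fin N) (Fin N × Fin N) B :=
  leg1 (μ k) * leg2 (μ l) - leg2 (μ l) * leg1 (μ k)

/-- The coefficients of `[A, μ_1(u) + μ_2(v)] - h (A μ_1(u) μ_2(v) - μ_2(v) μ_1(u) A)`, which is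
`-h⁻¹ (A L_1(u) L_2(v) - L_2(v) L_1(u) A)` for `L = 1 - h μ`. -/
def legTwist (A : Matrix (Fin N × Fin N) (Fin N × Fin N) ℂ) (μ : ℤ → Matrix (Fin N) (Fin N) B)
    (k l : ℤ) : Matrix (Fin N × Fin N) (Fin N × Fin N) B :=
  cmat B A * leg1 (μ k) * (if l = 0 then 1 else 0) + cmat B A * leg2 (μ l) * (if k = 0 then 1 else 0)
    - leg1 (μ k) * cmat B A * (if l = 0 then 1 else 0)
    - leg2 (μ l) * cmat B A * (if k = 0 then 1 else 0)
    - h • (cmat B A * (leg1 (μ k) * leg2 (μ l)) - leg2 (μ l) * leg1 (μ k) * cmat B A)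

/-- The relation `R̂(u-v) L_1(u) L_2(v) = L_2(v) L_1(u) R̂(u-v)` for `L = 1 - h μ`, divided by
`h^2`. -/
def rttDiv (g : LieType) (μ : ℤ → Matrix (Fin N) (Fin N) B) (k l : ℤ) :
    Matrix (Fin N × Fin N) (Fin N × Fin N) B :=
  match g with
  | .gl => mulDiff (legComm μ) k l + legTwist (permOp N) μ k l
  | g => mulDiff (fun k l => mulDiff (legComm μ) k l - (h * cst (kappa g N)) • legComm μ k l
      + legTwist (permOp N - brauerOp g N) μ k l) k l
      - (h * cst (kappa g N)) • legTwist (permOp N) μ k l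

/-- The coefficients of the series `1 - h μ(u)`. -/
def oneSub (μ : ℤ → Matrix (Fin N) (Fin N) B) (k : ℤ) : Matrix (Fin N) (Fin N) B :=
  (if k = 0 then 1 else 0) - h • μ k

theorem leg1_oneSub (μ : ℤ → Matrix (Fin N) (Fin N) B) (k : ℤ) :
    leg1 (oneSub μ k) = (if k = 0 then 1 else 0) - h • leg1 (μ k) := by
  ext ⟨a, b⟩ ⟨c, d⟩
  by_cases hk : k = 0 <;> by_cases h1 : a = c <;> by_cases h2 : b = d <;>
    simp [leg1, oneSub, Matrix.kroneckerMap_apply, hk, h1, h2]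

theorem leg2_oneSub (μ : ℤ → Matrix (Fin N) (Fin N) B) (k : ℤ) :
    leg2 (oneSub μ k) = (if k = 0 then 1 else 0) - h • leg2 (μ k) := by
  ext ⟨a, b⟩ ⟨c, d⟩
  by_cases hk : k = 0 <;> by_cases h1 : a = c <;> by_cases h2 : b = d <;>
    simp [leg2, oneSub, Matrix.kroneckerMap_apply, hk, h1, h2]

theorem Rhat_gl_coeff (e : ℕ) :
    (Rhat .gl N).map (fun q => algebraMap Coef B (q.coeff e)) =
      (if e = 1 then 1 else 0) - if e = 0 then h • cmat B (permOp N) else 0 := by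
  ext p q
  rcases e with _ | _ | e <;> by_cases hpq : p = q <;>
    simp [Rhat, hpq, cmat_apply, Polynomial.coeff_X, Polynomial.coeff_C] <;>
    simp [Algebra.smul_def]

theorem Rhat_coeff (g : LieType) (hg : g ≠ .gl) (e : ℕ) :
    (Rhat g N).map (fun q => algebraMap Coef B (q.coeff e)) =
      (if e = 2 then 1 else 0) - (if e = 1 then (h * cst (kappa g N)) • 1
        + h • cmat B (permOp N - brauerOp g N) else 0)
        + if e = 0 then (h * (h * cst (kappa g N))) • cmat B (permOp N) else 0 := by
  have key : ∀ a b : Coef, ∀ d : Polynomial Coef, (d = 0 ∨ d = 1) →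
      ((Polynomial.X * (Polynomial.X - Polynomial.C (h * cst (kappa g N)))) * d
        - (Polynomial.C h * (Polynomial.X - Polynomial.C (h * cst (kappa g N)))) * Polynomial.C a
        + (Polynomial.C h * Polynomial.X) * Polynomial.C b).coeff e =
      (if e = 2 then d.coeff 0 else 0) - (if e = 1 then (h * cst (kappa g N)) * d.coeff 0
        + h * (a - b) else 0) + if e = 0 then (h * (h * cst (kappa g N))) * a else 0 := by
    intro a b d hd
    have e1 : (Polynomial.X * (Polynomial.X - Polynomial.C (h * cst (kappa g N)))) * d
        - (Polynomial.C h * (Polynomial.X - Polynomial.C (h * cst (kappa g N)))) * Polynomial.C a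
        + (Polynomial.C h * Polynomial.X) * Polynomial.C b =
        Polynomial.C (d.coeff 0) * Polynomial.X ^ 2
        - Polynomial.C ((h * cst (kappa g N)) * d.coeff 0 + h * (a - b)) * Polynomial.X ^ 1
        + Polynomial.C ((h * (h * cst (kappa g N))) * a) * Polynomial.X ^ 0 := by
      rcases hd with rfl | rfl <;> simp only [Polynomial.coeff_zero, Polynomial.coeff_one_zero,
        map_mul, map_add, map_sub, map_zero, map_one] <;> ring
    rw [e1, Polynomial.coeff_add, Polynomial.coeff_sub]
    simp only [Polynomial.coeff_C_mul_X_pow]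
  ext p q
  have e2 : (Rhat g N) p q =
      (Polynomial.X * (Polynomial.X - Polynomial.C (h * cst (kappa g N)))) * (if p = q then 1 else 0)
        - (Polynomial.C h * (Polynomial.X - Polynomial.C (h * cst (kappa g N))))
          * Polynomial.C (cst (permOp N p q))
        + (Polynomial.C h * Polynomial.X) * Polynomial.C (cst (brauerOp g N p q)) := by
    cases g with
    | gl => exact absurd rfl hg
    | o => simp [Rhat, Matrix.one_apply]
    | sp => simp [Rhat, Matrix.one_apply]
  have e3 : (if p = q then (1 : Polynomial Coef) else 0).coeff 0 = if p = q then 1 else 0 := by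
    split_ifs <;> simp
  rw [Matrix.map_apply, e2, key _ _ _ (by split_ifs <;> simp), e3]
  rcases e with _ | _ | _ | e <;> by_cases hpq : p = q <;>
    simp [hpq, cmat_apply, cst] <;> simp [Algebra.smul_def, mul_assoc]

/-- The coefficients of the defining relation are divisible by `h^2`, with the explicit quotient
`rttDiv`. -/
theorem rttDefect_eq (g : LieType) (μ : ℤ → Matrix (Fin N) (Fin N) B) (k l : ℤ) :
    rttDefect g (oneSub μ) k l = h ^ 2 • rttDiv g μ k l := by
  have hw : ∀ (A : Matrix (Fin N × Fin N) (Fin N × Fin N) ℂ) (k l : ℤ),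
      cmat B A * leg1 (oneSub μ k) * leg2 (oneSub μ l)
        - leg2 (oneSub μ l) * leg1 (oneSub μ k) * cmat B A = -(h • legTwist A μ k l) := by
    intro A k l
    rw [leg1_oneSub, leg2_oneSub, legTwist]
    by_cases hk : k = 0 <;> by_cases hl : l = 0 <;>
      simp only [hk, hl, if_true, if_false, mul_sub, sub_mul, mul_one, one_mul, smul_sub, smul_add,
        zero_mul, mul_zero, mul_smul_comm, smul_mul_assoc, mul_assoc, smul_smul, smul_zero] <;> abel
  have hc : ∀ k l : ℤ, leg1 (oneSub μ k) * leg2 (oneSub μ l)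
        - leg2 (oneSub μ l) * leg1 (oneSub μ k) = h ^ 2 • legComm μ k l := by
    intro k l
    rw [leg1_oneSub, leg2_oneSub, legComm, pow_two]
    by_cases hk : k = 0 <;> by_cases hl : l = 0 <;>
      simp only [hk, hl, if_true, if_false, mul_sub, sub_mul, mul_one, one_mul, smul_sub,
        zero_mul, mul_zero, mul_smul_comm, smul_mul_assoc, smul_smul, smul_zero] <;> abel
  have h1 : ∀ (r : Coef) (X : Matrix (Fin N × Fin N) (Fin N × Fin N) B) (k l : ℤ),
      (r • X) * leg1 (oneSub μ k) * leg2 (oneSub μ l)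
        - leg2 (oneSub μ l) * leg1 (oneSub μ k) * (r • X) =
      r • (X * leg1 (oneSub μ k) * leg2 (oneSub μ l)
        - leg2 (oneSub μ l) * leg1 (oneSub μ k) * X) := by
    intro r X k l
    simp only [smul_mul_assoc, mul_smul_comm, smul_sub]
  by_cases hg : g = .gl
  · subst hg
    simp only [rttDefect, rttDiv, Finset.sum_range_succ, Finset.sum_range_zero, Rhat_gl_coeff]
    simp only [mulDiff, Nat.cast_zero, Nat.cast_one, sub_zero, sub_self, Nat.choose_zero_right,
      Nat.choose_self, pow_zero, pow_one, one_mul, zero_add, one_smul, if_true, one_ne_zero,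
      zero_ne_one, if_false, zero_sub, zero_mul, mul_zero, neg_mul, mul_neg, Nat.choose_one_right,
      OfNat.ofNat_ne_one, OfNat.ofNat_ne_zero, mul_one, smul_zero, add_zero]
    rw [sub_neg_eq_add, neg_add_eq_sub, ← neg_sub (_ * _ * _) _, h1, hw, hc, hc]
    simp only [smul_add, smul_sub, pow_two, smul_smul, smul_neg, neg_smul, one_smul, neg_neg]
    abel
  · have hdiv : rttDiv g μ k l = mulDiff (fun k l => mulDiff (legComm μ) k l
        - (h * cst (kappa g N)) • legComm μ k l + legTwist (permOp N - brauerOp g N) μ k l) k l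
        - (h * cst (kappa g N)) • legTwist (permOp N) μ k l := by
      cases g with
      | gl => exact absurd rfl hg
      | o => rfl
      | sp => rfl
    have h2 : ∀ (r : Coef) (A : Matrix (Fin N × Fin N) (Fin N × Fin N) ℂ) (k l : ℤ),
        (r • (1 : Matrix _ _ B) + h • cmat B A) * leg1 (oneSub μ k) * leg2 (oneSub μ l)
          - leg2 (oneSub μ l) * leg1 (oneSub μ k) * (r • (1 : Matrix _ _ B) + h • cmat B A) =
        r • (h ^ 2 • legComm μ k l) - h • h • legTwist A μ k l := by
      intro r A k l
      rw [← hc, sub_eq_add_neg (r • _), ← smul_neg, ← hw]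
      simp only [add_mul, mul_add, smul_mul_assoc, mul_smul_comm, smul_sub, one_mul, mul_one]
      abel
    rw [hdiv]
    simp only [rttDefect, Finset.sum_range_succ, Finset.sum_range_zero, Rhat_coeff g hg]
    simp only [mulDiff, Nat.cast_zero, Nat.cast_one, sub_zero, sub_self, Nat.choose_zero_right,
      Nat.choose_self, pow_zero, pow_one, one_mul, zero_add, one_smul, if_true, one_ne_zero,
      zero_ne_one, if_false, zero_sub, neg_mul, mul_neg, Nat.choose_one_right,
      OfNat.ofNat_ne_one, OfNat.ofNat_ne_zero, OfNat.one_ne_ofNat, OfNat.zero_ne_ofNat, mul_one,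
      add_zero, Nat.cast_ofNat]
    simp only [sub_neg_eq_add, neg_add_eq_sub]
    simp only [← neg_sub (_ * leg1 _ * leg2 _) _, h1, h2, hw, hc]
    have e1 : (2 : ℤ) - 1 = 1 := rfl
    have e2 : ((-1 : ℤ) ^ 2) = 1 := rfl
    simp only [e1, e2, sub_sub, one_add_one_eq_two, one_smul]
    simp only [smul_add, smul_sub, pow_two, smul_smul, smul_neg, neg_smul]
    simp only [mul_comm, mul_left_comm]
    abel

end DividedRelation

end

/-! ### Evaluations of the divided relation -/

section

open HahnSeries

section CenterAlgebra

variable {K : Type*} [Ring K] [Algebra Coef K]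

/-- A ring is an algebra over its center. -/
instance : Algebra (Subalgebra.center Coef K) K :=
  Algebra.ofModule (fun r x y => mul_assoc (r : K) x y) fun r x y =>
    show x * ((r : K) * y) = r * (x * y) by
      rw [← mul_assoc, ← mul_assoc, (Subalgebra.mem_center_iff.1 r.2 x)]

instance : IsScalarTower Coef (Subalgebra.center Coef K) K :=
  ⟨fun r s x => show (r • (s : K)) * x = r • ((s : K) * x) from smul_mul_assoc _ _ _⟩

end CenterAlgebra

/-- A joint evaluation at commuting central elements `a`, `b` of a ring `K` of double series over
`B`, the coefficients of which vanish when an exponent is at least `n`. The map `ev` evaluates series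
in `u` and `v` at `u = a`, `v = b`, and `ev₁`, `ev₂` those in one variable; `ev` is compatible with
the multiplication by `u` and `v` and with products `f(u) g(v)` in both orders. -/
structure Evaluation (B K Z : Type*) [Ring B] [Algebra Coef B] [Ring K] [Algebra Coef K] [CommRing Z]
    [Algebra Z K] (n : ℤ) where
  ev : (ℤ → ℤ → B) →ₗ[Coef] K
  ev₁ : (ℤ → B) →ₗ[Coef] K
  ev₂ : (ℤ → B) →ₗ[Coef] K
  a : Z
  b : Z
  ev_left : ∀ c, Bd₂ (n + 1) c → ev (sh c) = a • ev c
  ev_right : ∀ c : ℤ → ℤ → B, Bd₂ (n + 1) c → ev (fun k => sh (c k)) = b • ev c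
  ev_mul : ∀ f g : ℤ → B, ev (fun k l => f k * g l) = ev₁ f * ev₂ g
  ev_mul' : ∀ f g : ℤ → B, ev (fun k l => g l * f k) = ev₂ g * ev₁ f
  ev_one₁ : ev₁ (fun k => if k = 0 then 1 else 0) = 1
  ev_one₂ : ev₂ (fun k => if k = 0 then 1 else 0) = 1

section SeriesMatrix

/-- The matrix of the values of a linear functional on the entries of a series of matrices. -/
def mapSeq {B K : Type*} [Ring B] [Algebra Coef B] [Ring K] [Algebra Coef K]
    (φ : (ℤ → B) →ₗ[Coef] K) {m m' : Type*} (μ : ℤ → Matrix m m' B) : Matrix m m' K :=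
  fun i j => φ fun k => μ k i j

variable {B : Type*} [Ring B] {N : ℕ}

theorem leg1_apply (S : Matrix (Fin N) (Fin N) B) (p q : Fin N × Fin N) :
    leg1 S p q = S p.1 q.1 * (if p.2 = q.2 then 1 else 0) := by
  rw [leg1, Matrix.kroneckerMap_apply, Matrix.one_apply]

theorem leg2_apply (S : Matrix (Fin N) (Fin N) B) (p q : Fin N × Fin N) :
    leg2 S p q = (if p.1 = q.1 then 1 else 0) * S p.2 q.2 := by
  rw [leg2, Matrix.kroneckerMap_apply, Matrix.one_apply]

theorem leg1_mul_leg2 (S T : Matrix (Fin N) (Fin N) B) (p q : Fin N × Fin N) :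
    (leg1 S * leg2 T) p q = S p.1 q.1 * T p.2 q.2 := by
  simp [Matrix.mul_apply, Fintype.sum_prod_type, leg1_apply, leg2_apply]

theorem leg2_mul_leg1 (S T : Matrix (Fin N) (Fin N) B) (p q : Fin N × Fin N) :
    (leg2 T * leg1 S) p q = T p.2 q.2 * S p.1 q.1 := by
  simp [Matrix.mul_apply, Fintype.sum_prod_type, leg1_apply, leg2_apply]

theorem mul_ite_one_apply {m : Type*} [Fintype m] [DecidableEq m] (X : Matrix m m B) (P : Prop)
    [Decidable P] (p q : m) :
    (X * (if P then 1 else 0) : Matrix m m B) p q = X p q * (if P then 1 else 0) := by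
  split_ifs <;> simp

end SeriesMatrix

/-- The element `[A, M₁ + M₂] - h (A M₁ M₂ - M₂ M₁ A)`. -/
def twist {R : Type*} [Ring R] [Algebra Coef R] (A M₁ M₂ : R) : R :=
  A * M₁ + A * M₂ - M₁ * A - M₂ * A - h • (A * (M₁ * M₂) - M₂ * M₁ * A)

namespace Evaluation

variable {B K Z : Type*} [Ring B] [Algebra Coef B] [Ring K] [Algebra Coef K] [CommRing Z]
  [Algebra Z K] {n : ℤ} (E : Evaluation B K Z n)
  {m : Type*} [Fintype m] [DecidableEq m]

/-- The entrywise evaluation of a double series of matrices. -/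
def evM (c : ℤ → ℤ → Matrix m m B) : Matrix m m K := fun i j => E.ev fun k l => c k l i j

theorem evM_add (c c' : ℤ → ℤ → Matrix m m B) :
    E.evM (fun k l => c k l + c' k l) = E.evM c + E.evM c' := by
  ext i j
  exact map_add E.ev (fun k l => c k l i j) fun k l => c' k l i j

theorem evM_sub (c c' : ℤ → ℤ → Matrix m m B) :
    E.evM (fun k l => c k l - c' k l) = E.evM c - E.evM c' := by
  ext i j
  exact map_sub E.ev (fun k l => c k l i j) fun k l => c' k l i j

theorem evM_smul (r : Coef) (c : ℤ → ℤ → Matrix m m B) :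
    E.evM (fun k l => r • c k l) = r • E.evM c := by
  ext i j
  exact map_smul E.ev r fun k l => c k l i j

theorem evM_cmat_mul (A : Matrix m m ℂ) (c : ℤ → ℤ → Matrix m m B) :
    E.evM (fun k l => cmat B A * c k l) = cmat K A * E.evM c := by
  ext i j
  simp only [evM, Matrix.mul_apply, cmat_apply, ← Algebra.smul_def, ← map_smul, ← map_sum]
  congr 1
  ext k l
  simp

theorem evM_mul_cmat (A : Matrix m m ℂ) (c : ℤ → ℤ → Matrix m m B) :
    E.evM (fun k l => c k l * cmat B A) = E.evM c * cmat K A := by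
  ext i j
  simp only [evM, Matrix.mul_apply, cmat_apply, ← Algebra.commutes, ← Algebra.smul_def, ← map_smul,
    ← map_sum]
  congr 1
  ext k l
  simp

variable {N : ℕ}

theorem evM_leg1_mul_leg2 (μ ν : ℤ → Matrix (Fin N) (Fin N) B) :
    E.evM (fun k l => leg1 (μ k) * leg2 (ν l)) = leg1 (mapSeq E.ev₁ μ) * leg2 (mapSeq E.ev₂ ν) := by
  ext p q
  simp only [evM, leg1_mul_leg2]
  exact E.ev_mul _ _

theorem evM_leg2_mul_leg1 (μ ν : ℤ → Matrix (Fin N) (Fin N) B) :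
    E.evM (fun k l => leg2 (ν l) * leg1 (μ k)) = leg2 (mapSeq E.ev₂ ν) * leg1 (mapSeq E.ev₁ μ) := by
  ext p q
  simp only [evM, leg2_mul_leg1]
  exact E.ev_mul' _ _

theorem evM_leg1 (μ : ℤ → Matrix (Fin N) (Fin N) B) :
    E.evM (fun k l => leg1 (μ k) * (if l = 0 then 1 else 0)) = leg1 (mapSeq E.ev₁ μ) := by
  ext p q
  simp only [evM, mul_ite_one_apply]
  rw [E.ev_mul, E.ev_one₂, mul_one, leg1_apply]
  simp only [leg1_apply]
  split_ifs <;> simp [mapSeq, ← Pi.zero_def]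

theorem evM_leg2 (ν : ℤ → Matrix (Fin N) (Fin N) B) :
    E.evM (fun k l => leg2 (ν l) * (if k = 0 then 1 else 0)) = leg2 (mapSeq E.ev₂ ν) := by
  ext p q
  simp only [evM, mul_ite_one_apply]
  rw [E.ev_mul', E.ev_one₁, mul_one, leg2_apply]
  simp only [leg2_apply]
  split_ifs <;> simp [mapSeq, ← Pi.zero_def]

theorem evM_mulDiff {c : ℤ → ℤ → Matrix m m B} (hc : Bd₂ (n + 1) c) :
    E.evM (mulDiff c) = (E.a - E.b) • E.evM c := by
  ext i j
  have hc' : Bd₂ (n + 1) fun k l => c k l i j := fun k l hkl => by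
    change c k l i j = 0
    rw [hc k l hkl]; rfl
  have h1 := E.ev_left _ hc'
  have h2 := E.ev_right _ hc'
  rw [Matrix.smul_apply, sub_smul]
  change _ = E.a • E.ev (fun k l => c k l i j) - E.b • E.ev (fun k l => c k l i j)
  rw [← h1, ← h2, ← map_sub]
  rfl

theorem evM_legTwist (A : Matrix (Fin N × Fin N) (Fin N × Fin N) ℂ)
    (μ : ℤ → Matrix (Fin N) (Fin N) B) : E.evM (legTwist A μ) =
      twist (cmat K A) (leg1 (mapSeq E.ev₁ μ)) (leg2 (mapSeq E.ev₂ μ)) := by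
  have e1 : legTwist A μ = fun k l =>
      cmat B A * (leg1 (μ k) * (if l = 0 then 1 else 0))
      + cmat B A * (leg2 (μ l) * (if k = 0 then 1 else 0))
      - (leg1 (μ k) * (if l = 0 then 1 else 0)) * cmat B A
      - (leg2 (μ l) * (if k = 0 then 1 else 0)) * cmat B A
      - h • (cmat B A * (leg1 (μ k) * leg2 (μ l)) - leg2 (μ l) * leg1 (μ k) * cmat B A) := by
    funext k l
    rw [legTwist]
    split_ifs <;> simp only [mul_one, mul_zero, zero_mul]
  rw [e1, evM_sub, evM_sub, evM_sub, evM_add, evM_smul, evM_sub]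
  simp only [evM_cmat_mul, evM_mul_cmat, evM_leg1, evM_leg2, evM_leg1_mul_leg2, evM_leg2_mul_leg1,
    twist]

theorem evM_legComm (μ : ℤ → Matrix (Fin N) (Fin N) B) : E.evM (legComm μ) =
    leg1 (mapSeq E.ev₁ μ) * leg2 (mapSeq E.ev₂ μ) - leg2 (mapSeq E.ev₂ μ) * leg1 (mapSeq E.ev₁ μ) := by
  change E.evM (fun k l => leg1 (μ k) * leg2 (μ l) - leg2 (μ l) * leg1 (μ k)) = _
  rw [evM_sub, evM_leg1_mul_leg2, evM_leg2_mul_leg1]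

theorem bd_legComm {μ : ℤ → Matrix (Fin N) (Fin N) B} (hμ : Bd n μ) :
    Bd₂ n (legComm μ) := by
  have h1 : leg1 (0 : Matrix (Fin N) (Fin N) B) = 0 := by ext; simp [leg1_apply]
  have h2 : leg2 (0 : Matrix (Fin N) (Fin N) B) = 0 := by ext; simp [leg2_apply]
  rintro k l (hk | hl)
  · simp [legComm, hμ k hk, h1]
  · simp [legComm, hμ l hl, h2]

theorem bd_legTwist (hn : 0 < n) {μ : ℤ → Matrix (Fin N) (Fin N) B} (hμ : Bd n μ)
    (A : Matrix (Fin N × Fin N) (Fin N × Fin N) ℂ) : Bd₂ n (legTwist A μ) := by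
  have h1 : leg1 (0 : Matrix (Fin N) (Fin N) B) = 0 := by ext; simp [leg1_apply]
  have h2 : leg2 (0 : Matrix (Fin N) (Fin N) B) = 0 := by ext; simp [leg2_apply]
  rintro k l (hk | hl)
  · simp [legTwist, hμ k hk, h1, show k ≠ 0 by omega]
  · simp [legTwist, hμ l hl, h2, show l ≠ 0 by omega]

/-- The value of the divided relation for `gl_N` at `u = a`, `v = b`. -/
theorem eval_gl {μ : ℤ → Matrix (Fin N) (Fin N) B} (hμ : Bd n μ)
    (hrel : ∀ k l, rttDiv .gl μ k l = 0) :
    (E.a - E.b) • (leg1 (mapSeq E.ev₁ μ) * leg2 (mapSeq E.ev₂ μ)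
        - leg2 (mapSeq E.ev₂ μ) * leg1 (mapSeq E.ev₁ μ))
      + twist (cmat K (permOp N)) (leg1 (mapSeq E.ev₁ μ)) (leg2 (mapSeq E.ev₂ μ)) = 0 := by
  have e1 : E.evM (fun k l => rttDiv .gl μ k l) = 0 := by
    simp only [hrel]
    ext i j
    exact map_zero E.ev
  have hc : Bd₂ (n + 1) (legComm μ) := fun k l hkl => bd_legComm hμ k l (by omega)
  rw [← e1]
  change _ = E.evM (fun k l => mulDiff (legComm μ) k l + legTwist (permOp N) μ k l)
  rw [evM_add, evM_mulDiff E hc, evM_legComm, evM_legTwist]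

/-- The value of the divided relation for `o_N` and `sp_N` at `u = a`, `v = b`. -/
theorem eval_osp (hn : 0 < n) {μ : ℤ → Matrix (Fin N) (Fin N) B} (hμ : Bd n μ)
    {g : LieType} (hg : g ≠ .gl) (hrel : ∀ k l, rttDiv g μ k l = 0) :
    (E.a - E.b) • ((E.a - E.b) • (leg1 (mapSeq E.ev₁ μ) * leg2 (mapSeq E.ev₂ μ)
        - leg2 (mapSeq E.ev₂ μ) * leg1 (mapSeq E.ev₁ μ))
      - (h * cst (kappa g N)) • (leg1 (mapSeq E.ev₁ μ) * leg2 (mapSeq E.ev₂ μ)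
        - leg2 (mapSeq E.ev₂ μ) * leg1 (mapSeq E.ev₁ μ))
      + twist (cmat K (permOp N - brauerOp g N)) (leg1 (mapSeq E.ev₁ μ)) (leg2 (mapSeq E.ev₂ μ)))
      - (h * cst (kappa g N)) •
        twist (cmat K (permOp N)) (leg1 (mapSeq E.ev₁ μ)) (leg2 (mapSeq E.ev₂ μ)) = 0 := by
  have e1 : E.evM (fun k l => rttDiv g μ k l) = 0 := by
    simp only [hrel]
    ext i j
    exact map_zero E.ev
  have e2 : (fun k l => rttDiv g μ k l) = fun k l => mulDiff (fun k l => mulDiff (legComm μ) k l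
      - (h * cst (kappa g N)) • legComm μ k l + legTwist (permOp N - brauerOp g N) μ k l) k l
      - (h * cst (kappa g N)) • legTwist (permOp N) μ k l := by
    cases g with
    | gl => exact absurd rfl hg
    | o => rfl
    | sp => rfl
  have hc : Bd₂ (n + 1) (legComm μ) := fun k l hkl => bd_legComm hμ k l (by omega)
  have hc' : Bd₂ (n + 1) (fun k l => mulDiff (legComm μ) k l
      - (h * cst (kappa g N)) • legComm μ k l + legTwist (permOp N - brauerOp g N) μ k l) := by
    intro k l hkl
    beta_reduce
    rw [bd_legTwist hn hμ _ k l (by omega), mulDiff, bd_legComm hμ k l (by omega),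
      bd_legComm hμ (k - 1) l (by omega), bd_legComm hμ k (l - 1) (by omega)]
    simp
  rw [← e1, e2, evM_sub, evM_smul, evM_mulDiff E hc', evM_add, evM_sub, evM_smul, evM_mulDiff E hc,
    evM_legComm, evM_legTwist, evM_legTwist]

end Evaluation

section RTT

variable {R Z : Type*} [Ring R] [Algebra Coef R] [CommRing Z] [Algebra Coef Z] [Algebra Z R]
  [IsScalarTower Coef Z R]

theorem oneSub_commutator (M₁ M₂ : R) : (1 - h • M₁) * (1 - h • M₂) - (1 - h • M₂) * (1 - h • M₁) =
    h ^ 2 • (M₁ * M₂ - M₂ * M₁) := by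
  simp only [mul_sub, sub_mul, mul_one, one_mul, mul_smul_comm, smul_mul_assoc, smul_smul, smul_sub,
    pow_two]
  abel

theorem oneSub_twist (A M₁ M₂ : R) : A * (1 - h • M₁) * (1 - h • M₂)
    - (1 - h • M₂) * (1 - h • M₁) * A = -(h • twist A M₁ M₂) := by
  simp only [twist, mul_sub, sub_mul, mul_one, one_mul, mul_smul_comm, smul_mul_assoc, smul_smul,
    smul_sub, smul_add, mul_assoc]
  abel

theorem twist_sub (A A' M₁ M₂ : R) : twist (A - A') M₁ M₂ = twist A M₁ M₂ - twist A' M₁ M₂ := by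
  simp only [twist, sub_mul, mul_sub, smul_sub]
  abel

/-- The action on scalar matrices of the polynomial `R`-matrix `R̂(x)`, with given `P` and `Q`. -/
def Rpoly (g : LieType) (N : ℕ) (P Q : R) (x : Z) : R :=
  match g with
  | .gl => x • 1 - algebraMap Coef Z h • P
  | g => (x * (x - algebraMap Coef Z (h * cst (kappa g N)))) • 1
      - (algebraMap Coef Z h * (x - algebraMap Coef Z (h * cst (kappa g N)))) • P
      + (algebraMap Coef Z h * x) • Q

theorem Rpoly_osp {g : LieType} (hg : g ≠ .gl) (N : ℕ) (P Q : R) (x : Z) :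
    Rpoly g N P Q x = (x * (x - algebraMap Coef Z (h * cst (kappa g N)))) • 1
      - (algebraMap Coef Z h * (x - algebraMap Coef Z (h * cst (kappa g N)))) • P
      + (algebraMap Coef Z h * x) • Q := by
  cases g with
  | gl => exact absurd rfl hg
  | o => rfl
  | sp => rfl

/-- The sign `η` such that the image of the fusion idempotent lies where `P = η`. -/
def eta (g : LieType) : ℂ :=
  match g with
  | .o => 1
  | _ => -1

theorem eta_mul_self (g : LieType) : eta g * eta g = 1 := by cases g <;> simp [eta]

theorem kappa_eq {g : LieType} (hg : g ≠ .gl) (N : ℕ) : kappa g N = N / 2 - eta g := by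
  cases g with
  | gl => exact absurd rfl hg
  | o => simp [kappa, eta]
  | sp => simp [kappa, eta]

/-- The relation `R̂ L_1 L_2 = L_2 L_1 R̂` from the divided relation, for `gl_N`. -/
theorem rtt_gl {P M₁ M₂ : R} (Q : R) {x : Z} (N : ℕ)
    (hx : x • (M₁ * M₂ - M₂ * M₁) + twist P M₁ M₂ = 0) :
    Rpoly .gl N P Q x * (1 - h • M₁) * (1 - h • M₂)
      = (1 - h • M₂) * (1 - h • M₁) * Rpoly .gl N P Q x := by
  have h1 := oneSub_commutator M₁ M₂
  have h2 := oneSub_twist P M₁ M₂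
  rw [← sub_eq_zero]
  have e : Rpoly .gl N P Q x * (1 - h • M₁) * (1 - h • M₂)
      - (1 - h • M₂) * (1 - h • M₁) * Rpoly .gl N P Q x
      = x • ((1 - h • M₁) * (1 - h • M₂) - (1 - h • M₂) * (1 - h • M₁))
        - h • (P * (1 - h • M₁) * (1 - h • M₂) - (1 - h • M₂) * (1 - h • M₁) * P) := by
    generalize 1 - h • M₁ = L₁
    generalize 1 - h • M₂ = L₂
    rw [Rpoly, algebraMap_smul]
    simp only [sub_mul, mul_sub, smul_mul_assoc, mul_smul_comm, one_mul, mul_one, smul_sub]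
    abel
  rw [e, h1, h2, smul_comm x, smul_neg, sub_neg_eq_add, smul_smul h h, ← pow_two, ← smul_add, hx,
    smul_zero]

/-- At `u - v = h` the divided relation is the fused one; the division by `h` is essential, as `h` is
not a regular element. -/
theorem fused_rtt_gl {P M₁ M₂ : R} {x : Z} (hxh : x = algebraMap Coef Z h)
    (hx : x • (M₁ * M₂ - M₂ * M₁) + twist P M₁ M₂ = 0) :
    (1 - P) * (1 - h • M₁) * (1 - h • M₂) = (1 - h • M₂) * (1 - h • M₁) * (1 - P) := by
  have h1 := oneSub_commutator M₁ M₂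
  have h2 := oneSub_twist P M₁ M₂
  rw [← sub_eq_zero]
  have e : (1 - P) * (1 - h • M₁) * (1 - h • M₂) - (1 - h • M₂) * (1 - h • M₁) * (1 - P)
      = ((1 - h • M₁) * (1 - h • M₂) - (1 - h • M₂) * (1 - h • M₁))
        - (P * (1 - h • M₁) * (1 - h • M₂) - (1 - h • M₂) * (1 - h • M₁) * P) := by
    rw [sub_mul 1 P, sub_mul, mul_sub _ 1 P, one_mul, mul_one]
    abel
  rw [hxh, algebraMap_smul] at hx
  rw [e, h1, h2, sub_neg_eq_add, pow_two, mul_smul, ← smul_add, hx, smul_zero]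

/-- The relation between `L_1(u)` and `h⁻¹ (1 - L_2(v))` for `gl_N`. -/
theorem rtt_gl_divided {P M₁ M₂ : R} (Q : R) {x : Z} (N : ℕ)
    (hx : x • (M₁ * M₂ - M₂ * M₁) + twist P M₁ M₂ = 0) :
    Rpoly .gl N P Q x * (1 - h • M₁) * M₂ = M₂ * (1 - h • M₁) * Rpoly .gl N P Q x
      - (P * (1 - h • M₁) - (1 - h • M₁) * P) := by
  have e : Rpoly .gl N P Q x * (1 - h • M₁) * M₂ - (M₂ * (1 - h • M₁) * Rpoly .gl N P Q x
      - (P * (1 - h • M₁) - (1 - h • M₁) * P))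
      = -(h • (x • (M₁ * M₂ - M₂ * M₁) + twist P M₁ M₂)) := by
    rw [Rpoly, algebraMap_smul, twist]
    simp only [sub_mul, mul_sub, smul_mul_assoc, mul_smul_comm, one_mul, mul_one, smul_sub, smul_add,
      smul_comm x h, smul_smul, mul_assoc]
    abel
  rw [← sub_eq_zero, e, hx, smul_zero, neg_zero]

/-- The relation `R̂ L_1 L_2 = L_2 L_1 R̂` from the divided relation, for `o_N` and `sp_N`. -/
theorem rtt_osp {g : LieType} (hg : g ≠ .gl) {P Q M₁ M₂ : R} {x : Z} (N : ℕ)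
    (hx : x • (x • (M₁ * M₂ - M₂ * M₁) - (h * cst (kappa g N)) • (M₁ * M₂ - M₂ * M₁)
      + twist (P - Q) M₁ M₂) - (h * cst (kappa g N)) • twist P M₁ M₂ = 0) :
    Rpoly g N P Q x * (1 - h • M₁) * (1 - h • M₂)
      = (1 - h • M₂) * (1 - h • M₁) * Rpoly g N P Q x := by
  have h1 := oneSub_commutator M₁ M₂
  have h2 := oneSub_twist P M₁ M₂
  have h3 := oneSub_twist Q M₁ M₂
  rw [← sub_eq_zero]
  rw [Rpoly_osp hg]
  rw [twist_sub] at hx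
  simp only [← algebraMap_smul (R := Coef) Z] at h1 h2 h3 hx ⊢
  set t := algebraMap Coef Z h
  set s := algebraMap Coef Z (h * cst (kappa g N))
  rw [map_pow] at h1
  generalize M₁ * M₂ - M₂ * M₁ = K at *
  generalize twist P M₁ M₂ = TP at *
  generalize twist Q M₁ M₂ = TQ at *
  generalize 1 - t • M₁ = L₁ at *
  generalize 1 - t • M₂ = L₂ at *
  have e : ((x * (x - s)) • (1 : R) - (t * (x - s)) • P + (t * x) • Q) * L₁ * L₂
      - L₂ * L₁ * ((x * (x - s)) • (1 : R) - (t * (x - s)) • P + (t * x) • Q)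
      = (x * (x - s)) • (L₁ * L₂ - L₂ * L₁) - (t * (x - s)) • (P * L₁ * L₂ - L₂ * L₁ * P)
        + (t * x) • (Q * L₁ * L₂ - L₂ * L₁ * Q) := by
    simp only [sub_mul _ _ (_ : R), add_mul _ _ (_ : R), mul_sub (_ : R), mul_add (_ : R),
      smul_mul_assoc, mul_smul_comm, one_mul, mul_one, smul_sub]
    abel
  rw [e, h1, h2, h3]
  have e2 : (x * (x - s)) • t ^ 2 • K - (t * (x - s)) • -(t • TP) + (t * x) • -(t • TQ)
      = t ^ 2 • (x • (x • K - s • K + (TP - TQ)) - s • TP) := by module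
  rw [e2, hx, smul_zero]

/-- At `u - v = -η h` the divided relation is the fused one with the idempotent `(1 + η P)/2 - Q/N`. -/
theorem fused_rtt_osp {g : LieType} (hg : g ≠ .gl) {P Q M₁ M₂ : R} {x : Z} (N : ℕ) (hN : N ≠ 0)
    (hxh : x = -algebraMap Coef Z (cst (eta g) * h))
    (hx : x • (x • (M₁ * M₂ - M₂ * M₁) - (h * cst (kappa g N)) • (M₁ * M₂ - M₂ * M₁)
      + twist (P - Q) M₁ M₂) - (h * cst (kappa g N)) • twist P M₁ M₂ = 0) :
    (cst (1 / 2) • (1 + cst (eta g) • P) - cst (1 / N) • Q) * (1 - h • M₁) * (1 - h • M₂)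
      = (1 - h • M₂) * (1 - h • M₁) *
        (cst (1 / 2) • (1 + cst (eta g) • P) - cst (1 / N) • Q) := by
  have h1 := oneSub_commutator M₁ M₂
  have h2 := oneSub_twist P M₁ M₂
  have h3 := oneSub_twist Q M₁ M₂
  have hη : cst (eta g) * cst (eta g) = 1 := by
    rw [cst, ← map_mul, eta_mul_self, map_one]
  have hκ : cst (kappa g N) = (N : Coef) * cst (1 / 2) - cst (eta g) := by
    rw [kappa_eq hg, cst, map_sub, cst, cst, ← map_natCast (PowerSeries.C : ℂ →+* Coef) N,
      ← map_mul, mul_one_div]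
  have h2' : cst (1 / 2) * 2 = 1 := by
    rw [cst, ← map_ofNat (PowerSeries.C : ℂ →+* Coef) 2, ← map_mul]; norm_num
  have hN' : cst (1 / N) * (N : Coef) = 1 := by
    rw [cst, ← map_natCast (PowerSeries.C : ℂ →+* Coef) N, ← map_mul]
    rw [one_div, inv_mul_cancel₀ (by exact_mod_cast hN), map_one]
  rw [← sub_eq_zero]
  rw [twist_sub, hκ] at hx
  replace h2' := congrArg (algebraMap Coef Z) h2'
  replace hN' := congrArg (algebraMap Coef Z) hN'
  replace hη := congrArg (algebraMap Coef Z) hη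
  simp only [← algebraMap_smul (R := Coef) Z] at h1 h2 h3 hx ⊢
  simp only [map_mul, map_sub, map_pow, map_natCast, map_ofNat, map_one] at *
  set t := algebraMap Coef Z h
  set ι := algebraMap Coef Z (cst (eta g))
  set a := algebraMap Coef Z (cst (1 / 2))
  set b := algebraMap Coef Z (cst (1 / N))
  generalize M₁ * M₂ - M₂ * M₁ = K at *
  generalize twist P M₁ M₂ = TP at *
  generalize twist Q M₁ M₂ = TQ at *
  generalize 1 - t • M₁ = L₁ at *
  generalize 1 - t • M₂ = L₂ at *
  have e : (a • (1 + ι • P) - b • Q) * L₁ * L₂ - L₂ * L₁ * (a • (1 + ι • P) - b • Q)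
      = a • (L₁ * L₂ - L₂ * L₁) + (a * ι) • (P * L₁ * L₂ - L₂ * L₁ * P)
        - b • (Q * L₁ * L₂ - L₂ * L₁ * Q) := by
    simp only [sub_mul _ _ (_ : R), add_mul _ _ (_ : R), mul_sub (_ : R), mul_add (_ : R),
      smul_mul_assoc, mul_smul_comm, one_mul, mul_one, smul_sub, smul_add, smul_smul]
    abel
  rw [e, h1, h2, h3]
  -- the relation at `x = -η h` is `η N h^2` times the claim
  have e3 : a • t ^ 2 • K + (a * ι) • -(t • TP) - b • -(t • TQ) = (b * ι) •
      (x • (x • K - (t * (N * a - ι)) • K + (TP - TQ)) - (t * (N * a - ι)) • TP) := by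
    have c1 : a * t ^ 2 = b * ι * (x * x - x * (t * (N * a - ι))) := by
      rw [hxh]
      linear_combination (-a * t ^ 2) * hN' - b * t ^ 2 * N * a * hη
    have c2 : -(a * ι * t) = b * ι * (x - t * (N * a - ι)) := by
      rw [hxh]
      linear_combination (a * ι * t) * hN'
    have c3 : b * t = -(b * ι * x) := by
      rw [hxh]
      linear_combination (-b * t) * hη
    calc _ = (a * t ^ 2) • K + (-(a * ι * t)) • TP + (b * t) • TQ := by module
      _ = _ := by rw [c1, c2, c3]; module
  rw [e3, hx, smul_zero]

end RTT

end

/-! ### Series in two variables -/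

section

open HahnSeries

section DoubleTaylor

variable {B : Type*} [Ring B] [Algebra Coef B]

/-- The coefficients of `∑ c_{kl} (z + t)^k (w + t')^l`. -/
def sig₂ (p : ℕ) (t t' : Coef) : (ℤ → ℤ → B) →ₗ[Coef] (ℤ → ℤ → B) :=
  (sig p t).comp ((sig p t').compLeft ℤ)

theorem sig₂_apply (p : ℕ) (t t' : Coef) (c : ℤ → ℤ → B) :
    sig₂ p t t' c = sig p t fun k => sig p t' (c k) := rfl

/-- The substitution `u = z + t` turns the multiplication by `u` into that by `z + t`. -/
theorem sig₂_left {p : ℕ} {t : Coef} (ht : ∀ v : B, t ^ p • v = 0) (t' : Coef) (c : ℤ → ℤ → B) :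
    sig₂ p t t' (sh c) = sh (sig₂ p t t' c) + t • sig₂ p t t' c :=
  sig_sh (V := ℤ → B) p t (fun v => funext fun l => ht (v l)) (fun k => sig p t' (c k))

/-- The substitution `v = w + t'` turns the multiplication by `v` into that by `w + t'`. -/
theorem sig₂_right {p : ℕ} (t : Coef) {t' : Coef} (ht : ∀ v : B, t' ^ p • v = 0) (c : ℤ → ℤ → B) :
    sig₂ p t t' (fun k => sh (c k)) = (fun k => sh (sig₂ p t t' c k)) + t' • sig₂ p t t' c := by
  rw [sig₂_apply]
  have e : (fun k => sig p t' (sh (c k))) =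
      (fun k => sh (sig p t' (c k))) + t' • fun k => sig p t' (c k) := by
    funext k
    rw [sig_sh p t' ht]
    rfl
  rw [e, map_add, map_smul, sig₂_apply]
  congr 1
  funext k l
  simp [sig_apply, sh_apply]

theorem sig₂_mul (p : ℕ) (t t' : Coef) (f g : ℤ → B) :
    sig₂ p t t' (fun k l => f k * g l) = fun k l => sig p t f k * sig p t' g l := by
  funext k l
  simp only [sig₂_apply, sig_apply, Finset.sum_apply, Pi.smul_apply, Finset.sum_mul,
    Finset.mul_sum, Finset.smul_sum, smul_mul_assoc, mul_smul_comm]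
  rw [Finset.sum_comm]
  simp only [smul_smul, mul_comm, mul_left_comm, mul_assoc]

theorem sig₂_mul' (p : ℕ) (t t' : Coef) (f g : ℤ → B) :
    sig₂ p t t' (fun k l => g l * f k) = fun k l => sig p t' g l * sig p t f k := by
  funext k l
  simp only [sig₂_apply, sig_apply, Finset.sum_apply, Pi.smul_apply, Finset.sum_mul,
    Finset.mul_sum, Finset.smul_sum, smul_mul_assoc, mul_smul_comm]

theorem Bd₂.sig₂ {n : ℤ} {c : ℤ → ℤ → B} (hc : Bd₂ n c) (p : ℕ) (t t' : Coef) :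
    Bd₂ n (sig₂ p t t' c) := by
  intro k l hkl
  simp only [sig₂_apply, sig_apply, Finset.sum_apply, Pi.smul_apply]
  refine Finset.sum_eq_zero fun b _ => ?_
  rw [Finset.sum_eq_zero, smul_zero, smul_zero]
  intro b' _
  rw [hc _ _ (by omega), smul_zero, smul_zero]

theorem sig_one {p : ℕ} (hp : 0 < p) (t : Coef) :
    sig p t (fun k => if k = 0 then (1 : B) else 0) = fun k => if k = 0 then 1 else 0 := by
  funext k
  rw [sig_apply, Finset.sum_eq_single 0]
  · simp
  · intro b _ hb
    split_ifs with hk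
    · obtain ⟨b, rfl⟩ := Nat.exists_eq_succ_of_ne_zero hb
      rw [hk, Ring.choose_zero_succ, Int.cast_zero, zero_smul]
    · simp
  · intro h0
    exact absurd (Finset.mem_range.2 hp) h0

end DoubleTaylor

section Evaluations

variable {B : Type*} [Ring B] [Algebra Coef B]

/-- The series `f(z + d h)`. -/
def serz (p : ℕ) (P : ℤ) (d : ℂ) : (ℤ → B) →ₗ[Coef] HahnSeries ℤ B :=
  (lau P).comp (sig p (cst d * h))

/-- The embedding of the series in `z⁻¹` into the series in `w⁻¹` over them. -/
def zEmb (B : Type*) [Ring B] : HahnSeries ℤ B →+* HahnSeries ℤ (HahnSeries ℤ B) := C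

/-- The substitution of `w` for `z`. -/
def wEmb (B : Type*) [Ring B] : HahnSeries ℤ B →+* HahnSeries ℤ (HahnSeries ℤ B) where
  toFun x := x.map (C : B →+* HahnSeries ℤ B)
  map_one' := by
    ext1; ext1 n
    rw [map_coeff, coeff_one, coeff_one]
    split_ifs <;> simp
  map_zero' := by
    ext1; ext1 n
    simp
  map_mul' x y := HahnSeries.map_mul (C : B →+* HahnSeries ℤ B).toNonUnitalRingHom
  map_add' x y := HahnSeries.map_add (C : B →+* HahnSeries ℤ B).toAddMonoidHom

theorem coeff_wEmb (x : HahnSeries ℤ B) (n : ℤ) : (wEmb B x).coeff n = C (x.coeff n) := rfl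

theorem wEmb_lau (P : ℤ) (f : ℤ → B) : wEmb B (lau P f) = wlau P f := by
  ext1; ext1 n
  rw [coeff_wEmb, wlau, coeff_lau, coeff_lau]
  split_ifs <;> simp

theorem zEmb_smul (r : Coef) (x : HahnSeries ℤ B) : zEmb B (r • x) = r • zEmb B x := by
  ext n m
  simp only [zEmb, C_apply, coeff_single, coeff_smul]
  split_ifs <;> simp

theorem wEmb_smul (r : Coef) (x : HahnSeries ℤ B) : wEmb B (r • x) = r • wEmb B x := by
  ext n m
  simp only [coeff_wEmb, C_apply, coeff_single, coeff_smul]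
  split_ifs <;> simp

/-- The coefficients of the products of a series in `z` and a series in `w`. -/
theorem coeff_zEmb_mul_wEmb (x y : HahnSeries ℤ B) (n m : ℤ) :
    ((zEmb B x * wEmb B y).coeff n).coeff m = x.coeff m * y.coeff n := by
  rw [zEmb, coeff_C_mul', coeff_wEmb, coeff_mul_C']

theorem coeff_wEmb_mul_zEmb (x y : HahnSeries ℤ B) (n m : ℤ) :
    ((wEmb B y * zEmb B x).coeff n).coeff m = y.coeff n * x.coeff m := by
  rw [zEmb, coeff_mul_C', coeff_wEmb, coeff_C_mul']

/-- The central element `z`. -/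
def zC (B : Type*) [Ring B] [Algebra Coef B] : Subalgebra.center Coef (HahnSeries ℤ B) :=
  ⟨zvar B, Subalgebra.mem_center_iff.2 fun x => (zvar_comm x).symm⟩

/-- The central elements of the ring of series in `w⁻¹` and `z⁻¹`. -/
abbrev Ctr (B : Type*) [Ring B] [Algebra Coef B] : Type _ :=
  Subalgebra.center Coef (HahnSeries ℤ (HahnSeries ℤ B))

/-- The central element `z` of the ring of series in `w⁻¹` and `z⁻¹`. -/
def zCtr (B : Type*) [Ring B] [Algebra Coef B] : Ctr B :=
  ⟨C (zvar B), Subalgebra.mem_center_iff.2 fun x => by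
    ext1; ext1 n
    rw [coeff_C_mul', coeff_mul_C', zvar_comm]⟩

/-- The central element `w` of the ring of series in `w⁻¹` and `z⁻¹`. -/
def wCtr (B : Type*) [Ring B] [Algebra Coef B] : Ctr B := zC (HahnSeries ℤ B)

theorem pow_smul_eq_zero {p : ℕ} (hh : ∀ v : B, h ^ p • v = 0) (d : ℂ) (v : B) :
    (cst d * h) ^ p • v = 0 := by
  rw [mul_pow, mul_smul, hh, smul_zero]

/-- The evaluation at `u = z + d h`, `v = z + d' h`. -/
def sameEval {p : ℕ} (hp : 0 < p) (hh : ∀ v : B, h ^ p • v = 0) {n : ℤ} (hn : 0 < n) (d d' : ℂ) :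
    Evaluation B (HahnSeries ℤ B) (Subalgebra.center Coef (HahnSeries ℤ B)) n where
  ev := (diag2 (n + 2)).comp (sig₂ p (cst d * h) (cst d' * h))
  ev₁ := serz p (n + 2) d
  ev₂ := serz p (n + 2) d'
  a := zC B + algebraMap Coef _ (cst d * h)
  b := zC B + algebraMap Coef _ (cst d' * h)
  ev_left c hc := by
    rw [LinearMap.comp_apply, sig₂_left (pow_smul_eq_zero hh d), map_add, map_smul,
      diag2_sh_left (fun k l hkl => hc.sig₂ p _ _ k l (by omega)), add_smul, algebraMap_smul]
    rfl
  ev_right c hc := by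
    rw [LinearMap.comp_apply, sig₂_right _ (pow_smul_eq_zero hh d'), map_add, map_smul,
      diag2_sh_right (fun k l hkl => hc.sig₂ p _ _ k l (by omega)), add_smul, algebraMap_smul]
    rfl
  ev_mul f g := by rw [LinearMap.comp_apply, sig₂_mul, diag2_mul]; rfl
  ev_mul' f g := by rw [LinearMap.comp_apply, sig₂_mul', diag2_mul']; rfl
  ev_one₁ := by
    rw [serz, LinearMap.comp_apply, sig_one hp, lau_single (by omega), map_one]
  ev_one₂ := by
    rw [serz, LinearMap.comp_apply, sig_one hp, lau_single (by omega), map_one]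

/-- The evaluation at `u = z + d h`, `v = w + d' h`. -/
def mixEval {p : ℕ} (hp : 0 < p) (hh : ∀ v : B, h ^ p • v = 0) {n : ℤ} (hn : 0 < n) (d d' : ℂ) :
    Evaluation B (HahnSeries ℤ (HahnSeries ℤ B)) (Ctr B) n where
  ev := (mix2 (n + 2)).comp (sig₂ p (cst d * h) (cst d' * h))
  ev₁ := { toFun := fun f => zEmb B (serz p (n + 2) d f)
           map_add' := fun f g => by rw [map_add, map_add]
           map_smul' := fun r f => by rw [map_smul, zEmb_smul]; rfl }
  ev₂ := { toFun := fun f => wEmb B (serz p (n + 2) d' f)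
           map_add' := fun f g => by rw [map_add, map_add]
           map_smul' := fun r f => by rw [map_smul, wEmb_smul]; rfl }
  a := zCtr B + algebraMap Coef _ (cst d * h)
  b := wCtr B + algebraMap Coef _ (cst d' * h)
  ev_left c hc := by
    rw [LinearMap.comp_apply, sig₂_left (pow_smul_eq_zero hh d), map_add, map_smul,
      mix2_sh_left (fun k l hkl => hc.sig₂ p _ _ k l (by omega)), add_smul, algebraMap_smul]
    rfl
  ev_right c hc := by
    rw [LinearMap.comp_apply, sig₂_right _ (pow_smul_eq_zero hh d'), map_add, map_smul,
      mix2_sh_right (fun k l hkl => hc.sig₂ p _ _ k l (by omega)), add_smul, algebraMap_smul]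
    rfl
  ev_mul f g := by
    rw [LinearMap.comp_apply, sig₂_mul, mix2_mul, ← wEmb_lau]
    rfl
  ev_mul' f g := by
    rw [LinearMap.comp_apply, sig₂_mul', mix2_mul', ← wEmb_lau]
    rfl
  ev_one₁ := by
    change zEmb B (serz p (n + 2) d _) = 1
    rw [serz, LinearMap.comp_apply, sig_one hp, lau_single (by omega), map_one, map_one]
  ev_one₂ := by
    change wEmb B (serz p (n + 2) d' _) = 1
    rw [serz, LinearMap.comp_apply, sig_one hp, lau_single (by omega), map_one, map_one]

/-- Factors of the form `z - w + r` with a constant `r` can be cancelled: the leading term of such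
an element with respect to `w` is `-w`. -/
theorem zw_regular (r : Coef) {x : HahnSeries ℤ (HahnSeries ℤ B)}
    (hx : ((zCtr B - wCtr B + algebraMap Coef (Ctr B) r : Ctr B) :
      HahnSeries ℤ (HahnSeries ℤ B)) * x = 0) : x = 0 := by
  by_contra hne
  have h1 := coeff_order_eq_zero.not.2 hne
  have h3 : x.coeff (x.order - 1) = 0 := coeff_eq_zero_of_lt_order (by omega)
  have hr : r • x = algebraMap Coef (HahnSeries ℤ (HahnSeries ℤ B)) r * x := Algebra.smul_def r x
  replace hx : C (zvar B) * x - zvar _ * x + r • x = 0 := by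
    rw [hr, ← sub_mul, ← add_mul]
    exact hx
  have h2 := congrArg (fun y => y.coeff (x.order - 1)) hx
  beta_reduce at h2
  rw [coeff_add, coeff_sub, coeff_C_mul', coeff_zvar_mul, coeff_smul, h3, sub_add_cancel,
    mul_zero, smul_zero, add_zero, zero_sub, coeff_zero] at h2
  exact h1 (neg_eq_zero.1 h2)

end Evaluations

end

/-! ### Operators on tensor powers -/

section Places

variable {ι F X K : Type*} [Fintype ι] [DecidableEq ι] [Fintype F] [DecidableEq F]
  [Fintype X] [DecidableEq X] [Ring K]

/-- The map `r` on multi-indices is a system of coordinates for the legs in `s`. -/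
structure IsPlace (s : Finset ι) (r : (ι → F) → X) : Prop where
  congr : ∀ I J, (∀ c ∈ s, I c = J c) → r I = r J
  eq_on : ∀ I J, r I = r J → ∀ c ∈ s, I c = J c
  surj : ∀ x, ∃ I, r I = x

/-- The matrix acting as `M` on the tensor factors in `s` and as the identity on the others. -/
def placeFun (s : Finset ι) (r : (ι → F) → X) (M : Matrix X X K) : Matrix (ι → F) (ι → F) K :=
  fun I J => if ∀ c, c ∉ s → I c = J c then M (r I) (r J) else 0

theorem IsPlace.congr_piecewise {s : Finset ι} {r : (ι → F) → X} (hr : IsPlace s r) (I J : ι → F) :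
    r (s.piecewise I J) = r I :=
  hr.congr _ _ fun c hc => by rw [Finset.piecewise_eq_of_mem _ _ _ hc]

/-- The product of matrices placed at disjoint sets of tensor factors. -/
theorem placeFun_mul_of_disjoint {Y : Type*} {s s' : Finset ι} (hd : Disjoint s s')
    {r : (ι → F) → X} {r' : (ι → F) → Y} (hr : IsPlace s r) [Fintype Y] (hr' : IsPlace s' r')
    (M : Matrix X X K) (M' : Matrix Y Y K) (I J : ι → F) :
    (placeFun s r M * placeFun s' r' M') I J =
      if ∀ c, c ∉ s → c ∉ s' → I c = J c then M (r I) (r J) * M' (r' I) (r' J) else 0 := by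
  rw [Matrix.mul_apply, Finset.sum_eq_single (s.piecewise J I)]
  · have h1 : (∀ c, c ∉ s → I c = s.piecewise J I c) := fun c hc => by
      rw [Finset.piecewise_eq_of_notMem _ _ _ hc]
    have h2 : (∀ c, c ∉ s' → s.piecewise J I c = J c) ↔ ∀ c, c ∉ s → c ∉ s' → I c = J c := by
      refine forall_congr' fun c => ?_
      by_cases hc : c ∈ s
      · simp [hc]
      · simp [hc]
    have h3 : r' (s.piecewise J I) = r' I := hr'.congr _ _ fun c hc => by
      rw [Finset.piecewise_eq_of_notMem _ _ _ (Finset.disjoint_right.1 hd hc)]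
    rw [placeFun, placeFun, if_pos h1, hr.congr_piecewise, h3]
    simp only [h2]
    split_ifs <;> simp
  · intro L _ hL
    rw [placeFun, placeFun]
    split_ifs with h1 h2
    · refine absurd (funext fun c => ?_) hL
      by_cases hc : c ∈ s
      · rw [Finset.piecewise_eq_of_mem _ _ _ hc, h2 c (Finset.disjoint_left.1 hd hc)]
      · rw [Finset.piecewise_eq_of_notMem _ _ _ hc, h1 c hc]
    all_goals simp
  · intro h
    exact absurd (Finset.mem_univ _) h

/-- Matrices placed at disjoint sets of tensor factors commute if their entries do. -/
theorem placeFun_commute {Y : Type*} {s s' : Finset ι} (hd : Disjoint s s')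
    {r : (ι → F) → X} {r' : (ι → F) → Y} (hr : IsPlace s r) [Fintype Y] [DecidableEq Y]
    (hr' : IsPlace s' r')
    {M : Matrix X X K} {M' : Matrix Y Y K} (h : ∀ x y x' y', Commute (M x y) (M' x' y')) :
    Commute (placeFun s r M) (placeFun s' r' M') := by
  ext I J
  change (placeFun s r M * placeFun s' r' M') I J = (placeFun s' r' M' * placeFun s r M) I J
  rw [placeFun_mul_of_disjoint hd hr hr', placeFun_mul_of_disjoint hd.symm hr' hr]
  have h2 : (∀ c, c ∉ s → c ∉ s' → I c = J c) ↔ ∀ c, c ∉ s' → c ∉ s → I c = J c :=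
    forall_congr' fun c => by tauto
  simp only [h2, (h _ _ _ _).eq]

theorem placeFun_mul_apply {s : Finset ι} {r : (ι → F) → X} (hr : IsPlace s r)
    (M : Matrix X X K) (A : Matrix (ι → F) (ι → F) K) (g : X → ι → F) (hg : ∀ x, r (g x) = x)
    (I J : ι → F) :
    (placeFun s r M * A) I J = ∑ x, M (r I) x * A (s.piecewise (g x) I) J := by
  rw [Matrix.mul_apply]
  symm
  refine Finset.sum_of_injOn (fun x => s.piecewise (g x) I) ?_ ?_ ?_ ?_
  · intro x _ y _ hxy
    have := congrArg r hxy
    beta_reduce at this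
    rwa [hr.congr_piecewise, hr.congr_piecewise, hg, hg] at this
  · intro x _
    exact Finset.mem_coe.2 (Finset.mem_univ _)
  · intro L _ hL
    rw [placeFun]
    split_ifs with h1
    · refine absurd ⟨r L, Finset.mem_coe.2 (Finset.mem_univ _), funext fun c => ?_⟩ hL
      beta_reduce
      by_cases hc : c ∈ s
      · rw [Finset.piecewise_eq_of_mem _ _ _ hc]
        exact hr.eq_on _ _ (hg _) c hc
      · rw [Finset.piecewise_eq_of_notMem _ _ _ hc, h1 c hc]
    · rw [zero_mul]
  · intro x _
    have h1 : (∀ c, c ∉ s → I c = s.piecewise (g x) I c) := fun c hc => by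
      rw [Finset.piecewise_eq_of_notMem _ _ _ hc]
    rw [placeFun, if_pos h1, hr.congr_piecewise, hg]

/-- The placement of matrices at the tensor factors in `s`, as a ring homomorphism. -/
def place {s : Finset ι} {r : (ι → F) → X} (hr : IsPlace s r) :
    Matrix X X K →+* Matrix (ι → F) (ι → F) K where
  toFun := placeFun s r
  map_one' := by
    ext I J
    rw [placeFun, Matrix.one_apply, Matrix.one_apply]
    by_cases h : I = J
    · simp [h]
    · rw [if_neg h]
      split_ifs with h1 h2
      · refine absurd (funext fun c => ?_) h
        by_cases hc : c ∈ s
        · exact hr.eq_on _ _ h2 c hc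
        · exact h1 c hc
      · rfl
      · rfl
  map_zero' := by
    ext I J
    simp [placeFun]
  map_add' M M' := by
    ext I J
    simp only [placeFun, Matrix.add_apply]
    split_ifs <;> simp
  map_mul' M M' := by
    choose g hg using hr.surj
    ext I J
    rw [placeFun_mul_apply hr M _ g hg]
    have h1 : ∀ x, (∀ c, c ∉ s → s.piecewise (g x) I c = J c) ↔ ∀ c, c ∉ s → I c = J c := by
      intro x
      refine forall_congr' fun c => ?_
      by_cases hc : c ∈ s <;> simp [hc]
    simp only [placeFun, h1, hr.congr_piecewise, hg]
    split_ifs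
    · rw [Matrix.mul_apply]
    · simp

theorem place_apply {s : Finset ι} {r : (ι → F) → X} (hr : IsPlace s r) (M : Matrix X X K)
    (I J : ι → F) :
    place hr M I J = if ∀ c, c ∉ s → I c = J c then M (r I) (r J) else 0 := rfl

theorem isPlace_leg (i : ι) : IsPlace {i} (fun I : ι → F => I i) where
  congr I J h := h i (Finset.mem_singleton_self i)
  eq_on I J h c hc := by rwa [Finset.mem_singleton.1 hc]
  surj x := ⟨fun _ => x, rfl⟩

theorem isPlace_pair {i j : ι} (hij : i ≠ j) : IsPlace {i, j} (fun I : ι → F => (I i, I j)) where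
  congr I J h := by rw [h i (by simp), h j (by simp)]
  eq_on I J h c hc := by
    rw [Prod.ext_iff] at h
    rcases Finset.mem_insert.1 hc with rfl | hc
    · exact h.1
    · rw [Finset.mem_singleton.1 hc]; exact h.2
  surj x := ⟨fun c => if c = i then x.1 else x.2, by simp [hij.symm]⟩

theorem isPlace_embed {κ : Type*} [Fintype κ] [Nonempty F] (f : κ ↪ ι) :
    IsPlace (Finset.univ.map f) (fun (I : ι → F) (c : κ) => I (f c)) where
  congr I J h := funext fun c => h _ (Finset.mem_map_of_mem f (Finset.mem_univ c))
  eq_on I J h c hc := by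
    obtain ⟨d, _, rfl⟩ := Finset.mem_map.1 hc
    exact congrFun h d
  surj x := ⟨Function.extend f x fun _ => Classical.arbitrary F,
    funext fun c => f.injective.extend_apply _ _ _⟩

/-- The matrix acting as `S` on the tensor factor `i`. -/
def leg (i : ι) : Matrix F F K →+* Matrix (ι → F) (ι → F) K := place (isPlace_leg i)

/-- The matrix acting as `M` on the tensor factors `i` and `j`. -/
def pair {i j : ι} (hij : i ≠ j) : Matrix (F × F) (F × F) K →+* Matrix (ι → F) (ι → F) K :=
  place (isPlace_pair hij)

/-- The matrix acting as `M` on the tensor factors labelled by the image of `f`. -/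
def embed {κ : Type*} [Fintype κ] [DecidableEq κ] [Nonempty F] (f : κ ↪ ι) :
    Matrix (κ → F) (κ → F) K →+* Matrix (ι → F) (ι → F) K := place (isPlace_embed f)

theorem leg_apply (i : ι) (S : Matrix F F K) (I J : ι → F) :
    leg i S I J = if ∀ c, c ≠ i → I c = J c then S (I i) (J i) else 0 := by
  simp only [leg, place_apply, Finset.mem_singleton]

theorem pair_apply {i j : ι} (hij : i ≠ j) (M : Matrix (F × F) (F × F) K) (I J : ι → F) :
    pair hij M I J = if ∀ c, c ≠ i → c ≠ j → I c = J c then M (I i, I j) (J i, J j) else 0 := by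
  simp only [pair, place_apply, Finset.mem_insert, Finset.mem_singleton, not_or, and_imp]

theorem embed_apply {κ : Type*} [Fintype κ] [DecidableEq κ] [Nonempty F] (f : κ ↪ ι)
    (M : Matrix (κ → F) (κ → F) K) (I J : ι → F) :
    embed f M I J = if ∀ c, c ∉ Set.range f → I c = J c then M (I ∘ f) (J ∘ f) else 0 := by
  simp only [embed, place_apply, Finset.mem_map, Finset.mem_univ, true_and, Set.mem_range]
  rfl

theorem embed_leg {κ : Type*} [Fintype κ] [DecidableEq κ] [Nonempty F] (f : κ ↪ ι) (i : κ)
    (S : Matrix F F K) : embed f (leg i S) = leg (f i) S := by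
  ext I J
  rw [embed_apply, leg_apply, leg_apply, ← ite_and]
  refine if_congr ⟨fun h c hc => ?_, fun h => ⟨fun c hc => h c ?_, fun c hc => h _ ?_⟩⟩ rfl rfl
  · by_cases hr : c ∈ Set.range f
    · obtain ⟨d, rfl⟩ := hr
      exact h.2 d fun hd => hc (congrArg f hd)
    · exact h.1 c hr
  · rintro rfl
    exact hc ⟨i, rfl⟩
  · exact fun hd => hc (f.injective hd)

theorem embed_pair {κ : Type*} [Fintype κ] [DecidableEq κ] [Nonempty F] (f : κ ↪ ι) {i j : κ}
    (hij : i ≠ j) (M : Matrix (F × F) (F × F) K) :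
    embed f (pair hij M) = pair (f.injective.ne hij) M := by
  ext I J
  rw [embed_apply, pair_apply, pair_apply, ← ite_and]
  refine if_congr ⟨fun h c hc hc' => ?_, fun h => ⟨fun c hc => h c ?_ ?_, fun c hc hc' => h _ ?_ ?_⟩⟩
    rfl rfl
  · by_cases hr : c ∈ Set.range f
    · obtain ⟨d, rfl⟩ := hr
      exact h.2 d (fun hd => hc (congrArg f hd)) fun hd => hc' (congrArg f hd)
    · exact h.1 c hr
  · rintro rfl
    exact hc ⟨i, rfl⟩
  · rintro rfl
    exact hc ⟨j, rfl⟩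
  · exact fun hd => hc (f.injective hd)
  · exact fun hd => hc' (f.injective hd)

theorem pair_leg1 {N : ℕ} {i j : ι} (hij : i ≠ j) (S : Matrix (Fin N) (Fin N) K) :
    pair hij (leg1 S) = leg i S := by
  ext I J
  rw [pair_apply, leg_apply, leg1_apply, mul_ite, mul_one, mul_zero, ← ite_and]
  refine if_congr ⟨fun h c hc => ?_, fun h => ⟨fun c hc _ => h c hc, h j hij.symm⟩⟩ rfl rfl
  by_cases hcj : c = j
  · rw [hcj]; exact h.2
  · exact h.1 c hc hcj

theorem pair_leg2 {N : ℕ} {i j : ι} (hij : i ≠ j) (S : Matrix (Fin N) (Fin N) K) :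
    pair hij (leg2 S) = leg j S := by
  ext I J
  rw [pair_apply, leg_apply, leg2_apply, ite_mul, one_mul, zero_mul, ← ite_and]
  refine if_congr ⟨fun h c hc => ?_, fun h => ⟨fun c _ hc => h c hc, h i hij⟩⟩ rfl rfl
  by_cases hcj : c = i
  · rw [hcj]; exact h.2
  · exact h.1 c hcj hc

theorem pair_commute_leg {i j c : ι} (hij : i ≠ j) (hi : c ≠ i) (hj : c ≠ j)
    {M : Matrix (F × F) (F × F) K} {S : Matrix F F K} (h : ∀ x y a b, Commute (M x y) (S a b)) :
    Commute (pair hij M) (leg c S) := by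
  refine placeFun_commute ?_ (isPlace_pair hij) (isPlace_leg c) h
  simp [hi, hj]

theorem pair_commute_pair {i j i' j' : ι} (hij : i ≠ j) (hij' : i' ≠ j') (h1 : i ≠ i') (h2 : i ≠ j')
    (h3 : j ≠ i') (h4 : j ≠ j') {M M' : Matrix (F × F) (F × F) K}
    (h : ∀ x y a b, Commute (M x y) (M' a b)) : Commute (pair hij M) (pair hij' M') := by
  refine placeFun_commute ?_ (isPlace_pair hij) (isPlace_pair hij') h
  simp [h1.symm, h2.symm, h3.symm, h4.symm]

theorem embed_commute {κ κ' : Type*} [Fintype κ] [DecidableEq κ] [Fintype κ'] [DecidableEq κ']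
    [Nonempty F] {f : κ ↪ ι} {f' : κ' ↪ ι} (hf : ∀ a b, f a ≠ f' b)
    {M : Matrix (κ → F) (κ → F) K} {M' : Matrix (κ' → F) (κ' → F) K}
    (h : ∀ x y a b, Commute (M x y) (M' a b)) : Commute (embed f M) (embed f' M') := by
  refine placeFun_commute ?_ (isPlace_embed f) (isPlace_embed f') h
  rw [Finset.disjoint_left]
  simpa using fun a b => (hf a b).symm

theorem embed_commute_leg {κ : Type*} [Fintype κ] [DecidableEq κ]
    [Nonempty F] {f : κ ↪ ι} {c : ι} (hc : ∀ a, f a ≠ c)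
    {M : Matrix (κ → F) (κ → F) K} {S : Matrix F F K}
    (h : ∀ x y a b, Commute (M x y) (S a b)) : Commute (embed f M) (leg c S) := by
  refine placeFun_commute ?_ (isPlace_embed f) (isPlace_leg c) h
  simpa using hc

/-- The trace of a product of matrices acting on complementary tensor factors. -/
theorem trace_embed_mul_embed {κ κ' : Type*} [Fintype κ] [DecidableEq κ] [Fintype κ']
    [DecidableEq κ'] [Nonempty F] (M : Matrix (κ → F) (κ → F) K) (M' : Matrix (κ' → F) (κ' → F) K) :
    (embed (Function.Embedding.inl : κ ↪ κ ⊕ κ') M * embed Function.Embedding.inr M').trace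
      = M.trace * M'.trace := by
  have e : ∀ I : κ ⊕ κ' → F, (embed (Function.Embedding.inl : κ ↪ κ ⊕ κ') M *
      embed Function.Embedding.inr M' : Matrix (κ ⊕ κ' → F) (κ ⊕ κ' → F) K) I I = M (I ∘ Sum.inl) (I ∘ Sum.inl) *
        M' (I ∘ Sum.inr) (I ∘ Sum.inr) := fun I => by
    refine (placeFun_mul_of_disjoint ?_ (isPlace_embed _) (isPlace_embed _) M M' I I).trans ?_
    · rw [Finset.disjoint_left]
      simp
    · rw [if_pos fun _ _ _ => rfl]
      rfl
  simp only [Matrix.trace, Matrix.diag_apply, e]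
  rw [← (Equiv.sumArrowEquivProdArrow κ κ' F).symm.sum_comp, Fintype.sum_prod_type,
    Finset.sum_mul_sum]
  rfl

theorem trace_embed_mul_embed' {κ κ' : Type*} [Fintype κ] [DecidableEq κ] [Fintype κ']
    [DecidableEq κ'] [Nonempty F] (M : Matrix (κ → F) (κ → F) K) (M' : Matrix (κ' → F) (κ' → F) K) :
    (embed (Function.Embedding.inr : κ' ↪ κ ⊕ κ') M' * embed Function.Embedding.inl M).trace
      = M'.trace * M.trace := by
  have e : ∀ I : κ ⊕ κ' → F, (embed (Function.Embedding.inr : κ' ↪ κ ⊕ κ') M' *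
      embed Function.Embedding.inl M : Matrix (κ ⊕ κ' → F) (κ ⊕ κ' → F) K) I I = M' (I ∘ Sum.inr) (I ∘ Sum.inr) *
        M (I ∘ Sum.inl) (I ∘ Sum.inl) := fun I => by
    refine (placeFun_mul_of_disjoint ?_ (isPlace_embed _) (isPlace_embed _) M' M I I).trans ?_
    · rw [Finset.disjoint_left]
      simp
    · rw [if_pos fun _ _ _ => rfl]
      rfl
  simp only [Matrix.trace, Matrix.diag_apply, e]
  rw [← (Equiv.sumArrowEquivProdArrow κ κ' F).symm.sum_comp, Fintype.sum_prod_type,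
    Finset.sum_mul_sum, Finset.sum_comm]
  rfl

/-- The entries of an ordered product of matrices acting on different tensor factors. -/
theorem list_prod_leg_apply (S : ι → Matrix F F K) (l : List ι) (hl : l.Nodup) (I J : ι → F) :
    (l.map fun i => leg i (S i)).prod I J =
      if ∀ c, c ∉ l → I c = J c then (l.map fun i => S i (I i) (J i)).prod else 0 := by
  induction l generalizing I with
  | nil =>
    simp only [List.map_nil, List.prod_nil, Matrix.one_apply, List.not_mem_nil, not_false_eq_true,
      true_imp_iff, funext_iff]
  | cons i l ih =>
    obtain ⟨hi, hl⟩ := List.nodup_cons.1 hl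
    rw [List.map_cons, List.prod_cons]
    refine (placeFun_mul_apply (isPlace_leg i) (S i) _ (fun x _ => x) (fun x => rfl) I J).trans ?_
    simp only [ih hl]
    rw [Finset.sum_eq_single (J i)]
    · have h1 : (∀ c, c ∉ l → Finset.piecewise {i} (fun _ => J i) I c = J c) ↔
          ∀ c, c ∉ i :: l → I c = J c := by
        refine forall_congr' fun c => ?_
        by_cases hc : c = i
        · simp [hc]
        · simp [hc]
      simp only [h1, List.map_cons, List.prod_cons, mul_ite, mul_zero]
      congr 2
      refine congrArg List.prod (List.map_congr_left fun c hc => ?_)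
      rw [Finset.piecewise_eq_of_notMem]
      rw [Finset.mem_singleton]
      rintro rfl
      exact hi hc
    · intro x _ hx
      rw [if_neg, mul_zero]
      intro h
      have := h i hi
      simp only [Finset.piecewise_singleton, Function.update_self] at this
      exact hx this
    · intro h
      exact absurd (Finset.mem_univ _) h

end Places

section Permutations

variable {ι F K : Type*} [Fintype ι] [DecidableEq ι] [Fintype F] [DecidableEq F] [Ring K]

/-- The permutation of tensor factors. -/
def permMat (F K : Type*) [DecidableEq F] [Ring K] (σ : Equiv.Perm ι) :
    Matrix (ι → F) (ι → F) K :=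
  fun I J => if I = J ∘ (σ⁻¹ : Equiv.Perm ι) then 1 else 0

theorem permMat_mul_apply (σ : Equiv.Perm ι) (A : Matrix (ι → F) (ι → F) K) (I J : ι → F) :
    (permMat F K σ * A) I J = A (I ∘ σ) J := by
  rw [Matrix.mul_apply, Finset.sum_eq_single (I ∘ σ)]
  · rw [permMat, if_pos, one_mul]
    funext c; simp
  · intro L _ hL
    rw [permMat, if_neg, zero_mul]
    rintro rfl
    apply hL
    funext c; simp
  · intro h
    exact absurd (Finset.mem_univ _) h

theorem mul_permMat_apply (σ : Equiv.Perm ι) (A : Matrix (ι → F) (ι → F) K) (I J : ι → F) :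
    (A * permMat F K σ) I J = A I (J ∘ (σ⁻¹ : Equiv.Perm ι)) := by
  rw [Matrix.mul_apply, Finset.sum_eq_single (J ∘ (σ⁻¹ : Equiv.Perm ι))]
  · rw [permMat, if_pos rfl, mul_one]
  · intro L _ hL
    rw [permMat, if_neg hL, mul_zero]
  · intro h
    exact absurd (Finset.mem_univ _) h

theorem permMat_mul (σ τ : Equiv.Perm ι) :
    permMat F K (σ * τ) = permMat F K σ * permMat F K τ := by
  ext I J
  rw [permMat_mul_apply, permMat, permMat]
  refine if_congr ?_ rfl rfl
  constructor
  · rintro rfl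
    funext c; simp
  · intro h
    funext c
    have := congrFun h (σ⁻¹ c)
    simpa using this

theorem permMat_one : permMat F K (1 : Equiv.Perm ι) = 1 := by
  ext I J
  rw [permMat, Matrix.one_apply]
  rfl

/-- The conjugation by a permutation moves the tensor factors on which an operator acts. -/
theorem permMat_mul_pair (σ : Equiv.Perm ι) {i j : ι} (hij : i ≠ j) (M : Matrix (F × F) (F × F) K) :
    permMat F K σ * pair hij M = pair (σ.injective.ne hij) M * permMat F K σ := by
  ext I J
  rw [permMat_mul_apply, mul_permMat_apply, pair_apply, pair_apply]
  refine if_congr ⟨fun h c hc hc' => ?_, fun h c hc hc' => ?_⟩ (by simp) rfl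
  · have := h (σ⁻¹ c) (fun e => hc (by simp [← e])) (fun e => hc' (by simp [← e]))
    simpa using this
  · have := h (σ c) (σ.injective.ne hc) (σ.injective.ne hc')
    simpa using this

end Permutations

/-! ### Relations in the Brauer algebra -/

section BrauerAlgebra

variable {R Z : Type*} [Ring R] [CommRing Z] [Algebra Z R]

/-- The relations between the images `P_{ij}`, `Q_{ij}` of the generators of the Brauer algebra on
three legs, with `p = P_{12}`, `q = P_{13}`, `r = P_{23}` and `A = Q_{12}`, `B = Q_{13}`,
`C = Q_{23}`. The parameter of the algebra is `2 m`. -/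
structure BrauerTriple (η m : Z) (p q r A B C : R) : Prop where
  pp : p * p = 1
  qq : q * q = 1
  rr : r * r = 1
  pq : p * q = q * r
  rp : r * p = p * q
  rq : r * q = q * p
  pr : p * r = q * p
  pA : p * A = η • A
  Ap : A * p = η • A
  qB : q * B = η • B
  Bq : B * q = η • B
  rC : r * C = η • C
  Cr : C * r = η • C
  AA : A * A = (2 * m) • A
  BB : B * B = (2 * m) • B
  CC : C * C = (2 * m) • C
  Ar : A * r = A * B
  rB : r * B = A * B
  Br : B * r = B * A
  rA : r * A = B * A
  Aq : A * q = A * C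
  qC : q * C = A * C
  Cq : C * q = C * A
  qA : q * A = C * A
  Bp : B * p = B * C
  pC : p * C = B * C
  Cp : C * p = C * B
  pB : p * B = C * B

/-- The matrix `x (x - s) - t (x - s) P + t x Q`. -/
def Rmat (t s : Z) (P Q : R) (x : Z) : R := (x * (x - s)) • 1 - (t * (x - s)) • P + (t * x) • Q

/-- The unitarity of the `R`-matrix. -/
theorem Rmat_mul_neg {η m : Z} {P Q : R} (hη : η = 1 ∨ η = -1) (h1 : P * P = 1) (h2 : P * Q = η • Q)
    (h3 : Q * P = η • Q) (h4 : Q * Q = (2 * m) • Q) (t x : Z) :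
    Rmat t (t * (m - η)) P Q x * Rmat t (t * (m - η)) P Q (-x) =
      ((x ^ 2 - t ^ 2) * (x ^ 2 - (t * (m - η)) ^ 2)) • 1 := by
  simp only [Rmat, mul_add (_ : R), mul_sub (_ : R), add_mul _ _ (_ : R), sub_mul _ _ (_ : R),
    smul_mul_assoc, mul_smul_comm, one_mul, mul_one, h1, h2, h3, h4, smul_smul]
  rcases hη with rfl | rfl <;> module

namespace BrauerTriple

variable {η m : Z} {p q r A B C : R} (H : BrauerTriple η m p q r A B C)
include H

theorem pqr : p * q * r = q := by rw [H.pq, mul_assoc, H.rr, mul_one]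
theorem pAC : p * (A * C) = η • (A * C) := by rw [← mul_assoc, H.pA, smul_mul_assoc]
theorem pqC : p * q * C = η • (A * C) := by rw [mul_assoc, H.qC, H.pAC]
theorem CAp : C * A * p = η • (C * A) := by rw [mul_assoc, H.Ap, mul_smul_comm]
theorem CBr : C * B * r = η • (C * A) := by
  rw [← H.Cp, mul_assoc, H.pr, ← mul_assoc, H.Cq, H.CAp]
theorem CBC : C * B * C = C := by rw [← H.pB, mul_assoc, ← H.pC, ← mul_assoc, H.pp, one_mul]
theorem ACr : A * C * r = η • (A * C) := by rw [mul_assoc, H.Cr, mul_smul_comm]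
theorem ACC : A * C * C = (2 * m) • (A * C) := by rw [mul_assoc, H.CC, mul_smul_comm]
theorem ABr : A * B * r = A := by rw [← H.Ar, mul_assoc, H.rr, mul_one]
theorem ABC : A * B * C = η • (A * C) := by rw [mul_assoc, ← H.pC, ← mul_assoc, H.Ap, smul_mul_assoc]
theorem qpp : q * p * p = q := by rw [mul_assoc, H.pp, mul_one]
theorem qpA : q * p * A = η • (C * A) := by rw [mul_assoc, H.pA, mul_smul_comm, H.qA]
theorem ABp : A * B * p = η • (A * C) := by rw [← H.rB, mul_assoc, H.Bp, ← mul_assoc, H.rB, H.ABC]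
theorem ABA : A * B * A = A := by rw [← H.rB, mul_assoc, ← H.rA, ← mul_assoc, H.rr, one_mul]
theorem CAA : C * A * A = (2 * m) • (C * A) := by rw [mul_assoc, H.AA, mul_smul_comm]
theorem CBp : C * B * p = C := by rw [← H.Cp, mul_assoc, H.pp, mul_one]
theorem CBA : C * B * A = η • (C * A) := by
  rw [mul_assoc, ← H.rA, ← mul_assoc, H.Cr, smul_mul_assoc]

/-- The Yang–Baxter equation at the point where the `R`-matrix in the first two legs degenerates
to a multiple of the idempotent `(1 + η P)/2 - Q/N`. -/
theorem fused_yang_baxter (hη : η = 1 ∨ η = -1) (t x : Z) :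
    (m • (1 + η • p) - A) * Rmat t (t * (m - η)) q B x * Rmat t (t * (m - η)) r C (x + η * t)
      = Rmat t (t * (m - η)) r C (x + η * t) * Rmat t (t * (m - η)) q B x *
        (m • (1 + η • p) - A) := by
  simp only [Rmat, mul_add (_ : R), mul_sub (_ : R), add_mul _ _ (_ : R), sub_mul _ _ (_ : R),
    smul_mul_assoc, mul_smul_comm, one_mul, mul_one, smul_smul, smul_add,
    H.rq, H.pr, H.Ar, H.rB, H.Br, H.rA, H.Aq, H.qC, H.Cq, H.qA, H.Bp, H.pC, H.Cp,
    H.pB, H.rp, H.pqr, H.pqC, H.CBr, H.CBC, H.ACr, H.ACC, H.ABr, H.ABC, H.qpp, H.qpA, H.ABp, H.ABA,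
    H.CAA, H.CBp, H.CBA, H.CAp, ← H.pq]
  rcases hη with rfl | rfl <;> module

end BrauerTriple
end BrauerAlgebra

section BrauerMatrices

/-- The operator `Q`, replaced by zero for `gl_N`. -/
def brau (g : LieType) (N : ℕ) : Matrix (Fin N × Fin N) (Fin N × Fin N) ℂ :=
  match g with
  | .gl => 0
  | g => brauerOp g N

theorem brau_gl (N : ℕ) : brau .gl N = 0 := rfl

theorem brau_osp {g : LieType} (hg : g ≠ .gl) (N : ℕ) : brau g N = brauerOp g N := by
  cases g with
  | gl => exact absurd rfl hg
  | o => rfl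
  | sp => rfl

theorem sgn_mul_self (g : LieType) (N : ℕ) (i : Fin N) : sgn g N i * sgn g N i = 1 := by
  cases g <;> simp only [sgn, mul_one]
  split_ifs <;> simp

theorem sgn_rev {g : LieType} (hg : g ≠ .gl) {N : ℕ} (hsp : g = .sp → Even N) (i : Fin N) :
    sgn g N i.rev = eta g * sgn g N i := by
  cases g with
  | gl => exact absurd rfl hg
  | o => simp [sgn, eta]
  | sp =>
    obtain ⟨k, hk⟩ := hsp rfl
    have := i.2
    simp only [sgn, eta, Fin.val_rev]
    split_ifs <;> first | omega | simp

theorem brau_apply_osp {g : LieType} (hg : g ≠ .gl) (N : ℕ) (a b : Fin N × Fin N) :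
    brau g N a b = if a.2 = a.1.rev ∧ b.2 = b.1.rev then sgn g N a.1 * sgn g N b.1 else 0 := by
  rw [brau_osp hg]; rfl

theorem permOp_mul_apply {N : ℕ} (M : Matrix (Fin N × Fin N) (Fin N × Fin N) ℂ) (a b) :
    (permOp N * M) a b = M a.swap b := by
  rw [Matrix.mul_apply, Finset.sum_eq_single a.swap]
  · simp [permOp]
  · intro c _ hc
    rw [permOp, if_neg, zero_mul]
    rintro ⟨h1, h2⟩
    exact hc (Prod.ext h2.symm h1.symm)
  · intro h
    exact absurd (Finset.mem_univ _) h

theorem mul_permOp_apply {N : ℕ} (M : Matrix (Fin N × Fin N) (Fin N × Fin N) ℂ) (a b) :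
    (M * permOp N) a b = M a b.swap := by
  rw [Matrix.mul_apply, Finset.sum_eq_single b.swap]
  · simp [permOp]
  · intro c _ hc
    rw [permOp, if_neg, mul_zero]
    rintro ⟨h1, h2⟩
    exact hc (Prod.ext h1 h2)
  · intro h
    exact absurd (Finset.mem_univ _) h

theorem permOp_mul_permOp (N : ℕ) : permOp N * permOp N = 1 := by
  ext a b
  rw [permOp_mul_apply, permOp, Matrix.one_apply]
  simp only [Prod.fst_swap, Prod.snd_swap, Prod.ext_iff]
  exact if_congr and_comm rfl rfl

theorem permOp_mul_brau (g : LieType) {N : ℕ} (hsp : g = .sp → Even N) :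
    permOp N * brau g N = eta g • brau g N := by
  by_cases hg : g = .gl
  · subst hg; simp [brau_gl]
  ext a b
  rw [permOp_mul_apply, Matrix.smul_apply, brau_apply_osp hg, brau_apply_osp hg, smul_eq_mul,
    mul_ite, mul_zero]
  simp only [Prod.fst_swap, Prod.snd_swap]
  by_cases h1 : a.2 = a.1.rev
  · rw [h1, Fin.rev_rev, sgn_rev hg hsp, mul_assoc]
    simp
  · rw [if_neg, if_neg]
    · exact fun h => h1 h.1
    · exact fun h => h1 (by rw [h.1, Fin.rev_rev])

theorem brau_mul_permOp (g : LieType) {N : ℕ} (hsp : g = .sp → Even N) :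
    brau g N * permOp N = eta g • brau g N := by
  by_cases hg : g = .gl
  · subst hg; simp [brau_gl]
  ext a b
  rw [mul_permOp_apply, Matrix.smul_apply, brau_apply_osp hg, brau_apply_osp hg, smul_eq_mul,
    mul_ite, mul_zero]
  simp only [Prod.fst_swap, Prod.snd_swap]
  by_cases h1 : b.2 = b.1.rev
  · rw [h1, Fin.rev_rev, sgn_rev hg hsp, mul_left_comm]
    simp
  · rw [if_neg, if_neg]
    · exact fun h => h1 h.2
    · exact fun h => h1 (by rw [h.2, Fin.rev_rev])

theorem brau_mul_brau (g : LieType) {N : ℕ} : brau g N * brau g N = (N : ℂ) • brau g N := by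
  by_cases hg : g = .gl
  · subst hg; simp [brau_gl]
  ext a b
  rw [Matrix.mul_apply, Fintype.sum_prod_type, Matrix.smul_apply]
  simp only [brau_apply_osp hg]
  rw [Finset.sum_congr rfl (g := fun _ => if a.2 = a.1.rev ∧ b.2 = b.1.rev then
    sgn g N a.1 * sgn g N b.1 else 0)]
  · simp
  intro c _
  rw [Finset.sum_eq_single c.rev]
  · by_cases h1 : a.2 = a.1.rev <;> by_cases h2 : b.2 = b.1.rev <;> simp [h1, h2]
    linear_combination (sgn g N a.1 * sgn g N b.1) * sgn_mul_self g N c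
  · intro d _ hd
    simp [hd]
  · intro h
    exact absurd (Finset.mem_univ _) h

/-- The idempotent `(1 + η P)/2 - Q/N`. -/
def fuseIdem (g : LieType) (N : ℕ) : Matrix (Fin N × Fin N) (Fin N × Fin N) ℂ :=
  (1 / 2 : ℂ) • (1 + eta g • permOp N) - (1 / N : ℂ) • brau g N

theorem fuseIdem_mul_permOp (g : LieType) {N : ℕ} (hsp : g = .sp → Even N) :
    fuseIdem g N * permOp N = eta g • fuseIdem g N := by
  rw [fuseIdem, sub_mul, smul_mul_assoc, add_mul, smul_mul_assoc, permOp_mul_permOp, one_mul,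
    smul_mul_assoc, brau_mul_permOp g hsp]
  generalize permOp N = P
  generalize brau g N = Q
  cases g <;> simp only [eta] <;> module

theorem fuseIdem_mul_brau (g : LieType) {N : ℕ} (hN : N ≠ 0) (hsp : g = .sp → Even N) :
    fuseIdem g N * brau g N = 0 := by
  have hN' : (N : ℂ) ≠ 0 := by exact_mod_cast hN
  rw [fuseIdem, sub_mul, smul_mul_assoc, add_mul, smul_mul_assoc, permOp_mul_brau g hsp, one_mul,
    smul_mul_assoc, brau_mul_brau, smul_smul, smul_smul, eta_mul_self, one_div_mul_cancel hN']
  generalize brau g N = Q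
  module

theorem fuseIdem_mul_self (g : LieType) {N : ℕ} (hN : N ≠ 0) (hsp : g = .sp → Even N) :
    fuseIdem g N * fuseIdem g N = fuseIdem g N := by
  conv_lhs => arg 2; rw [fuseIdem]
  rw [mul_sub, mul_smul_comm, mul_add, mul_smul_comm, mul_smul_comm, fuseIdem_mul_permOp g hsp,
    fuseIdem_mul_brau g hN hsp, smul_smul, eta_mul_self, mul_one]
  generalize fuseIdem g N = e
  module

variable {ι : Type*} [Fintype ι] [DecidableEq ι] {N : ℕ}

theorem pair_permOp {i j : ι} (hij : i ≠ j) :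
    pair hij (permOp N) = permMat (Fin N) ℂ (Equiv.swap i j) := by
  ext I J
  rw [pair_apply, permOp, permMat, ← ite_and, Equiv.swap_inv]
  refine if_congr ⟨fun h => funext fun c => ?_, ?_⟩ rfl rfl
  · by_cases hi : c = i
    · subst hi; simpa using h.2.1
    · by_cases hj : c = j
      · subst hj; simpa using h.2.2
      · simpa [Equiv.swap_apply_of_ne_of_ne hi hj] using h.1 c hi hj
  · rintro rfl
    refine ⟨fun c hi hj => ?_, ?_, ?_⟩ <;> simp [Equiv.swap_apply_of_ne_of_ne, *]

theorem pair_brau_apply {g : LieType} (hg : g ≠ .gl) {i j : ι} (hij : i ≠ j) (I J : ι → Fin N) :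
    pair hij (brau g N) I J = if (∀ c, c ≠ i → c ≠ j → I c = J c) ∧ I j = (I i).rev ∧
      J j = (J i).rev then sgn g N (I i) * sgn g N (J i) else 0 := by
  rw [pair_apply, brau_apply_osp hg, ← ite_and]

theorem pair_brau_comm (g : LieType) (hsp : g = .sp → Even N) {i j : ι} (hij : i ≠ j) :
    pair hij (brau g N) = pair hij.symm (brau g N) := by
  by_cases hg : g = .gl
  · subst hg; simp [brau_gl]
  ext I J
  rw [pair_brau_apply hg, pair_brau_apply hg]
  by_cases h1 : I j = (I i).rev
  · by_cases h2 : J j = (J i).rev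
    · refine if_congr ?_ ?_ rfl
      · simp only [h1, h2, Fin.rev_rev, and_true]
        exact ⟨fun h c hc hc' => h c hc' hc, fun h c hc hc' => h c hc' hc⟩
      · rw [h1, h2, sgn_rev hg hsp, sgn_rev hg hsp]
        linear_combination (-sgn g N (I i) * sgn g N (J i)) * eta_mul_self g
    · rw [if_neg (fun h => h2 h.2.2), if_neg]
      exact fun h => h2 (by rw [h.2.2, Fin.rev_rev])
  · rw [if_neg (fun h => h1 h.2.1), if_neg]
    exact fun h => h1 (by rw [h.2.1, Fin.rev_rev])

theorem pair_permOp_comm {i j : ι} (hij : i ≠ j) :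
    pair hij (permOp N) = pair hij.symm (permOp N) := by
  rw [pair_permOp, pair_permOp, Equiv.swap_comm]

theorem pair_permOp_mul_pair_left {i j k : ι} (hij : i ≠ j) (hik : i ≠ k) (hjk : j ≠ k)
    (M : Matrix (Fin N × Fin N) (Fin N × Fin N) ℂ) :
    pair hij (permOp N) * pair hik M = pair hjk M * pair hij (permOp N) := by
  rw [pair_permOp, permMat_mul_pair]
  simp only [Equiv.swap_apply_left, Equiv.swap_apply_of_ne_of_ne hik.symm hjk.symm]

/-- The relation `Q_{ij} Q_{ik} = Q_{ij} P_{jk}`. -/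
theorem pair_brau_mul_pair_brau (g : LieType) {i j k : ι} (hij : i ≠ j) (hik : i ≠ k)
    (hjk : j ≠ k) : pair hij (brau g N) * pair hik (brau g N) =
      pair hij (brau g N) * pair hjk (permOp N) := by
  by_cases hg : g = .gl
  · subst hg; simp [brau_gl]
  ext I J
  rw [pair_permOp hjk, mul_permMat_apply, Equiv.swap_inv, pair_brau_apply hg]
  refine (placeFun_mul_apply (isPlace_pair hij) _ _ (fun x c => if c = i then x.1 else x.2)
    (fun x => by simp [hij.symm]) I J).trans ?_
  rw [Finset.sum_eq_single ((I k).rev, I k)]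
  · rw [pair_brau_apply hg, brau_apply_osp hg]
    simp only [Finset.piecewise_insert, Finset.piecewise_singleton, Function.update_self,
      Function.comp_apply, Equiv.swap_apply_left, Equiv.swap_apply_of_ne_of_ne hij hik,
      Function.update_of_ne hik.symm, Function.update_of_ne hjk.symm, Fin.rev_rev, and_true, if_true,
      ← ite_and, ite_mul, mul_ite, mul_zero, zero_mul]
    refine if_congr ?_ ?_ rfl
    · constructor
      · rintro ⟨⟨h1, -, h2⟩, h3⟩
        refine ⟨fun c hi hj => ?_, h3, h2⟩
        by_cases hk : c = k
        · subst hk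
          simpa [hij.symm] using h1 j hij.symm hjk
        · simpa [hi, hj, hk, Equiv.swap_apply_of_ne_of_ne] using h1 c hi hk
      · rintro ⟨h1, h3, h2⟩
        refine ⟨⟨fun c hi hk => ?_, trivial, h2⟩, h3⟩
        by_cases hj : c = j
        · subst hj
          simpa [hij.symm] using h1 k hik.symm hjk.symm
        · simpa [hi, hj, hk, Equiv.swap_apply_of_ne_of_ne] using h1 c hi hj
    · linear_combination (sgn g N (I i) * sgn g N (J i)) * sgn_mul_self g N (I k).rev
  · intro x _ hx
    rw [brau_apply_osp hg, pair_brau_apply hg]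
    split_ifs with h1 h2
    · refine absurd ?_ hx
      have := h2.2.1
      simp only [Finset.piecewise_insert, Finset.piecewise_singleton, Function.update_self,
      Function.update_of_ne hik.symm, Function.update_of_ne hjk.symm, if_true] at this
      rw [this, Fin.rev_rev]
      exact Prod.ext rfl (by rw [h1.2])
    all_goals simp
  · intro h
    exact absurd (Finset.mem_univ _) h

/-- The relations between the operators on three tensor factors. -/
theorem brauerTriple_pair (g : LieType) (hsp : g = .sp → Even N) {i j k : ι} (hij : i ≠ j)
    (hik : i ≠ k) (hjk : j ≠ k) :
    BrauerTriple (eta g) ((N : ℂ) / 2) (pair hij (permOp N)) (pair hik (permOp N))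
      (pair hjk (permOp N)) (pair hij (brau g N)) (pair hik (brau g N)) (pair hjk (brau g N)) := by
  have sq : ∀ {a b : ι} (hab : a ≠ b), pair hab (permOp N) * pair hab (permOp N) = 1 := fun hab => by
    rw [← map_mul, permOp_mul_permOp, map_one]
  have smulp : ∀ {a b : ι} (hab : a ≠ b) (r : ℂ), pair hab (r • brau g N) = r • pair hab (brau g N) :=
    fun hab r => by
      ext I J
      simp only [pair_apply, Matrix.smul_apply]
      split_ifs <;> simp
  have hPQ : ∀ {a b : ι} (hab : a ≠ b), pair hab (permOp N) * pair hab (brau g N) =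
      eta g • pair hab (brau g N) := fun hab => by
    rw [← map_mul, permOp_mul_brau g hsp, smulp]
  have hQP : ∀ {a b : ι} (hab : a ≠ b), pair hab (brau g N) * pair hab (permOp N) =
      eta g • pair hab (brau g N) := fun hab => by
    rw [← map_mul, brau_mul_permOp g hsp, smulp]
  have hQQ : ∀ {a b : ι} (hab : a ≠ b), pair hab (brau g N) * pair hab (brau g N) =
      (2 * ((N : ℂ) / 2)) • pair hab (brau g N) := fun hab => by
    rw [← map_mul, brau_mul_brau, smulp, mul_div_cancel₀ _ two_ne_zero]
  have c1 := pair_permOp_mul_pair_left (N := N) hij hik hjk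
  have c2 := pair_permOp_mul_pair_left (N := N) hij.symm hjk hik
  have c3 := pair_permOp_mul_pair_left (N := N) hik hij hjk.symm
  have c4 := pair_permOp_mul_pair_left (N := N) hik.symm hjk.symm hij
  have c5 := pair_permOp_mul_pair_left (N := N) hjk hij.symm hik.symm
  have c6 := pair_permOp_mul_pair_left (N := N) hjk.symm hik.symm hij.symm
  have p2 := c2 (permOp N)
  have p4 := c4 (permOp N)
  have p5 := c5 (permOp N)
  have p6 := c6 (permOp N)
  have b2 := c2 (brau g N)
  have b3 := c3 (brau g N)
  have b4 := c4 (brau g N)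
  have b5 := c5 (brau g N)
  have b6 := c6 (brau g N)
  have t1 := pair_brau_mul_pair_brau (N := N) g hij hik hjk
  have t2 := pair_brau_mul_pair_brau (N := N) g hik hij hjk.symm
  have t3 := pair_brau_mul_pair_brau (N := N) g hij.symm hjk hik
  have t4 := pair_brau_mul_pair_brau (N := N) g hjk hij.symm hik.symm
  have t5 := pair_brau_mul_pair_brau (N := N) g hik.symm hjk.symm hij
  have t6 := pair_brau_mul_pair_brau (N := N) g hjk.symm hik.symm hij.symm
  simp only [pair_permOp_comm hij.symm, pair_permOp_comm hik.symm, pair_permOp_comm hjk.symm,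
    pair_brau_comm g hsp hij.symm, pair_brau_comm g hsp hik.symm, pair_brau_comm g hsp hjk.symm]
    at c1 b2 b3 b4 b5 b6 p2 p4 p5 p6 t1 t2 t3 t4 t5 t6
  refine ⟨sq hij, sq hik, sq hjk, p4.symm, p5.trans p4, p6.trans p2, p2,
    hPQ hij, hQP hij, hPQ hik, hQP hik, hPQ hjk, hQP hjk, hQQ hij, hQQ hik, hQQ hjk, t1.symm, ?_,
    t2.symm, ?_, t3.symm, ?_, t4.symm, ?_, t5.symm, ?_, t6.symm, ?_⟩
  · rw [t1, ← b6]
  · rw [t2, ← b5]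
  · rw [t3, ← b4]
  · rw [t4, ← b3]
  · rw [t5, ← b2]
  · rw [t6, ← c1]

end BrauerMatrices

/-! ### The fusion idempotents -/

section Fusion

theorem adj_ne {n : ℕ} {a b : Fin n} (hab : a.val + 1 = b.val) : a ≠ b := by
  rintro rfl
  omega

/-- The one-dimensional character of the symmetric group with value `η` at transpositions. -/
def chi (g : LieType) (n : ℕ) : Equiv.Perm (Fin n) →* ℂ :=
  match g with
  | .o => 1
  | _ => ((Int.castRingHom ℂ : ℤ →* ℂ).comp (Units.coeHom ℤ)).comp Equiv.Perm.sign

theorem chi_swap (g : LieType) {n : ℕ} {a b : Fin n} (hab : a ≠ b) :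
    chi g n (Equiv.swap a b) = eta g := by
  cases g <;> simp [chi, eta, Equiv.Perm.sign_swap hab]

theorem chi_gl (n : ℕ) (σ : Equiv.Perm (Fin n)) :
    chi .gl n σ = ((Equiv.Perm.sign σ : ℤ) : ℂ) := rfl

theorem exists_perm_pair {α : Type*} [DecidableEq α] {i j a b : α} (hij : i ≠ j) (hab : a ≠ b) :
    ∃ σ : Equiv.Perm α, σ i = a ∧ σ j = b := by
  refine ⟨Equiv.swap (Equiv.swap i a j) b * Equiv.swap i a, ?_, ?_⟩
  · rw [Equiv.Perm.mul_apply, Equiv.swap_apply_left, Equiv.swap_apply_of_ne_of_ne _ hab]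
    intro h
    have := congrArg (Equiv.swap i a) h
    rw [Equiv.swap_apply_right, Equiv.swap_apply_self] at this
    exact hij this
  · rw [Equiv.Perm.mul_apply, Equiv.swap_apply_left]

variable {N n : ℕ}

theorem pair_smul {ι F K Z : Type*} [Fintype ι] [DecidableEq ι] [Fintype F] [DecidableEq F] [Ring K]
    [CommRing Z] [Algebra Z K] {i j : ι} (hij : i ≠ j) (r : Z)
    (M : Matrix (F × F) (F × F) K) : pair hij (r • M) = r • pair hij M := by
  ext I J
  simp only [pair_apply, Matrix.smul_apply]
  split_ifs <;> simp

theorem fuseIdem_gl (N : ℕ) : fuseIdem .gl N = (1 / 2 : ℂ) • (1 - permOp N) := by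
  have : eta .gl = -1 := rfl
  rw [fuseIdem, brau_gl, smul_zero, sub_zero, this, neg_one_smul, sub_eq_add_neg]

section RightModule

variable {R : Type*} [Ring R] (φ : Matrix (Fin n → Fin N) (Fin n → Fin N) ℂ →+* R)
  {g : LieType} {z : R}

theorem mul_map_smul_of_mul_map {M : Matrix (Fin n → Fin N) (Fin n → Fin N) ℂ} {c : ℂ}
    (h : z * φ M = z * φ (c • 1)) (A : Matrix (Fin n → Fin N) (Fin n → Fin N) ℂ) :
    z * φ (M * A) = z * φ (c • A) := by
  rw [map_mul, ← mul_assoc, h, mul_assoc, ← map_mul, smul_mul_assoc, one_mul]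

theorem mul_map_smul_left {M : Matrix (Fin n → Fin N) (Fin n → Fin N) ℂ}
    {M' : Matrix (Fin n → Fin N) (Fin n → Fin N) ℂ}
    (h : z * φ M = z * φ M') (c : ℂ) : z * φ (c • M) = z * φ (c • M') := by
  have e : ∀ A : Matrix (Fin n → Fin N) (Fin n → Fin N) ℂ, c • A = A * (c • 1) := fun A => by simp
  rw [e M, e M', map_mul, map_mul, ← mul_assoc, ← mul_assoc, h]

variable (hsp : g = .sp → Even N) (hN : N ≠ 0)
  (hz : ∀ (a b : Fin n) (hab : a.val + 1 = b.val), z * φ (pair (adj_ne hab) (fuseIdem g N)) = z)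
include hsp hN hz

/-- If `z` is fixed by the idempotents of adjacent legs on the right, transpositions act by `η`. -/
theorem mul_map_permOp {a b : Fin n} (hab : a.val + 1 = b.val) :
    z * φ (pair (adj_ne hab) (permOp N)) = z * φ (eta g • 1) := by
  conv_lhs => rw [← hz a b hab]
  rw [mul_assoc, ← map_mul, ← map_mul, fuseIdem_mul_permOp g hsp, pair_smul]
  have e : eta g • pair (adj_ne hab) (fuseIdem g N) =
      pair (adj_ne hab) (fuseIdem g N) * (eta g • 1) := by simp
  rw [e, map_mul, ← mul_assoc, hz a b hab]

theorem mul_map_permMat (σ : Equiv.Perm (Fin n)) :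
    z * φ (permMat (Fin N) ℂ σ) = z * φ (chi g n σ • 1) := by
  obtain _ | n := n
  · rw [Subsingleton.elim σ 1, permMat_one, map_one, map_one, one_smul, map_one]
  have hσ : σ ∈ Submonoid.closure (Set.range fun i : Fin n => Equiv.swap i.castSucc i.succ) := by
    rw [Equiv.Perm.mclosure_swap_castSucc_succ]; trivial
  induction hσ using Submonoid.closure_induction with
  | mem σ h =>
    obtain ⟨i, rfl⟩ := h
    have hi : i.castSucc.val + 1 = i.succ.val := by simp
    have := mul_map_permOp φ hsp hN hz hi
    rwa [pair_permOp, ← chi_swap g (adj_ne hi)] at this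
  | one => rw [permMat_one, map_one, map_one, one_smul, map_one]
  | mul σ τ _ _ h1 h2 =>
    rw [permMat_mul, mul_map_smul_of_mul_map φ h1, mul_map_smul_left φ h2, smul_smul, map_mul]

/-- If `z` is fixed by the idempotents of adjacent legs on the right, all `Q_{ab}` annihilate it: the
ones for adjacent legs do, and permutations reach all pairs of legs. -/
theorem mul_map_pair_brau {a b : Fin n} (hab : a ≠ b) :
    z * φ (pair hab (brau g N)) = 0 := by
  obtain ⟨i, j, hij⟩ : ∃ i j : Fin n, i.val + 1 = j.val := by
    have h1 := a.2
    have h2 := b.2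
    have h3 : a.val ≠ b.val := fun h => hab (Fin.ext h)
    exact ⟨⟨0, by omega⟩, ⟨1, by omega⟩, rfl⟩
  have h0 : z * φ (pair (adj_ne hij) (brau g N)) = 0 := by
    conv_lhs => rw [← hz i j hij]
    rw [mul_assoc, ← map_mul, ← map_mul, fuseIdem_mul_brau g hN hsp, map_zero, map_zero, mul_zero]
  obtain ⟨σ, rfl, rfl⟩ := exists_perm_pair (adj_ne hij) hab
  have e : pair (σ.injective.ne (adj_ne hij)) (brau g N) =
      permMat (Fin N) ℂ σ * (pair (adj_ne hij) (brau g N) * permMat (Fin N) ℂ σ⁻¹) := by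
    rw [← mul_assoc, permMat_mul_pair, mul_assoc, ← permMat_mul, mul_inv_cancel, permMat_one, mul_one]
  rw [e, mul_map_smul_of_mul_map φ (mul_map_permMat φ hsp hN hz σ)]
  have e2 : ∀ A : Matrix (Fin n → Fin N) (Fin n → Fin N) ℂ, chi g n σ • A = A * (chi g n σ • 1) :=
    fun A => by simp
  rw [e2, mul_assoc, map_mul, ← mul_assoc, h0, zero_mul]

/-- The matrix with one nonzero column. -/
def colMat (x : (Fin n → Fin N) → ℂ) (J : Fin n → Fin N) :
    Matrix (Fin n → Fin N) (Fin n → Fin N) ℂ :=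
  fun I L => if L = J then x I else 0

end RightModule

theorem isHermitian_pair_permOp {ι : Type*} [Fintype ι] [DecidableEq ι] {a b : ι} (hab : a ≠ b) :
    (pair hab (permOp N)).IsHermitian := by
  ext I J
  rw [Matrix.conjTranspose_apply, pair_permOp, permMat, permMat, Equiv.swap_inv]
  have : J = I ∘ Equiv.swap a b ↔ I = J ∘ Equiv.swap a b := by
    constructor <;> rintro rfl <;> funext c <;> simp
  simp only [this]
  split_ifs <;> simp

theorem star_sgn (g : LieType) (i : Fin N) : star (sgn g N i) = sgn g N i := by
  cases g <;> simp only [sgn, star_one]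
  split_ifs <;> simp

theorem isHermitian_pair_brau {ι : Type*} [Fintype ι] [DecidableEq ι] {g : LieType} (hg : g ≠ .gl)
    {a b : ι} (hab : a ≠ b) :
    (pair hab (brau g N)).IsHermitian := by
  ext I J
  rw [Matrix.conjTranspose_apply, pair_brau_apply hg, pair_brau_apply hg]
  rw [apply_ite star, star_zero, star_mul', star_sgn, star_sgn, mul_comm]
  refine if_congr ?_ rfl rfl
  constructor <;> rintro ⟨h1, h2, h3⟩ <;> exact ⟨fun c hc hc' => (h1 c hc hc').symm, h3, h2⟩

theorem onLegs_eq_pair {a b : Fin n} (hab : a ≠ b) (M : Matrix (Fin N × Fin N) (Fin N × Fin N) ℂ) :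
    onLegs a b M = pair hab M := by
  ext I J
  rw [pair_apply, onLegs]
  congr

open Matrix in
theorem mem_brauerInvariants {g : LieType} (hg : g ≠ .gl)
    (x : EuclideanSpace ℂ (Fin n → Fin N)) : x ∈ brauerInvariants g N n ↔
      ∀ (a b : Fin n) (hab : a < b),
        toEuclideanLin (eta g • pair hab.ne (permOp N) - 1) x = 0 ∧
          toEuclideanLin (eta g • pair hab.ne (brau g N)) x = 0 := by
  have : brauerInvariants g N n = ⨅ (a : Fin n) (b : Fin n) (_ : a < b),
    LinearMap.ker (Matrix.toEuclideanLin (eta g • onLegs a b (permOp N) - 1)) ⊓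
      LinearMap.ker (Matrix.toEuclideanLin (eta g • onLegs a b (brauerOp g N))) := by
    cases g with
    | gl => exact absurd rfl hg
    | o => rfl
    | sp => rfl
  rw [this]
  simp only [Submodule.mem_iInf, Submodule.mem_inf, LinearMap.mem_ker, brau_osp hg]
  refine forall_congr' fun a => forall_congr' fun b => forall_congr' fun hab => ?_
  rw [onLegs_eq_pair hab.ne, onLegs_eq_pair hab.ne]

open Matrix in
theorem fusionOp_osp {g : LieType} (hg : g ≠ .gl) (x : EuclideanSpace ℂ (Fin n → Fin N)) :
    toEuclideanLin (fusionOp g N n) x = (brauerInvariants g N n).starProjection x := by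
  have : ∀ I J, fusionOp g N n I J =
      (brauerInvariants g N n).starProjection (EuclideanSpace.single J (1 : ℂ)) I := by
    cases g with
    | gl => exact absurd rfl hg
    | o => exact fun I J => rfl
    | sp => exact fun I J => rfl
  have hx : x = ∑ J, x J • EuclideanSpace.single J (1 : ℂ) := by
    ext I
    simp [Pi.single_apply]
  ext I
  conv_rhs => rw [hx, map_sum]
  simp [Matrix.toLpLin_apply, Matrix.mulVec, dotProduct, this, mul_comm]

open Matrix in
/-- The idempotent `E` annihilates the images of Hermitian matrices which vanish on its image. -/
theorem fusionOp_mul_eq_zero {g : LieType} (hg : g ≠ .gl)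
    {M : Matrix (Fin n → Fin N) (Fin n → Fin N) ℂ} (hM : M.IsHermitian)
    (h : ∀ x ∈ brauerInvariants g N n, toEuclideanLin M x = 0) : fusionOp g N n * M = 0 := by
  apply toEuclideanLin.injective
  ext1 x
  have e : toEuclideanLin (fusionOp g N n * M) x =
      toEuclideanLin (fusionOp g N n) (toEuclideanLin M x) := by
    simp [Matrix.toLpLin_apply]
  rw [e, fusionOp_osp hg, map_zero, LinearMap.zero_apply,
    Submodule.starProjection_apply_eq_zero_iff, Submodule.mem_orthogonal]
  intro y hy
  rw [← (isSymmetric_toEuclideanLin_iff.2 hM) y x, h y hy, inner_zero_left]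

theorem fusionOp_gl (N n : ℕ) : fusionOp .gl N n =
    ∑ p : Equiv.Perm (Fin n), ((n.factorial : ℂ)⁻¹ * chi .gl n p) • permMat (Fin N) ℂ p := by
  ext I J
  rw [Matrix.sum_apply]
  change (n.factorial : ℂ)⁻¹ * ∑ p : Equiv.Perm (Fin n), _ = _
  rw [Finset.mul_sum]
  refine Finset.sum_congr rfl fun p _ => ?_
  rw [Matrix.smul_apply, permMat, smul_eq_mul, mul_assoc, chi_gl]
  congr 1
  split_ifs
  · rw [mul_one]
  · rw [mul_zero]

theorem fusionOp_mul_pair_permOp (g : LieType) {a b : Fin n} (hab : a < b) :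
    fusionOp g N n * pair hab.ne (permOp N) = eta g • fusionOp g N n := by
  by_cases hg : g = .gl
  · subst hg
    rw [pair_permOp, fusionOp_gl]
    simp only [Finset.sum_mul, Finset.smul_sum]
    refine Fintype.sum_equiv (Equiv.mulRight (Equiv.swap a b)) _ _ fun p => ?_
    rw [Equiv.coe_mulRight, smul_mul_assoc, ← permMat_mul, map_mul, chi_swap .gl hab.ne, smul_smul]
    congr 1
    linear_combination (-(n.factorial : ℂ)⁻¹ * chi .gl n p) * eta_mul_self .gl
  · have := fusionOp_mul_eq_zero hg (M := eta g • pair hab.ne (permOp N) - 1) ?_ fun x hx =>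
      ((mem_brauerInvariants hg x).1 hx a b hab).1
    · rw [mul_sub, mul_one, mul_smul_comm, sub_eq_zero] at this
      conv_rhs => rw [← this, smul_smul, eta_mul_self, one_smul]
    · refine Matrix.IsHermitian.sub ?_ Matrix.isHermitian_one
      refine (isHermitian_pair_permOp hab.ne).smul ?_
      cases g <;> simp [eta, IsSelfAdjoint]

theorem fusionOp_mul_pair_brau (g : LieType) {a b : Fin n} (hab : a < b) :
    fusionOp g N n * pair hab.ne (brau g N) = 0 := by
  by_cases hg : g = .gl
  · subst hg
    rw [brau_gl, map_zero, mul_zero]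
  · have := fusionOp_mul_eq_zero hg (M := eta g • pair hab.ne (brau g N)) ?_ fun x hx =>
      ((mem_brauerInvariants hg x).1 hx a b hab).2
    · rw [mul_smul_comm] at this
      rw [← one_smul ℂ (_ * _), ← eta_mul_self g, ← smul_smul, this, smul_zero]
    · refine (isHermitian_pair_brau hg hab.ne).smul ?_
      cases g <;> simp [eta, IsSelfAdjoint]

/-- The defining property of the fusion idempotent on the right. -/
theorem fusionOp_mul_fuseIdem (g : LieType) {a b : Fin n} (hab : a < b) :
    fusionOp g N n * pair hab.ne (fuseIdem g N) = fusionOp g N n := by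
  rw [fuseIdem, map_sub, pair_smul, pair_smul, map_add, pair_smul, map_one, mul_sub, mul_smul_comm,
    mul_smul_comm, fusionOp_mul_pair_brau g hab, mul_add, mul_smul_comm,
    fusionOp_mul_pair_permOp g hab, smul_smul, eta_mul_self, mul_one]
  module

theorem colMat_sum (M : Matrix (Fin n → Fin N) (Fin n → Fin N) ℂ) :
    M = ∑ J, colMat (fun I => M I J) J := by
  ext I L
  rw [Matrix.sum_apply, Finset.sum_eq_single L]
  · simp [colMat]
  · intro J _ hJ
    simp [colMat, hJ.symm]
  · intro h
    exact absurd (Finset.mem_univ _) h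

theorem mul_colMat (M : Matrix (Fin n → Fin N) (Fin n → Fin N) ℂ) (x : (Fin n → Fin N) → ℂ)
    (J : Fin n → Fin N) : M * colMat x J = colMat (M.mulVec x) J := by
  ext I L
  rw [Matrix.mul_apply]
  simp only [colMat, Matrix.mulVec, dotProduct, mul_ite, mul_zero]
  split_ifs <;> simp

open Matrix in
/-- A right eigenvector for all `(1 + η P)/2 - Q/N` in adjacent legs is one for the idempotent `E`:
the vectors whose column matrices are annihilated by `z` form a subspace which contains the images
of all `η P - 1` and `Q`, hence the orthogonal complement of the image of `E`. -/
theorem mul_map_fusionOp {R : Type*} [Ring R]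
    (φ : Matrix (Fin n → Fin N) (Fin n → Fin N) ℂ →+* R) {g : LieType} {z : R}
    (hsp : g = .sp → Even N) (hN : N ≠ 0)
    (hz : ∀ (a b : Fin n) (hab : a.val + 1 = b.val), z * φ (pair (adj_ne hab) (fuseIdem g N)) = z) :
    z * φ (fusionOp g N n) = z := by
  by_cases hg : g = .gl
  · subst hg
    have hf : (n.factorial : ℂ) ≠ 0 := by exact_mod_cast n.factorial_ne_zero
    have h1 : ∀ p : Equiv.Perm (Fin n), z * φ (((n.factorial : ℂ)⁻¹ * chi .gl n p) •
        permMat (Fin N) ℂ p) = z * φ ((n.factorial : ℂ)⁻¹ • 1) := fun p => by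
      rw [mul_map_smul_left φ (mul_map_permMat φ hsp hN hz p), smul_smul, mul_assoc, chi_gl,
        ← Int.cast_mul, Int.units_coe_mul_self, Int.cast_one, mul_one]
    rw [fusionOp_gl, map_sum, Finset.mul_sum, Finset.sum_congr rfl fun p _ => h1 p,
      ← Finset.mul_sum, ← map_sum, Finset.sum_const, Finset.card_univ, Fintype.card_perm,
      Fintype.card_fin, ← Nat.cast_smul_eq_nsmul ℂ, smul_smul, mul_inv_cancel₀ hf, one_smul, map_one,
      mul_one]
  · let W : Submodule ℂ (EuclideanSpace ℂ (Fin n → Fin N)) :=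
      { carrier := {x | ∀ J, z * φ (colMat (WithLp.ofLp x) J) = 0}
        add_mem' := by
          intro x y hx hy J
          have e : colMat (WithLp.ofLp (x + y)) J =
              colMat (WithLp.ofLp x) J + colMat (WithLp.ofLp y) J := by
            ext I L
            simp only [colMat, Matrix.add_apply]
            split_ifs <;> simp
          rw [e, map_add, mul_add, hx J, hy J, add_zero]
        zero_mem' := by
          intro J
          have e : colMat (WithLp.ofLp (0 : EuclideanSpace ℂ (Fin n → Fin N))) J = 0 := by
            ext I L
            simp [colMat]
          rw [e, map_zero, mul_zero]
        smul_mem' := by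
          intro c x hx J
          have e : colMat (WithLp.ofLp (c • x)) J = c • colMat (WithLp.ofLp x) J := by
            ext I L
            simp [colMat]
          have h0 : z * φ (colMat (WithLp.ofLp x) J) = z * φ 0 := by rw [hx J, map_zero, mul_zero]
          rw [e, mul_map_smul_left φ h0 c, smul_zero, map_zero, mul_zero] }
    have hW : ∀ M : Matrix (Fin n → Fin N) (Fin n → Fin N) ℂ, z * φ M = 0 → ∀ x,
        toEuclideanLin M x ∈ W := by
      intro M hM x J
      have e : colMat (WithLp.ofLp (toEuclideanLin M x)) J = M * colMat (WithLp.ofLp x) J := by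
        rw [mul_colMat]; rfl
      rw [e, map_mul, ← mul_assoc, hM, zero_mul]
    have hort : Wᗮ ≤ brauerInvariants g N n := by
      intro y hy
      have key : ∀ M : Matrix (Fin n → Fin N) (Fin n → Fin N) ℂ, M.IsHermitian → z * φ M = 0 →
          toEuclideanLin M y = 0 := fun M hM h0 => by
        refine ext_inner_left ℂ fun x => ?_
        rw [← (isSymmetric_toEuclideanLin_iff.2 hM) x y, inner_zero_right]
        exact hy _ (hW M h0 x)
      refine (mem_brauerInvariants hg y).2 fun a b hab => ⟨key _ ?_ ?_, key _ ?_ ?_⟩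
      · refine Matrix.IsHermitian.sub ?_ Matrix.isHermitian_one
        refine (isHermitian_pair_permOp hab.ne).smul ?_
        cases g <;> simp [eta, IsSelfAdjoint]
      · rw [pair_permOp, map_sub, mul_sub, mul_map_smul_left φ (mul_map_permMat φ hsp hN hz _),
          chi_swap g hab.ne, smul_smul, eta_mul_self, one_smul, sub_self]
      · refine (isHermitian_pair_brau hg hab.ne).smul ?_
        cases g <;> simp [eta, IsSelfAdjoint]
      · have h0 : z * φ (pair hab.ne (brau g N)) = z * φ 0 := by
          rw [mul_map_pair_brau φ hsp hN hz hab.ne, map_zero, mul_zero]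
        rw [mul_map_smul_left φ h0, smul_zero, map_zero, mul_zero]
    have hle : (brauerInvariants g N n)ᗮ ≤ W := by
      have := Submodule.orthogonal_le hort
      rwa [Submodule.orthogonal_orthogonal] at this
    have h1 : z * φ (1 - fusionOp g N n) = 0 := by
      rw [colMat_sum (1 - fusionOp g N n), map_sum, Finset.mul_sum]
      refine Finset.sum_eq_zero fun J _ => ?_
      have hmem : EuclideanSpace.single J (1 : ℂ) - (brauerInvariants g N n).starProjection
          (EuclideanSpace.single J (1 : ℂ)) ∈ W :=
        hle (Submodule.sub_starProjection_mem_orthogonal _)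
      have := hmem J
      convert this using 4
      ext I
      rw [← fusionOp_osp hg]
      simp [Matrix.toLpLin_apply, Matrix.one_apply]
    rw [map_sub, mul_sub, map_one, mul_one, sub_eq_zero] at h1
    exact h1.symm

end Fusion

/-! ### Ordered products and traces -/

section OrderedProducts

variable {M α β : Type*} [Monoid M]

theorem commute_list_prod {x : M} {l : List M} (h : ∀ y ∈ l, Commute x y) : Commute x l.prod :=
  Commute.list_prod_right l x h

theorem list_prod_mul_list_prod (f g : α → M) (l : List α) (hl : l.Nodup)
    (h : ∀ a ∈ l, ∀ b ∈ l, a ≠ b → Commute (f a) (g b)) :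
    (l.map f).prod * (l.map g).prod = (l.map fun a => f a * g a).prod := by
  induction l with
  | nil => simp
  | cons a l ih =>
    obtain ⟨ha, hl⟩ := List.nodup_cons.1 hl
    have h1 : Commute (g a) (l.map f).prod := commute_list_prod fun y hy => by
      obtain ⟨b, hb, rfl⟩ := List.mem_map.1 hy
      exact (h b (List.mem_cons_of_mem _ hb) a List.mem_cons_self (by rintro rfl; exact ha hb)).symm
    simp only [List.map_cons, List.prod_cons]
    rw [← ih hl fun b hb c hc => h b (List.mem_cons_of_mem _ hb) c (List.mem_cons_of_mem _ hc)]
    simp only [mul_assoc]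
    rw [← mul_assoc _ (g a), ← h1.eq, mul_assoc]

/-- The exchange of the order of two ordered products. -/
theorem list_prod_comm (f : α → β → M) (l : List α) (l' : List β) (hl : l.Nodup) (hl' : l'.Nodup)
    (h : ∀ a b a' b', a ≠ a' → b ≠ b' → Commute (f a b) (f a' b')) :
    (l'.map fun b => (l.map fun a => f a b).prod).prod =
      (l.map fun a => (l'.map fun b => f a b).prod).prod := by
  induction l' with
  | nil => simp
  | cons b l' ih =>
    obtain ⟨hb, hl'⟩ := List.nodup_cons.1 hl'
    simp only [List.map_cons, List.prod_cons]
    rw [ih hl', list_prod_mul_list_prod _ _ l hl]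
    intro a _ a' _ haa'
    refine commute_list_prod fun y hy => ?_
    obtain ⟨b', hb', rfl⟩ := List.mem_map.1 hy
    exact h a b a' b' haa' (by rintro rfl; exact hb hb')

/-- The reordering of two ordered products from the reordering of their factors. -/
theorem intertwine_prod (f : α → β → M) (x : α → M) (y : β → M)
    (h : ∀ a b, f a b * x a * y b = y b * x a * f a b)
    (hx : ∀ a b a', a ≠ a' → Commute (f a b) (x a'))
    (hy : ∀ a b b', b ≠ b' → Commute (f a b) (y b')) (l : List α) (hl : l.Nodup) (l' : List β)
    (hl' : l'.Nodup) :
    (l'.reverse.map fun b => (l.map fun a => f a b).prod).prod * (l.map x).prod * (l'.map y).prod =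
      (l'.map y).prod * (l.map x).prod *
        (l'.reverse.map fun b => (l.map fun a => f a b).prod).prod := by
  have h1 : ∀ b, (l.map fun a => f a b).prod * (l.map x).prod * y b =
      y b * (l.map x).prod * (l.map fun a => f a b).prod := by
    intro b
    induction l with
    | nil => simp
    | cons a l ih =>
      obtain ⟨ha, hl⟩ := List.nodup_cons.1 hl
      simp only [List.map_cons, List.prod_cons]
      have c1 : Commute (x a) (l.map fun a => f a b).prod := commute_list_prod fun z hz => by
        obtain ⟨c, hc, rfl⟩ := List.mem_map.1 hz
        exact (hx c b a (by rintro rfl; exact ha hc)).symm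
      have c2 : Commute (f a b) (l.map x).prod := commute_list_prod fun z hz => by
        obtain ⟨c, hc, rfl⟩ := List.mem_map.1 hz
        exact hx a b c (by rintro rfl; exact ha hc)
      calc _ = f a b * ((l.map fun a => f a b).prod * x a) * (l.map x).prod * y b := by
              simp only [mul_assoc]
        _ = f a b * x a * ((l.map fun a => f a b).prod * (l.map x).prod * y b) := by
              rw [← c1.eq]; simp only [mul_assoc]
        _ = f a b * x a * y b * (l.map x).prod * (l.map fun a => f a b).prod := by
              rw [ih hl]; simp only [mul_assoc]
        _ = y b * x a * (f a b * (l.map x).prod) * (l.map fun a => f a b).prod := by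
              rw [h]; simp only [mul_assoc]
        _ = _ := by rw [c2.eq]; simp only [mul_assoc]
  induction l' with
  | nil => simp
  | cons b l' ih =>
    obtain ⟨hb, hl'⟩ := List.nodup_cons.1 hl'
    simp only [List.reverse_cons, List.map_append, List.prod_append, List.map_cons, List.prod_cons,
      List.map_nil, List.prod_nil, mul_one]
    have c1 : Commute (y b) (l'.reverse.map fun b => (l.map fun a => f a b).prod).prod :=
      commute_list_prod fun z hz => by
        obtain ⟨c, hc, rfl⟩ := List.mem_map.1 hz
        refine commute_list_prod fun z hz => ?_
        obtain ⟨a, ha, rfl⟩ := List.mem_map.1 hz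
        exact (hy a c b (by rintro rfl; exact hb (List.mem_reverse.1 hc))).symm
    have c2 : Commute (l'.map y).prod (l.map fun a => f a b).prod :=
      commute_list_prod fun z hz => by
        obtain ⟨a, ha, rfl⟩ := List.mem_map.1 hz
        refine (commute_list_prod fun z hz => ?_).symm
        obtain ⟨c, hc, rfl⟩ := List.mem_map.1 hz
        exact hy a b c (by rintro rfl; exact hb hc)
    have ih := ih hl'
    have hb1 := h1 b
    generalize (l'.reverse.map fun b => (l.map fun a => f a b).prod).prod = R at *
    generalize (l.map fun a => f a b).prod = G at *
    generalize (l.map x).prod = X at *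
    generalize (l'.map y).prod = Y at *
    calc _ = R * (G * X * y b) * Y := by simp only [mul_assoc]
      _ = R * y b * X * (G * Y) := by rw [hb1]; simp only [mul_assoc]
      _ = y b * (R * X * Y) * G := by rw [← c1.eq, ← c2.eq]; simp only [mul_assoc]
      _ = _ := by rw [ih]; simp only [mul_assoc]

end OrderedProducts

section RingProducts

variable {R Z α β : Type*} [Ring R] [CommRing Z] [Algebra Z R]

theorem list_prod_mul_reverse (f k : α → R) (c : α → Z) (h : ∀ a, f a * k a = c a • 1) (l : List α) :
    (l.map f).prod * (l.reverse.map k).prod = (l.map c).prod • 1 := by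
  induction l with
  | nil => simp
  | cons a l ih =>
    simp only [List.reverse_cons, List.map_append, List.prod_append, List.map_cons, List.prod_cons,
      List.map_nil, List.prod_nil, mul_one]
    calc _ = f a * ((l.map f).prod * (l.reverse.map k).prod) * k a := by simp only [mul_assoc]
      _ = _ := by rw [ih, mul_smul_comm, smul_mul_assoc, mul_one, h, smul_smul, mul_comm]

/-- An ordered product following `E` absorbs an idempotent which exchanges two adjacent factors and
commutes with the others. -/
theorem absorb_adjacent {E e x y : R} {pre post : List R} (hE : E * e = E) (he : e * e = e)
    (hxy : e * x * y = y * x * e) (hpre : ∀ u ∈ pre, Commute e u) (hpost : ∀ u ∈ post, Commute e u) :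
    E * (pre ++ x :: y :: post).prod * e = E * (pre ++ x :: y :: post).prod := by
  have c1 := commute_list_prod hpre
  have c2 := commute_list_prod hpost
  simp only [List.prod_append, List.prod_cons]
  have key : E * (pre.prod * (x * (y * post.prod))) = E * pre.prod * y * x * post.prod * e := by
    calc _ = E * e * pre.prod * x * y * post.prod := by rw [hE]; simp only [mul_assoc]
      _ = E * pre.prod * (e * x * y) * post.prod := by
        rw [mul_assoc E, c1.eq]; simp only [mul_assoc]
      _ = _ := by rw [hxy]; simp only [mul_assoc]; rw [c2.eq]
  rw [key, mul_assoc _ e, he]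

theorem finRange_split {n : ℕ} {a b : Fin n} (hab : a.val + 1 = b.val) :
    ∃ pre post, List.finRange n = pre ++ a :: b :: post := by
  refine ⟨(List.finRange n).take a, (List.finRange n).drop (a + 2), ?_⟩
  conv_lhs => rw [← List.take_append_drop a.val (List.finRange n)]
  congr 1
  rw [List.drop_eq_getElem_cons (by simp), List.drop_eq_getElem_cons (by simp [hab])]
  have := b.2
  simp [hab]
  omega

/-- A fused product: `E M_1 ⋯ M_n` absorbs the idempotent of two adjacent factors. -/
theorem absorb_prod {n : ℕ} {E e : R} {M : Fin n → R} {a b : Fin n} (hab : a.val + 1 = b.val)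
    (hE : E * e = E) (he : e * e = e) (hxy : e * M a * M b = M b * M a * e)
    (hc : ∀ c, c ≠ a → c ≠ b → Commute e (M c)) :
    E * ((List.finRange n).map M).prod * e = E * ((List.finRange n).map M).prod := by
  obtain ⟨pre, post, hl⟩ := finRange_split hab
  have hd := List.nodup_finRange n
  rw [hl] at hd ⊢
  simp only [List.map_append, List.map_cons]
  simp only [List.nodup_append, List.nodup_cons, List.mem_cons, not_or] at hd
  refine absorb_adjacent hE he hxy ?_ ?_
  · intro u hu
    obtain ⟨c, hc', rfl⟩ := List.mem_map.1 hu
    exact hc c (hd.2.2 c hc' a (Or.inl rfl)) (hd.2.2 c hc' b (Or.inr (Or.inl rfl)))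
  · intro u hu
    obtain ⟨c, hc', rfl⟩ := List.mem_map.1 hu
    exact hc c (by rintro rfl; exact hd.2.1.1.2 hc') (by rintro rfl; exact hd.2.1.2.1 hc')

theorem absorb_prod_reverse {n : ℕ} {E e : R} {M : Fin n → R} {a b : Fin n}
    (hab : a.val + 1 = b.val)
    (hE : E * e = E) (he : e * e = e) (hxy : e * M b * M a = M a * M b * e)
    (hc : ∀ c, c ≠ a → c ≠ b → Commute e (M c)) :
    E * ((List.finRange n).reverse.map M).prod * e = E * ((List.finRange n).reverse.map M).prod := by
  obtain ⟨pre, post, hl⟩ := finRange_split hab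
  have hd := List.nodup_finRange n
  rw [hl] at hd ⊢
  simp only [List.reverse_append, List.reverse_cons, List.append_assoc, List.map_append,
    List.map_cons, List.singleton_append, List.map_nil]
  simp only [List.nodup_append, List.nodup_cons, List.mem_cons, not_or] at hd
  refine absorb_adjacent hE he hxy ?_ ?_
  · intro u hu
    obtain ⟨c, hc', rfl⟩ := List.mem_map.1 hu
    rw [List.mem_reverse] at hc'
    exact hc c (by rintro rfl; exact hd.2.1.1.2 hc') (by rintro rfl; exact hd.2.1.2.1 hc')
  · intro u hu
    obtain ⟨c, hc', rfl⟩ := List.mem_map.1 hu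
    rw [List.mem_reverse] at hc'
    exact hc c (hd.2.2 c hc' a (Or.inl rfl)) (hd.2.2 c hc' b (Or.inr (Or.inl rfl)))

/-- A product absorbs the idempotent `E` if every factor does. -/
theorem absorb_list {E : R} {l : List R} (h : ∀ x ∈ l, E * x * E = E * x) (hE : E * E = E) :
    E * l.prod * E = E * l.prod := by
  induction l with
  | nil => simpa using hE
  | cons x l ih =>
    rw [List.prod_cons]
    have h1 := h x List.mem_cons_self
    have h2 := ih fun y hy => h y (List.mem_cons_of_mem _ hy)
    calc _ = (E * x * E) * l.prod * E := by rw [h1]; simp only [mul_assoc]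
      _ = E * x * (E * l.prod * E) := by simp only [mul_assoc]
      _ = (E * x * E) * l.prod := by rw [h2]; simp only [mul_assoc]
      _ = _ := by rw [h1]; simp only [mul_assoc]

end RingProducts

section CentralTrace

variable {A K : Type*} [Fintype A] [DecidableEq A] [Ring K]

/-- Matrices with central entries can be permuted cyclically under the trace. -/
theorem trace_mul_comm_of_central {U : Matrix A A K} (hU : U ∈ (Subring.center K).matrix)
    (V : Matrix A A K) : (U * V).trace = (V * U).trace := by
  simp only [Matrix.trace, Matrix.diag_apply, Matrix.mul_apply]
  rw [Finset.sum_comm]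
  refine Finset.sum_congr rfl fun i _ => Finset.sum_congr rfl fun j _ => ?_
  exact (Subring.mem_center_iff.1 (hU j i) _).symm

/-- The trace identity behind the commutativity of transfer matrices. -/
theorem trace_eq_of_intertwine {Z : Type*} [CommRing Z] [Algebra Z K] {E R R' W W' : Matrix A A K}
    {p : Z} (hp : ∀ x : K, p • x = 0 → x = 0) (hE : E ∈ (Subring.center K).matrix)
    (hR : R ∈ (Subring.center K).matrix) (hEE : E * E = E) (hRR : R * R' = p • 1) (hRR' : R' * R = p • 1)
    (hER : E * R * E = E * R) (hER' : E * R' * E = E * R') (hEW : E * W' * E = E * W')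
    (h : R * W = W' * R) : (E * W).trace = (E * W').trace := by
  rw [← sub_eq_zero]
  apply hp
  rw [smul_sub, ← Matrix.trace_smul, ← Matrix.trace_smul, sub_eq_zero]
  have e1 : p • (E * W) = (E * R') * (E * W') * (E * R) := by
    calc _ = E * (R' * R) * W := by rw [hRR', mul_smul_comm, smul_mul_assoc, mul_one]
      _ = (E * R' * E) * (W' * R) := by rw [mul_assoc E, mul_assoc R', h, hER']; simp only [mul_assoc]
      _ = (E * R') * (E * W' * E) * R := by rw [hEW]; simp only [mul_assoc]
      _ = _ := by simp only [mul_assoc]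
  have e2 : p • (E * W') = (E * R) * ((E * R') * (E * W')) := by
    calc _ = E * (R * R') * (E * W') := by
          rw [hRR, mul_smul_comm, smul_mul_assoc, mul_one, ← mul_assoc, hEE]
      _ = (E * R * E) * R' * (E * W') := by rw [hER]; simp only [mul_assoc]
      _ = _ := by simp only [mul_assoc]
  rw [e1, e2, trace_mul_comm_of_central (mul_mem hE hR)]

end CentralTrace

/-! ### The R-matrix over an algebra -/

section Transfer

/-- The relations between the generators are preserved by homomorphisms. -/
theorem BrauerTriple.map {R Z R' Z' : Type*} [Ring R] [CommRing Z] [Algebra Z R] [Ring R']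
    [CommRing Z'] [Algebra Z' R'] (φ : R →+* R') (ψ : Z →+* Z')
    (hφ : ∀ (c : Z) (x : R), φ (c • x) = ψ c • φ x) {η m : Z} {p q r A B C : R}
    (H : BrauerTriple η m p q r A B C) :
    BrauerTriple (ψ η) (ψ m) (φ p) (φ q) (φ r) (φ A) (φ B) (φ C) := by
  have h2 : ψ (2 * m) = 2 * ψ m := by rw [map_mul, map_ofNat]
  constructor
  all_goals
    rw [← map_mul]
    first
    | rw [← map_mul] | rw [← h2, ← hφ] | rw [← hφ] | rw [← map_one φ]
    refine congrArg φ ?_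
  exacts [H.pp, H.qq, H.rr, H.pq, H.rp, H.rq, H.pr, H.pA, H.Ap, H.qB, H.Bq, H.rC, H.Cr, H.AA, H.BB,
    H.CC, H.Ar, H.rB, H.Br, H.rA, H.Aq, H.qC, H.Cq, H.qA, H.Bp, H.pC, H.Cp, H.pB]

variable {K Z : Type*} [Ring K] [Algebra Coef K] [CommRing Z] [Algebra Coef Z] [Algebra Z K]
  [IsScalarTower Coef Z K] {N : ℕ}

/-- The constants in a `ℂ[[h]]`-algebra. -/
def cZ (Z : Type*) [CommRing Z] [Algebra Coef Z] : ℂ →+* Z :=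
  (algebraMap Coef Z).comp (PowerSeries.C : ℂ →+* Coef)

theorem cZ_apply (c : ℂ) : cZ Z c = algebraMap Coef Z (cst c) := rfl

theorem cmat_smul {X : Type*} [Fintype X] [DecidableEq X] (c : ℂ) (M : Matrix X X ℂ) :
    cmat K (c • M) = cZ Z c • cmat K M := by
  ext i j
  rw [Matrix.smul_apply, cmat_apply, cmat_apply, Matrix.smul_apply, cZ_apply, algebraMap_smul,
    smul_eq_mul, cst, map_mul, map_mul, Algebra.smul_def]
  rfl

theorem cmat_mem_center {X : Type*} [Fintype X] [DecidableEq X] (M : Matrix X X ℂ) :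
    cmat K M ∈ (Subring.center K).matrix := fun i j => by
  rw [cmat_apply]
  exact Subring.mem_center_iff.2 fun x => (Algebra.commutes _ x).symm

theorem cmat_pair {ι : Type*} [Fintype ι] [DecidableEq ι] {i j : ι} (hij : i ≠ j)
    (M : Matrix (Fin N × Fin N) (Fin N × Fin N) ℂ) : cmat K (pair hij M) = pair hij (cmat K M) := by
  ext I J
  rw [cmat_apply, pair_apply, pair_apply]
  split_ifs
  · rfl
  · rw [cst, map_zero, map_zero]

theorem smul_mem_central_matrix {X : Type*} [Fintype X] [DecidableEq X] (c : Z) {M : Matrix X X K}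
    (hM : M ∈ (Subring.center K).matrix) : c • M ∈ (Subring.center K).matrix := fun i j => by
  refine Subring.mem_center_iff.2 fun x => ?_
  change x * (c • M i j) = c • M i j * x
  rw [mul_smul_comm, smul_mul_assoc, Subring.mem_center_iff.1 (hM i j)]

theorem place_mem_central_matrix {ι F X : Type*} [Fintype ι] [DecidableEq ι] [Fintype F]
    [DecidableEq F] [Fintype X] [DecidableEq X] {s : Finset ι} {r : (ι → F) → X} (hr : IsPlace s r)
    {M : Matrix X X K} (hM : M ∈ (Subring.center K).matrix) :
    place hr M ∈ (Subring.center K).matrix := fun I J => by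
  rw [place_apply]
  split_ifs
  · exact hM _ _
  · exact zero_mem _

theorem commute_of_central {X : Type*} [Fintype X] [DecidableEq X] {M : Matrix X X K}
    (hM : M ∈ (Subring.center K).matrix) (x y : X) (a : K) : Commute (M x y) a :=
  (Subring.mem_center_iff.1 (hM x y) a).symm

/-- The `R`-matrix at `x`, multiplied for `gl_N` by a linear factor such that it depends uniformly
on the type. -/
def RK (K : Type*) [Ring K] [Algebra Coef K] [Algebra Z K] (g : LieType) (N : ℕ) (x : Z) :
    Matrix (Fin N × Fin N) (Fin N × Fin N) K :=
  Rmat (algebraMap Coef Z h) (algebraMap Coef Z h * (cZ Z (N / 2) - cZ Z (eta g)))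
    (cmat K (permOp N)) (cmat K (brau g N)) x

theorem RK_mem_center (g : LieType) (x : Z) : RK K g N x ∈ (Subring.center K).matrix :=
  add_mem (sub_mem (smul_mem_central_matrix _ (one_mem _))
    (smul_mem_central_matrix _ (cmat_mem_center _))) (smul_mem_central_matrix _ (cmat_mem_center _))

theorem cZ_eta (g : LieType) : cZ Z (eta g) = 1 ∨ cZ Z (eta g) = -1 := by
  cases g <;> simp [eta]

theorem fuseIdem_eq (g : LieType) (hN : N ≠ 0) : fuseIdem g N =
    (1 / N : ℂ) • ((N / 2 : ℂ) • (1 + eta g • permOp N) - brau g N) := by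
  have hN' : (N : ℂ) ≠ 0 := by exact_mod_cast hN
  rw [fuseIdem, smul_sub, smul_smul]
  congr 2
  field_simp

/-- The unitarity of the `R`-matrix. -/
theorem RK_mul_neg (g : LieType) (hsp : g = .sp → Even N) (x : Z) :
    RK K g N x * RK K g N (-x) = ((x ^ 2 - algebraMap Coef Z h ^ 2) *
      (x ^ 2 - (algebraMap Coef Z h * (cZ Z (N / 2) - cZ Z (eta g))) ^ 2)) • 1 := by
  refine Rmat_mul_neg (cZ_eta g) ?_ ?_ ?_ ?_ _ _
  · rw [← map_mul, permOp_mul_permOp, map_one]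
  · rw [← map_mul, permOp_mul_brau g hsp, cmat_smul (Z := Z)]
  · rw [← map_mul, brau_mul_permOp g hsp, cmat_smul (Z := Z)]
  · rw [← map_mul, brau_mul_brau g, cmat_smul (Z := Z)]
    congr 1
    rw [← map_ofNat (cZ Z) 2, ← map_mul, mul_div_cancel₀ _ two_ne_zero]

section Legs

variable {ι : Type*} [Fintype ι] [DecidableEq ι]

theorem pair_RK (g : LieType) {i j : ι} (hij : i ≠ j) (x : Z) : pair hij (RK K g N x) =
    Rmat (algebraMap Coef Z h) (algebraMap Coef Z h * (cZ Z (N / 2) - cZ Z (eta g)))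
      (cmat K (pair hij (permOp N))) (cmat K (pair hij (brau g N))) x := by
  rw [RK, Rmat, map_add, map_sub, pair_smul, pair_smul, pair_smul, map_one, cmat_pair, cmat_pair, Rmat]

theorem pair_RK_comm (g : LieType) (hsp : g = .sp → Even N) {i j : ι} (hij : i ≠ j) (x : Z) :
    pair hij (RK K g N x) = pair hij.symm (RK K g N x) := by
  rw [pair_RK, pair_RK, pair_permOp_comm, pair_brau_comm g hsp]

/-- The fused Yang–Baxter equation on three tensor factors. -/
theorem fused_pair_RK (g : LieType) (hN : N ≠ 0) (hsp : g = .sp → Even N) {i j k : ι} (hij : i ≠ j)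
    (hik : i ≠ k) (hjk : j ≠ k) {x y : Z} (hxy : y = x + cZ Z (eta g) * algebraMap Coef Z h) :
    pair hij (cmat K (fuseIdem g N)) * pair hik (RK K g N x) * pair hjk (RK K g N y) =
      pair hjk (RK K g N y) * pair hik (RK K g N x) * pair hij (cmat K (fuseIdem g N)) := by
  have H := (brauerTriple_pair g hsp hij hik hjk).map (cmat K) (cZ Z) fun c M => cmat_smul c M
  have h1 := H.fused_yang_baxter (cZ_eta g) (algebraMap Coef Z h) x
  have e : pair hij (cmat K (fuseIdem g N)) = cZ Z (1 / N) • (cZ Z (N / 2) • (1 + cZ Z (eta g) •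
      cmat K (pair hij (permOp N))) - cmat K (pair hij (brau g N))) := by
    rw [fuseIdem_eq g hN, cmat_smul (Z := Z), map_sub, cmat_smul (Z := Z), map_add,
      cmat_smul (Z := Z), pair_smul, map_sub, pair_smul, map_add, pair_smul, map_one, map_one,
      cmat_pair, cmat_pair]
  rw [e, pair_RK, pair_RK, hxy, smul_mul_assoc, smul_mul_assoc, h1, mul_smul_comm]

/-- The fused Yang–Baxter equation in the reverse order. -/
theorem fused_pair_RK' (g : LieType) (hN : N ≠ 0) (hsp : g = .sp → Even N) {i j k : ι} (hij : i ≠ j)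
    (hik : i ≠ k) (hjk : j ≠ k) {x y : Z} (hxy : x = y + cZ Z (eta g) * algebraMap Coef Z h) :
    pair hij (cmat K (fuseIdem g N)) * pair hjk (RK K g N y) * pair hik (RK K g N x) =
      pair hik (RK K g N x) * pair hjk (RK K g N y) * pair hij (cmat K (fuseIdem g N)) := by
  have h1 := fused_pair_RK (K := K) g hN hsp hij.symm hjk hik hxy
  have e : pair hij.symm (cmat K (fuseIdem g N)) = pair hij (cmat K (fuseIdem g N)) := by
    rw [← cmat_pair, ← cmat_pair]
    congr 1
    rw [fuseIdem, map_sub, map_sub, pair_smul, pair_smul, pair_smul, pair_smul, map_add, map_add,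
      pair_smul, pair_smul, map_one, map_one, pair_permOp_comm, pair_brau_comm g hsp]
  rwa [e] at h1

end Legs

end Transfer

/-! ### Commutativity of fused traces -/

section AbsorbTwo

variable {R : Type*} [Ring R] {E₁ E₂ : R}

theorem absorb_mul (h12 : Commute E₁ E₂) {x : R} (h1 : E₁ * x * E₁ = E₁ * x)
    (h2 : E₂ * x * E₂ = E₂ * x) : E₁ * E₂ * x * (E₁ * E₂) = E₁ * E₂ * x := by
  calc _ = E₂ * (E₁ * x * E₁) * E₂ := by rw [h12.eq]; simp only [mul_assoc]; rw [h12.eq]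
    _ = E₁ * (E₂ * x * E₂) := by rw [h1, ← mul_assoc, ← h12.eq]; simp only [mul_assoc]
    _ = _ := by rw [h2]; simp only [mul_assoc]

theorem absorb_mul_of_commute (h12 : Commute E₁ E₂) {x y : R} (h1 : E₁ * x * E₁ = E₁ * x)
    (h2 : E₂ * y * E₂ = E₂ * y) (hx : Commute E₂ x) (hy : Commute E₁ y) :
    E₁ * E₂ * (y * x) * (E₁ * E₂) = E₁ * E₂ * (y * x) := by
  calc _ = E₂ * (E₁ * y) * x * E₁ * E₂ := by rw [h12.eq]; simp only [mul_assoc]; rw [h12.eq]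
    _ = E₂ * y * (E₁ * x * E₁) * E₂ := by rw [hy.eq]; simp only [mul_assoc]
    _ = E₂ * y * E₁ * (x * E₂) := by rw [h1]; simp only [mul_assoc]
    _ = E₂ * y * (E₁ * E₂) * x := by rw [← hx.eq]; simp only [mul_assoc]
    _ = (E₂ * y * E₂) * E₁ * x := by rw [h12.eq]; simp only [mul_assoc]
    _ = E₂ * (y * E₁) * x := by rw [h2]; simp only [mul_assoc]
    _ = _ := by rw [← hy.eq, h12.eq]; simp only [mul_assoc]

end AbsorbTwo

theorem list_prod_map_reverse {Z α : Type*} [CommMonoid Z] (c : α → Z) (l : List α) :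
    (l.reverse.map c).prod = (l.map c).prod :=
  ((List.reverse_perm l).map c).prod_eq

theorem list_prod_smul_regular {Z K α : Type*} [CommRing Z] [Ring K] [Algebra Z K] (c : α → Z)
    (h : ∀ a, ∀ x : K, c a • x = 0 → x = 0) (l : List α) (x : K) (hx : (l.map c).prod • x = 0) :
    x = 0 := by
  induction l with
  | nil => simpa using hx
  | cons a l ih =>
    rw [List.map_cons, List.prod_cons, mul_smul] at hx
    exact ih (h a _ hx)

section Transfer

variable {K Z : Type*} [Ring K] [Algebra Coef K] [CommRing Z] [Algebra Coef Z] [Algebra Z K]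
  [IsScalarTower Coef Z K] {N : ℕ}

/-- The idempotent `E_[n]` over a `ℂ[[h]]`-algebra. -/
abbrev fuseK (K : Type*) [Ring K] [Algebra Coef K] (g : LieType) (N n : ℕ) :
    Matrix (Fin n → Fin N) (Fin n → Fin N) K := cmat K (fusionOp g N n)

/-- The ordered product `L_1 ⋯ L_n` of matrices acting on different tensor factors. -/
abbrev legProd {n : ℕ} (L : Fin n → Matrix (Fin N) (Fin N) K) :
    Matrix (Fin n → Fin N) (Fin n → Fin N) K := ((List.finRange n).map fun i => leg i (L i)).prod

variable {ι : Type*} [Fintype ι] [DecidableEq ι] [Nonempty (Fin N)]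

theorem embed_cmat_fuseIdem (g : LieType) {n : ℕ} (f : Fin n ↪ ι) {a b : Fin n} (hab : a ≠ b) :
    embed f (cmat K (pair hab (fuseIdem g N))) =
      pair (f.injective.ne hab) (cmat K (fuseIdem g N)) := by
  rw [cmat_pair, embed_pair]

theorem pair_cmat_fuseIdem_idem (g : LieType) (hN : N ≠ 0) (hsp : g = .sp → Even N) {i j : ι}
    (hij : i ≠ j) : pair hij (cmat K (fuseIdem g N)) * pair hij (cmat K (fuseIdem g N)) =
      pair hij (cmat K (fuseIdem g N)) := by
  rw [← map_mul, ← map_mul, fuseIdem_mul_self g hN hsp]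

theorem embed_fuseK_mul (g : LieType) {n : ℕ} (f : Fin n ↪ ι) {a b : Fin n}
    (hab : a.val + 1 = b.val) :
    embed f (fuseK K g N n) * pair (f.injective.ne (adj_ne hab)) (cmat K (fuseIdem g N)) =
      embed f (fuseK K g N n) := by
  have hlt : a < b := by
    rw [Fin.lt_def]; omega
  rw [← embed_cmat_fuseIdem g f (adj_ne hab), ← map_mul, ← map_mul, fusionOp_mul_fuseIdem g hlt]

/-- A product absorbs the idempotent `E_[n]` acting on the tensor factors in the image of `f` if it
absorbs the elementary idempotents. -/
theorem embed_fuseK_absorb (g : LieType) (hN : N ≠ 0) (hsp : g = .sp → Even N) {n : ℕ}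
    (f : Fin n ↪ ι) {z : Matrix (ι → Fin N) (ι → Fin N) K}
    (hz : ∀ (a b : Fin n) (hab : a.val + 1 = b.val),
      z * pair (f.injective.ne (adj_ne hab)) (cmat K (fuseIdem g N)) = z) :
    z * embed f (fuseK K g N n) = z := by
  refine mul_map_fusionOp ((embed f).comp (cmat K)) hsp hN fun a b hab => ?_
  rw [RingHom.comp_apply, embed_cmat_fuseIdem]
  exact hz a b hab

theorem fuseK_mul_self (g : LieType) (hN : N ≠ 0) (hsp : g = .sp → Even N) {n : ℕ}
    (f : Fin n ↪ ι) : embed f (fuseK K g N n) * embed f (fuseK K g N n) = embed f (fuseK K g N n) :=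
  embed_fuseK_absorb g hN hsp f fun _ _ hab => embed_fuseK_mul g f hab

theorem embed_legProd {n : ℕ} (f : Fin n ↪ ι) (L : Fin n → Matrix (Fin N) (Fin N) K) :
    embed f (legProd L) = ((List.finRange n).map fun i => leg (f i) (L i)).prod := by
  rw [legProd, map_list_prod, List.map_map]
  congr 2
  funext i
  exact embed_leg f i (L i)

/-- The fusion of the matrices `L(u + d_i h)`. -/
theorem embed_fuseK_legProd (g : LieType) (hN : N ≠ 0) (hsp : g = .sp → Even N) {n : ℕ}
    (f : Fin n ↪ ι) (L : Fin n → Matrix (Fin N) (Fin N) K)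
    (hL : ∀ i i' : Fin n, i.val + 1 = i'.val → cmat K (fuseIdem g N) * leg1 (L i) * leg2 (L i') =
      leg2 (L i') * leg1 (L i) * cmat K (fuseIdem g N)) :
    embed f (fuseK K g N n) * embed f (legProd L) * embed f (fuseK K g N n) =
      embed f (fuseK K g N n) * embed f (legProd L) := by
  refine embed_fuseK_absorb g hN hsp f fun a b hab => ?_
  rw [embed_legProd]
  refine absorb_prod hab (embed_fuseK_mul g f hab) (pair_cmat_fuseIdem_idem g hN hsp _) ?_ ?_
  · have := congrArg (pair (f.injective.ne (adj_ne hab))) (hL a b hab)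
    simpa only [map_mul, pair_leg1, pair_leg2] using this
  · intro c h1 h2
    exact pair_commute_leg _ (f.injective.ne h1) (f.injective.ne h2) fun x y _ _ =>
      commute_of_central (cmat_mem_center _) x y _

/-- The commutativity of the fused transfer matrices: a product of `R`-matrices intertwines the two
orders of the factors, it is compatible with the idempotents, and it can be cancelled under the
trace. -/
theorem commute_fused_traces (g : LieType) (hN : N ≠ 0) (hsp : g = .sp → Even N) {n m : ℕ}
    (L : Fin n → Matrix (Fin N) (Fin N) K) (L' : Fin m → Matrix (Fin N) (Fin N) K)
    (a : Fin n → Z) (b : Fin m → Z)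
    (ha : ∀ i i' : Fin n, i.val + 1 = i'.val → a i' = a i + cZ Z (eta g) * algebraMap Coef Z h)
    (hb : ∀ i i' : Fin m, i.val + 1 = i'.val → b i' = b i + cZ Z (eta g) * algebraMap Coef Z h)
    (hL : ∀ i i' : Fin n, i.val + 1 = i'.val → cmat K (fuseIdem g N) * leg1 (L i) * leg2 (L i') =
      leg2 (L i') * leg1 (L i) * cmat K (fuseIdem g N))
    (hL' : ∀ i i' : Fin m, i.val + 1 = i'.val →
      cmat K (fuseIdem g N) * leg1 (L' i) * leg2 (L' i') =
        leg2 (L' i') * leg1 (L' i) * cmat K (fuseIdem g N))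
    (hR : ∀ i j, RK K g N (a i - b j) * leg1 (L i) * leg2 (L' j) =
      leg2 (L' j) * leg1 (L i) * RK K g N (a i - b j))
    (hreg : ∀ i j, ∀ x : K, (((a i - b j) ^ 2 - algebraMap Coef Z h ^ 2) *
      ((a i - b j) ^ 2 - (algebraMap Coef Z h * (cZ Z (N / 2) - cZ Z (eta g))) ^ 2)) • x = 0 →
        x = 0) :
    Commute (fuseK K g N n * legProd L).trace (fuseK K g N m * legProd L').trace := by
  let ι := Fin n ⊕ Fin m
  let f₁ : Fin n ↪ ι := Function.Embedding.inl
  let f₂ : Fin m ↪ ι := Function.Embedding.inr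
  have nij : ∀ i j, f₁ i ≠ f₂ j := fun i j => Sum.inl_ne_inr
  let F : Fin n → Fin m → Matrix (ι → Fin N) (ι → Fin N) K := fun i j =>
    pair (nij i j) (RK K g N (a i - b j))
  let G : Fin n → Fin m → Matrix (ι → Fin N) (ι → Fin N) K := fun i j =>
    pair (nij i j) (RK K g N (-(a i - b j)))
  let c : Fin n → Fin m → Z := fun i j => ((a i - b j) ^ 2 - algebraMap Coef Z h ^ 2) *
      ((a i - b j) ^ 2 - (algebraMap Coef Z h * (cZ Z (N / 2) - cZ Z (eta g))) ^ 2)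
  let A := List.finRange n
  let B := List.finRange m
  have hA : A.Nodup := List.nodup_finRange n
  have hB : B.Nodup := List.nodup_finRange m
  have hFG : ∀ i j, F i j * G i j = c i j • 1 := fun i j => by
    rw [← map_mul, RK_mul_neg g hsp, pair_smul, map_one]
  have hGF : ∀ i j, G i j * F i j = c i j • 1 := fun i j => by
    have := RK_mul_neg (K := K) g hsp (-(a i - b j))
    rw [neg_neg, neg_sq] at this
    rw [← map_mul, this, pair_smul, map_one]
  let R := (B.reverse.map fun j => (A.map fun i => F i j).prod).prod
  let R' := (B.map fun j => (A.reverse.map fun i => G i j).prod).prod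
  let p := (B.map fun j => (A.map fun i => c i j).prod).prod
  have hRR : R * R' = p • 1 := by
    have := list_prod_mul_reverse (fun j => (A.map fun i => F i j).prod)
      (fun j => (A.reverse.map fun i => G i j).prod) (fun j => (A.map fun i => c i j).prod)
      (fun j => list_prod_mul_reverse _ _ _ (fun i => hFG i j) A) B.reverse
    rwa [List.reverse_reverse, list_prod_map_reverse] at this
  have hRR' : R' * R = p • 1 := by
    have h1 : ∀ j, (A.reverse.map fun i => G i j).prod * (A.map fun i => F i j).prod =
        (A.map fun i => c i j).prod • 1 := fun j => by
      have := list_prod_mul_reverse _ _ _ (fun i => hGF i j) A.reverse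
      rwa [List.reverse_reverse, list_prod_map_reverse] at this
    exact list_prod_mul_reverse _ _ _ h1 B
  have hp : ∀ x : K, p • x = 0 → x = 0 := list_prod_smul_regular _
    (fun j => list_prod_smul_regular _ (fun i => hreg i j) A) B
  have hFc : ∀ i j, F i j ∈ (Subring.center K).matrix := fun i j =>
    place_mem_central_matrix _ (RK_mem_center g _)
  have hRc : R ∈ (Subring.center K).matrix := by
    refine list_prod_mem fun x hx => ?_
    obtain ⟨j, _, rfl⟩ := List.mem_map.1 hx
    refine list_prod_mem fun x hx => ?_
    obtain ⟨i, _, rfl⟩ := List.mem_map.1 hx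
    exact hFc i j
  set E₁ := embed f₁ (fuseK K g N n) with hE₁
  set E₂ := embed f₂ (fuseK K g N m) with hE₂
  have hE₁c : E₁ ∈ (Subring.center K).matrix := place_mem_central_matrix _ (cmat_mem_center _)
  have hE₂c : E₂ ∈ (Subring.center K).matrix := place_mem_central_matrix _ (cmat_mem_center _)
  have h12 : Commute E₁ E₂ := embed_commute nij fun x y _ _ =>
    commute_of_central (cmat_mem_center _) x y _
  have hE11 : E₁ * E₁ = E₁ := fuseK_mul_self g hN hsp f₁
  have hE22 : E₂ * E₂ = E₂ := fuseK_mul_self g hN hsp f₂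
  have comm1 : ∀ (x : Z) {i i' : Fin n} (hi : i ≠ i') (k : Fin n) (j : Fin m), k ≠ i → k ≠ i' →
      Commute (pair (f₁.injective.ne hi) (cmat K (fuseIdem g N))) (pair (nij k j) (RK K g N x)) :=
    fun x i i' hi k j h1 h2 => pair_commute_pair _ _ (f₁.injective.ne h1.symm) (nij i j)
      (f₁.injective.ne h2.symm) (nij i' j) fun x y _ _ =>
        commute_of_central (cmat_mem_center _) x y _
  have comm2 : ∀ (x : Z) {j j' : Fin m} (hj : j ≠ j') (i : Fin n) (k : Fin m), k ≠ j → k ≠ j' →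
      Commute (pair (f₂.injective.ne hj) (cmat K (fuseIdem g N))) (pair (nij i k) (RK K g N x)) :=
    fun x j j' hj i k h1 h2 => pair_commute_pair _ _ (nij i j).symm (f₂.injective.ne h1.symm)
      (nij i j').symm (f₂.injective.ne h2.symm) fun x y _ _ =>
        commute_of_central (cmat_mem_center _) x y _
  have hFcomm : ∀ (x y : Z) (i : Fin n) (j : Fin m) (i' : Fin n) (j' : Fin m), i ≠ i' → j ≠ j' →
      Commute (pair (nij i j) (RK K g N x)) (pair (nij i' j') (RK K g N y)) :=
    fun x y i j i' j' hi hj => pair_commute_pair _ _ (f₁.injective.ne hi) (nij i j')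
      (nij i' j).symm (f₂.injective.ne hj) fun x y _ _ => commute_of_central (RK_mem_center g _) x y _
  have hE₁R : E₁ * R * E₁ = E₁ * R := by
    refine absorb_list (fun x hx => ?_) hE11
    obtain ⟨j, _, rfl⟩ := List.mem_map.1 hx
    refine embed_fuseK_absorb g hN hsp f₁ fun i i' hi => absorb_prod hi (embed_fuseK_mul g f₁ hi)
      (pair_cmat_fuseIdem_idem g hN hsp _) ?_ fun k h1 h2 => comm1 _ (adj_ne hi) k j h1 h2
    exact fused_pair_RK g hN hsp _ _ _ (by rw [ha i i' hi]; ring)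
  have hE₁R' : E₁ * R' * E₁ = E₁ * R' := by
    refine absorb_list (fun x hx => ?_) hE11
    obtain ⟨j, _, rfl⟩ := List.mem_map.1 hx
    refine embed_fuseK_absorb g hN hsp f₁ fun i i' hi =>
      absorb_prod_reverse hi (embed_fuseK_mul g f₁ hi)
        (pair_cmat_fuseIdem_idem g hN hsp _) ?_ fun k h1 h2 => comm1 _ (adj_ne hi) k j h1 h2
    exact fused_pair_RK' g hN hsp _ _ _ (by rw [ha i i' hi]; ring)
  have hE₂R : E₂ * R * E₂ = E₂ * R := by
    rw [show R = (A.map fun i => (B.reverse.map fun j => F i j).prod).prod from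
      list_prod_comm F A B.reverse hA (List.nodup_reverse.2 hB)
        fun i j i' j' hi hj => hFcomm _ _ i j i' j' hi hj]
    refine absorb_list (fun x hx => ?_) hE22
    obtain ⟨i, _, rfl⟩ := List.mem_map.1 hx
    refine embed_fuseK_absorb g hN hsp f₂ fun j j' hj =>
      absorb_prod_reverse hj (embed_fuseK_mul g f₂ hj)
        (pair_cmat_fuseIdem_idem g hN hsp _) ?_ fun k h1 h2 => comm2 _ (adj_ne hj) i k h1 h2
    simp only [F]
    rw [pair_RK_comm g hsp (nij i j), pair_RK_comm g hsp (nij i j')]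
    exact fused_pair_RK' g hN hsp _ _ _ (by rw [hb j j' hj]; ring)
  have hE₂R' : E₂ * R' * E₂ = E₂ * R' := by
    rw [show R' = (A.reverse.map fun i => (B.map fun j => G i j).prod).prod from
      list_prod_comm G A.reverse B (List.nodup_reverse.2 hA) hB
        fun i j i' j' hi hj => hFcomm _ _ i j i' j' hi hj]
    refine absorb_list (fun x hx => ?_) hE22
    obtain ⟨i, _, rfl⟩ := List.mem_map.1 hx
    refine embed_fuseK_absorb g hN hsp f₂ fun j j' hj =>
      absorb_prod hj (embed_fuseK_mul g f₂ hj)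
        (pair_cmat_fuseIdem_idem g hN hsp _) ?_ fun k h1 h2 => comm2 _ (adj_ne hj) i k h1 h2
    simp only [G]
    rw [pair_RK_comm g hsp (nij i j), pair_RK_comm g hsp (nij i j')]
    exact fused_pair_RK g hN hsp _ _ _ (by rw [hb j j' hj]; ring)
  set X := embed f₁ (legProd L) with hX
  set Y := embed f₂ (legProd L') with hY
  have hRXY : R * (X * Y) = Y * X * R := by
    rw [← mul_assoc, hX, hY, embed_legProd, embed_legProd]
    refine intertwine_prod F (fun i => leg (f₁ i) (L i)) (fun j => leg (f₂ j) (L' j)) ?_ ?_ ?_ A hA B hB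
    · intro i j
      have := congrArg (pair (nij i j)) (hR i j)
      simpa only [map_mul, pair_leg1, pair_leg2] using this
    · intro i j i' hi
      exact pair_commute_leg _ (f₁.injective.ne hi.symm) (nij i' j) fun x y _ _ =>
        commute_of_central (RK_mem_center g _) x y _
    · intro i j j' hj
      exact pair_commute_leg _ (nij i j').symm (f₂.injective.ne hj.symm) fun x y _ _ =>
        commute_of_central (RK_mem_center g _) x y _
  have hE₁Y : Commute E₁ Y := embed_commute nij fun x y _ _ =>
    commute_of_central (cmat_mem_center _) x y _
  have hE₂X : Commute E₂ X := embed_commute (fun i j => (nij j i).symm) fun x y _ _ =>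
    commute_of_central (cmat_mem_center _) x y _
  have hE₁X : E₁ * X * E₁ = E₁ * X := embed_fuseK_legProd g hN hsp f₁ L hL
  have hE₂Y : E₂ * Y * E₂ = E₂ * Y := embed_fuseK_legProd g hN hsp f₂ L' hL'
  have key := trace_eq_of_intertwine hp (mul_mem hE₁c hE₂c) hRc
    (by rw [mul_assoc, ← mul_assoc E₂, ← h12.eq, mul_assoc, hE22, ← mul_assoc, hE11]) hRR hRR'
    (absorb_mul h12 hE₁R hE₂R) (absorb_mul h12 hE₁R' hE₂R')
    (absorb_mul_of_commute h12 hE₁X hE₂Y hE₂X hE₁Y) hRXY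
  have e1 : E₁ * E₂ * (X * Y) = embed f₁ (fuseK K g N n * legProd L) *
      embed f₂ (fuseK K g N m * legProd L') := by
    rw [map_mul, map_mul]
    calc _ = E₁ * (E₂ * X) * Y := by simp only [mul_assoc]
      _ = _ := by rw [hE₂X.eq]; simp only [mul_assoc, hE₁, hE₂, hX, hY]
  have e2 : E₁ * E₂ * (Y * X) = embed f₂ (fuseK K g N m * legProd L') *
      embed f₁ (fuseK K g N n * legProd L) := by
    rw [map_mul, map_mul]
    calc _ = E₂ * (E₁ * Y) * X := by rw [h12.eq]; simp only [mul_assoc]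
      _ = _ := by rw [hE₁Y.eq]; simp only [mul_assoc, hE₁, hE₂, hX, hY]
  rw [e1, e2, trace_embed_mul_embed, trace_embed_mul_embed'] at key
  exact key

end Transfer

/-! ### Divided differences of products of R-matrices -/

section QuantumDeterminant

variable {R Z : Type*} [Ring R] [CommRing Z] [Algebra Z R]

/-- The quotient by `t` of the difference of the ordered product `∏ (c_i - t P_i)` and `∏ c_i`, given
by a recursion since `t` need not be regular. -/
def divDiff (t : Z) (c : ℕ → Z) (P : ℕ → R) : List ℕ → R
  | [] => 0
  | i :: l => (c i • 1 - t • P i) * divDiff t c P l - (l.map c).prod • P i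

theorem prod_eq_divDiff (t : Z) (c : ℕ → Z) (P : ℕ → R) (l : List ℕ) :
    (l.map fun i => c i • 1 - t • P i).prod = (l.map c).prod • 1 + t • divDiff t c P l := by
  induction l with
  | nil => simp [divDiff]
  | cons i l ih =>
    rw [List.map_cons, List.prod_cons, ih, divDiff, List.map_cons, List.prod_cons]
    simp only [mul_add (_ : R), sub_mul _ _ (_ : R), mul_smul_comm, smul_mul_assoc, one_mul, mul_one]
    module

theorem divDiff_append (t : Z) (c : ℕ → Z) (P : ℕ → R) (l : List ℕ) (n : ℕ) :
    divDiff t c P (l ++ [n]) = c n • divDiff t c P l -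
      (l.map fun i => c i • 1 - t • P i).prod * P n := by
  induction l with
  | nil => simp [divDiff]
  | cons i l ih =>
    rw [List.cons_append, divDiff, ih, divDiff, List.map_cons, List.prod_cons, List.map_append,
      List.prod_append, List.map_singleton, List.prod_singleton, mul_sub, mul_smul_comm, mul_assoc]
    module

/-- The relations between `M` and the single factors `L_i`, multiplied out. They differ from those of
an intertwining operator by the commutators with `P_i`, which add up to a commutator with `divDiff`. -/
theorem intertwine_divDiff (t : Z) (c : ℕ → Z) (P L : ℕ → R) (M : R)
    (h : ∀ i, (c i • 1 - t • P i) * L i * M = M * L i * (c i • 1 - t • P i) - (P i * L i - L i * P i))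
    (hc : ∀ i j, i ≠ j → Commute (P i) (L j)) (l : List ℕ) (hl : l.Nodup) :
    (l.map fun i => c i • 1 - t • P i).prod * (l.map L).prod * M
      - M * (l.map L).prod * (l.map fun i => c i • 1 - t • P i).prod =
      divDiff t c P l * (l.map L).prod - (l.map L).prod * divDiff t c P l := by
  induction l with
  | nil => simp [divDiff]
  | cons i l ih =>
    obtain ⟨hi, hl⟩ := List.nodup_cons.1 hl
    have hfc : ∀ a b, a ≠ b → Commute (c a • 1 - t • P a) (L b) := fun a b hab =>
      ((Commute.one_left _).smul_left _).sub_left ((hc a b hab).smul_left _)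
    have c1 : Commute (L i) (l.map fun i => c i • 1 - t • P i).prod :=
      commute_list_prod fun z hz => by
        obtain ⟨j, hj, rfl⟩ := List.mem_map.1 hz
        exact (hfc j i (by rintro rfl; exact hi hj)).symm
    have c2 : Commute (P i) (l.map L).prod := commute_list_prod fun z hz => by
      obtain ⟨j, hj, rfl⟩ := List.mem_map.1 hz
      exact hc i j (by rintro rfl; exact hi hj)
    have hS : ∀ l : List ℕ, i ∉ l → Commute (L i) (divDiff t c P l) := by
      intro l hl
      induction l with
      | nil => exact Commute.zero_right _
      | cons j l ih =>
        rw [List.mem_cons, not_or] at hl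
        rw [divDiff]
        exact ((hfc j i (Ne.symm hl.1)).symm.mul_right (ih hl.2)).sub_right
          ((hc j i (Ne.symm hl.1)).symm.smul_right _)
    have c3 := hS l hi
    have ih := ih hl
    have hi1 := h i
    have hG := prod_eq_divDiff t c P l
    simp only [List.map_cons, List.prod_cons, divDiff]
    generalize (l.map fun i => c i • 1 - t • P i).prod = G at *
    generalize (l.map L).prod = X at *
    generalize divDiff t c P l = S at *
    generalize (l.map c).prod = C at *
    generalize L i = x at *
    generalize P i = p at *
    generalize c i = a at *
    have ih' : G * X * M = M * X * G + (S * X - X * S) := by rw [← ih]; abel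
    have e1 : (a • 1 - t • p) * G * (x * X) * M = (a • 1 - t • p) * x * (G * X * M) := by
      simp only [mul_assoc]; rw [← mul_assoc G x, ← c1.eq]; simp only [mul_assoc]
    have e2 : (a • 1 - t • p) * G * (x * X) * M = M * x * ((a • 1 - t • p) * X) * G
        - (p * x - x * p) * X * G + (a • 1 - t • p) * x * (S * X - X * S) := by
      rw [e1, ih', mul_add, ← mul_assoc, ← mul_assoc, hi1, sub_mul, sub_mul]
      simp only [mul_assoc]
    have cfX : Commute (a • 1 - t • p) X := ((Commute.one_left _).smul_left _).sub_left (c2.smul_left _)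
    have e3 : M * x * ((a • 1 - t • p) * X) * G = M * (x * X) * ((a • 1 - t • p) * G) := by
      rw [cfX.eq]; simp only [mul_assoc]
    rw [e2, e3]
    have e4 : (p * x - x * p) * X * G = C • (p * x * X - x * X * p) + t • ((p * x - x * p) * X * S) := by
      rw [hG, mul_add, mul_smul_comm, mul_smul_comm, mul_one, sub_mul, mul_assoc x p, c2.eq,
        ← mul_assoc]
    have e5 : ((a • 1 - t • p) * S - C • p) * (x * X) =
        (a • 1 - t • p) * x * S * X - C • (p * x * X) := by
      rw [sub_mul, smul_mul_assoc, ← mul_assoc, ← mul_assoc, mul_assoc _ S x, ← c3.eq, ← mul_assoc]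
    have e6 : (x * X) * ((a • 1 - t • p) * S - C • p) =
        x * (a • 1 - t • p) * X * S - C • (x * X * p) := by
      rw [mul_sub, mul_smul_comm, ← mul_assoc, mul_assoc x X, ← cfX.eq, ← mul_assoc]
    rw [e4, e5, e6]
    simp only [mul_sub (_ : R), sub_mul _ _ (_ : R), mul_smul_comm, smul_mul_assoc, one_mul, mul_one,
      smul_sub, mul_assoc]
    abel

/-- The effect of the product of `R`-matrices on the antisymmetrizer, with the constant term
removed. -/
theorem mul_divDiff_range (t : Z) (c : ℕ → Z) (P : ℕ → R) (E : R) (N : ℕ)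
    (hc : ∀ i, c (i + 1) = c i - t) (hE : ∀ i k, i < k → k < N → E * P i * P k = -(E * P i)) (n : ℕ)
    (hn : n < N) : E * divDiff t c P (List.range (n + 1)) =
      -(((List.range n).map c).prod • (E * ∑ i ∈ Finset.range (n + 1), P i)) := by
  induction n with
  | zero => simp [divDiff]
  | succ n ih =>
    have ih := ih (by omega)
    rw [List.range_succ, divDiff_append, mul_sub, mul_smul_comm, ih, ← mul_assoc, prod_eq_divDiff,
      mul_add, mul_smul_comm, mul_smul_comm, mul_one, ih, Finset.sum_range_succ _ (n + 1)]
    have e : E * (∑ i ∈ Finset.range (n + 1), P i) * P (n + 1) =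
        -(E * ∑ i ∈ Finset.range (n + 1), P i) := by
      rw [Finset.mul_sum, Finset.sum_mul, ← Finset.sum_neg_distrib]
      exact Finset.sum_congr rfl fun i hi => hE i (n + 1) (Finset.mem_range.1 hi) hn
    rw [add_mul, smul_mul_assoc, smul_mul_assoc, neg_mul, smul_mul_assoc, e, mul_add,
      List.range_succ (n := n), List.map_append, List.prod_append, List.map_singleton,
      List.prod_singleton, hc n]
    generalize E * ∑ i ∈ Finset.range (n + 1), P i = x
    module

end QuantumDeterminant

/-! ### The quantum determinant -/

section QuantumDeterminantCentral

variable {N : ℕ}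

/-- The legs of the tensor product of `N + 1` copies of `ℂ^N`, the last one being auxiliary. -/
abbrev AuxLegs (N : ℕ) : Type := Fin N ⊕ Unit

theorem inl_ne_aux (i : Fin N) : (Function.Embedding.inl i : AuxLegs N) ≠ Sum.inr () := Sum.inl_ne_inr

theorem embed_fusionOp_mul_pair [Nonempty (Fin N)] {i k : Fin N} (hik : i ≠ k) :
    embed (Function.Embedding.inl : Fin N ↪ AuxLegs N) (fusionOp .gl N N) *
      pair (Function.Embedding.inl.injective.ne hik) (permOp N) =
        -embed (Function.Embedding.inl : Fin N ↪ AuxLegs N) (fusionOp .gl N N) := by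
  rw [← embed_pair _ hik, ← map_mul, ← map_neg]
  congr 1
  have h1 : eta .gl = -1 := rfl
  rcases lt_or_gt_of_ne hik with h | h
  · rw [fusionOp_mul_pair_permOp .gl h, h1, neg_one_smul]
  · rw [pair_permOp_comm, fusionOp_mul_pair_permOp .gl h, h1, neg_one_smul]

theorem embed_fusionOp_mul_pair_pair [Nonempty (Fin N)] {i k : Fin N} (hik : i ≠ k) :
    embed (Function.Embedding.inl : Fin N ↪ AuxLegs N) (fusionOp .gl N N) *
      pair (inl_ne_aux i) (permOp N) * pair (inl_ne_aux k) (permOp N) =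
        -(embed (Function.Embedding.inl : Fin N ↪ AuxLegs N) (fusionOp .gl N N) *
          pair (inl_ne_aux i) (permOp N)) := by
  have h1 := pair_permOp_mul_pair_left (N := N) (inl_ne_aux i).symm (inl_ne_aux k).symm
    (Function.Embedding.inl.injective.ne hik) (permOp N)
  rw [pair_permOp_comm (inl_ne_aux i).symm, pair_permOp_comm (inl_ne_aux k).symm] at h1
  rw [mul_assoc, h1, ← mul_assoc, embed_fusionOp_mul_pair hik, neg_mul]

/-- The antisymmetrizer on `N + 1` copies of `ℂ^N` vanishes: up to a factor it is `E (1 - ∑ P_{i0})`,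
where `E` is the antisymmetrizer on the first `N` copies and `0` is the auxiliary one. -/
theorem embed_fusionOp_mul_sum [Nonempty (Fin N)] :
    embed (Function.Embedding.inl : Fin N ↪ AuxLegs N) (fusionOp .gl N N) *
      ∑ i, pair (inl_ne_aux i) (permOp N) =
        embed (Function.Embedding.inl : Fin N ↪ AuxLegs N) (fusionOp .gl N N) := by
  set E := embed (Function.Embedding.inl : Fin N ↪ AuxLegs N) (fusionOp .gl N N) with hE
  have sq : ∀ {a b : AuxLegs N} (hab : a ≠ b), pair hab (permOp N) * pair hab (permOp N) = 1 :=
    fun hab => by rw [← map_mul, permOp_mul_permOp, map_one]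
  -- the matrix `E (1 - ∑ P_{i0})` changes its sign under the transpositions of any two legs
  set T := E * (1 - ∑ i, pair (inl_ne_aux i) (permOp N)) with hT
  have hT1 : ∀ {a b : Fin N} (hab : a ≠ b), T * pair (Function.Embedding.inl.injective.ne hab :
      (Function.Embedding.inl a : AuxLegs N) ≠ Function.Embedding.inl b) (permOp N) = -T := by
    intro a b hab
    have e : (∑ i, pair (inl_ne_aux i) (permOp N)) * pair (Function.Embedding.inl.injective.ne hab :
        (Function.Embedding.inl a : AuxLegs N) ≠ Function.Embedding.inl b) (permOp N) =
        pair (Function.Embedding.inl.injective.ne hab) (permOp N) *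
          ∑ i, pair (inl_ne_aux i) (permOp N) := by
      rw [Finset.sum_mul, Finset.mul_sum]
      symm
      refine Fintype.sum_equiv (Equiv.swap a b) _ _ fun i => ?_
      rw [pair_permOp (Function.Embedding.inl.injective.ne hab), permMat_mul_pair]
      congr 1
      have h1 : Equiv.swap (Function.Embedding.inl a : AuxLegs N) (Function.Embedding.inl b)
          (Function.Embedding.inl i) = Function.Embedding.inl (Equiv.swap a b i) :=
        (Function.Embedding.inl.injective.swap_apply a b i)
      have h2 : Equiv.swap (Function.Embedding.inl a : AuxLegs N) (Function.Embedding.inl b)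
          (Sum.inr ()) = Sum.inr () :=
        Equiv.swap_apply_of_ne_of_ne Sum.inr_ne_inl Sum.inr_ne_inl
      simp only [h1, h2]
    rw [hT, mul_sub, mul_one, sub_mul, mul_assoc E, e, ← mul_assoc, embed_fusionOp_mul_pair hab]
    simp only [neg_mul]
    abel
  have hT2 : ∀ a : Fin N, T * pair (inl_ne_aux a) (permOp N) = -T := by
    intro a
    have e : ∑ i ∈ Finset.univ.erase a, E * pair (inl_ne_aux i) (permOp N) *
        pair (inl_ne_aux a) (permOp N) =
          -∑ i ∈ Finset.univ.erase a, E * pair (inl_ne_aux i) (permOp N) := by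
      rw [← Finset.sum_neg_distrib]
      exact Finset.sum_congr rfl fun i hi => embed_fusionOp_mul_pair_pair (Finset.ne_of_mem_erase hi)
    rw [hT, mul_sub, mul_one, sub_mul, Finset.mul_sum, Finset.sum_mul,
      ← Finset.add_sum_erase _ _ (Finset.mem_univ a), e, mul_assoc, sq, mul_one,
      ← Finset.add_sum_erase _ _ (Finset.mem_univ a)]
    abel
  have hT3 : ∀ {a b : AuxLegs N} (hab : a ≠ b), T * pair hab (permOp N) = -T := by
    rintro (a | ⟨⟩) (b | ⟨⟩) hab
    · exact hT1 fun h => hab (congrArg _ h)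
    · exact hT2 a
    · rw [pair_permOp_comm]; exact hT2 b
    · exact absurd rfl hab
  have hT0 : T = 0 := by
    ext I J
    obtain ⟨a, b, hab, hJ⟩ : ∃ a b : AuxLegs N, a ≠ b ∧ J a = J b :=
      Fintype.exists_ne_map_eq_of_card_lt J (by simp)
    have h1 := congrFun (congrFun (hT3 hab) I) J
    rw [pair_permOp, mul_permMat_apply, Equiv.swap_inv] at h1
    have h2 : J ∘ Equiv.swap a b = J := by
      funext c
      rw [Function.comp_apply, Equiv.swap_apply_def]
      split_ifs with h h'
      · rw [h, hJ]
      · rw [h', hJ]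
      · rfl
    rw [h2, Matrix.neg_apply] at h1
    exact self_eq_neg.1 h1
  rw [hT, mul_sub, mul_one, sub_eq_zero] at hT0
  exact hT0.symm

variable {K Z : Type*} [Ring K] [Algebra Coef K] [CommRing Z] [Algebra Coef Z] [Algebra Z K]
  [IsScalarTower Coef Z K]

theorem cmat_embed {ι κ : Type*} [Fintype ι] [DecidableEq ι] [Fintype κ] [DecidableEq κ]
    [Nonempty (Fin N)] (f : κ ↪ ι) (M : Matrix (κ → Fin N) (κ → Fin N) ℂ) :
    cmat K (embed f M) = embed f (cmat K M) := by
  ext I J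
  rw [cmat_apply, embed_apply, embed_apply]
  split_ifs
  · rfl
  · rw [cst, map_zero, map_zero]

/-- The quantum determinant commutes with the entries of every matrix `M` satisfying the relation
between the series `L(u)` and `h⁻¹ (1 - L(v))`. The product of the `R`-matrices acts on the image of the
antisymmetrizer as a scalar, and so does its divided difference. -/
theorem commute_quantum_determinant [Nonempty (Fin N)] (L : Fin N → Matrix (Fin N) (Fin N) K)
    (M : Matrix (Fin N) (Fin N) K) (c : ℕ → Z) (hc : ∀ i, c (i + 1) = c i - algebraMap Coef Z h)
    (hL : ∀ i i' : Fin N, i.val + 1 = i'.val → cmat K (fuseIdem .gl N) * leg1 (L i) * leg2 (L i') =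
      leg2 (L i') * leg1 (L i) * cmat K (fuseIdem .gl N))
    (hM : ∀ i : Fin N, Rpoly .gl N (cmat K (permOp N)) (cmat K (brau .gl N)) (c i) *
      leg1 (L i) * leg2 M = leg2 M * leg1 (L i) *
        Rpoly .gl N (cmat K (permOp N)) (cmat K (brau .gl N)) (c i) -
        (cmat K (permOp N) * leg1 (L i) - leg1 (L i) * cmat K (permOp N)))
    (hreg : ∀ i, ∀ x : K, c i • x = 0 → x = 0) (k l : Fin N) :
    Commute (fuseK K .gl N N * legProd L).trace (M k l) := by
  have hN0 : 0 < N := Fin.pos_iff_nonempty.2 inferInstance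
  have hN : N ≠ 0 := hN0.ne'
  have hsp : LieType.gl = .sp → Even N := nofun
  let f : Fin N ↪ AuxLegs N := Function.Embedding.inl
  set t := algebraMap Coef Z h with ht
  let P : ℕ → Matrix (AuxLegs N → Fin N) (AuxLegs N → Fin N) K := fun i =>
    if hi : i < N then pair (inl_ne_aux ⟨i, hi⟩) (cmat K (permOp N)) else 0
  let X : ℕ → Matrix (AuxLegs N → Fin N) (AuxLegs N → Fin N) K := fun i =>
    if hi : i < N then leg (f ⟨i, hi⟩) (L ⟨i, hi⟩) else 1
  let M' : Matrix (AuxLegs N → Fin N) (AuxLegs N → Fin N) K := leg (Sum.inr ()) M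
  set E := embed f (fuseK K .gl N N) with hE
  have hP : ∀ i : Fin N, P i = pair (inl_ne_aux i) (cmat K (permOp N)) := fun i => by
    simp only [P, i.2, dif_pos]
  have hX : ((List.range N).map X).prod = embed f (legProd L) := by
    rw [embed_legProd, ← List.map_coe_finRange_eq_range, List.map_map]
    congr 2
    funext i
    simp only [X, Function.comp_apply, i.2, dif_pos]
  have key := intertwine_divDiff t c P X M' ?_ ?_ (List.range N) List.nodup_range
  rotate_left
  · intro i
    by_cases hi : i < N
    · have := congrArg (pair (inl_ne_aux ⟨i, hi⟩)) (hM ⟨i, hi⟩)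
      simp only [Rpoly, ← ht, map_sub, map_mul, pair_smul, pair_leg1, pair_leg2, map_one] at this
      simpa only [P, X, M', hi, dif_pos] using this
    · simp only [P, X, hi, dif_neg, not_false_eq_true, smul_zero, sub_zero, mul_one, mul_smul_comm,
        smul_mul_assoc, one_mul, sub_self]
  · intro i j hij
    by_cases hi : i < N
    · by_cases hj : j < N
      · simp only [P, X, hi, hj, dif_pos]
        exact pair_commute_leg _ (f.injective.ne fun h => hij (Fin.ext_iff.1 h).symm) (inl_ne_aux _)
          fun x y _ _ => commute_of_central (cmat_mem_center _) x y _
      · simp only [X, hj, dif_neg, not_false_eq_true]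
        exact Commute.one_right _
    · simp only [P, hi, dif_neg, not_false_eq_true]
      exact Commute.zero_left _
  have hEP : ∀ i k, i < k → k < N → E * P i * P k = -(E * P i) := by
    intro i k hik hk
    have hi : i < N := hik.trans hk
    have h1 := congrArg (cmat K) (embed_fusionOp_mul_pair_pair (N := N) (i := ⟨i, hi⟩) (k := ⟨k, hk⟩)
      (fun h => hik.ne (Fin.ext_iff.1 h)))
    simpa only [P, hi, hk, dif_pos, map_mul, map_neg, cmat_embed, cmat_pair] using h1
  have hEsum : E * ∑ i ∈ Finset.range N, P i = E := by
    have h1 := congrArg (cmat K) (embed_fusionOp_mul_sum (N := N))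
    rw [map_mul, cmat_embed, map_sum] at h1
    rw [← Fin.sum_univ_eq_sum_range]
    simp only [hP]
    simpa only [cmat_pair] using h1
  obtain ⟨n, hn⟩ : ∃ n, N = n + 1 := ⟨N - 1, by omega⟩
  set C := ((List.range n).map c).prod with hC
  have hES : E * divDiff t c P (List.range N) = -(C • E) := by
    have := mul_divDiff_range t c P E N hc hEP n (by omega)
    rwa [← hn, hEsum] at this
  have hER : E * ((List.range N).map fun i => c i • 1 - t • P i).prod = (C * c (n + 1)) • E := by
    rw [prod_eq_divDiff, mul_add, mul_smul_comm, mul_smul_comm, hES, mul_one]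
    have hCN : ((List.range N).map c).prod = C * c n := by
      rw [congrArg List.range hn, List.range_succ, List.map_append, List.prod_append,
        List.map_singleton, List.prod_singleton]
    rw [hCN, hc n]
    module
  have hEX : E * ((List.range N).map X).prod * E = E * ((List.range N).map X).prod := by
    rw [hX]
    exact embed_fuseK_legProd .gl hN hsp f L hL
  have hEM : Commute E M' := embed_commute_leg (fun i => inl_ne_aux i) fun x y _ _ =>
    commute_of_central (cmat_mem_center _) x y _
  have hEE : E * E = E := fuseK_mul_self .gl hN hsp f
  have main : (C * c (n + 1)) • (E * ((List.range N).map X).prod * M' -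
      M' * (E * ((List.range N).map X).prod)) = 0 := by
    have h1 := congrArg (E * ·) key
    generalize ((List.range N).map fun i => c i • 1 - t • P i).prod = G at *
    generalize ((List.range N).map X).prod = Y at *
    generalize divDiff t c P (List.range N) = S at *
    have e1 : E * (S * Y - Y * S) = 0 := by
      rw [mul_sub, ← mul_assoc, hES, ← mul_assoc, ← hEX, mul_assoc _ E S, hES, mul_neg, mul_smul_comm,
        neg_mul, smul_mul_assoc]
      simp only [mul_assoc]
      rw [← mul_assoc E Y E, hEX]
      abel
    have e2 : E * (G * Y * M' - M' * Y * G) = (C * c (n + 1)) • (E * Y * M' - M' * (E * Y)) := by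
      rw [mul_sub, ← mul_assoc, ← mul_assoc, hER, smul_mul_assoc, smul_mul_assoc, smul_sub]
      congr 1
      calc _ = M' * (E * Y * E) * G := by
            rw [hEX]; simp only [mul_assoc]; rw [← mul_assoc E, hEM.eq, mul_assoc]
        _ = M' * (E * Y) * (E * G) := by simp only [mul_assoc]
        _ = _ := by rw [hER, mul_smul_comm, mul_assoc M', hEX]
    rw [← e2]
    exact h1.trans e1
  have hq : ∀ x : K, (C * c (n + 1)) • x = 0 → x = 0 := fun x hx => by
    rw [mul_smul] at hx
    exact hreg _ _ (list_prod_smul_regular c hreg _ _ hx)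
  rw [hX, hE, ← map_mul] at main
  generalize fuseK K .gl N N * legProd L = U at *
  have hd : Disjoint (Finset.univ.map f) {(Sum.inr () : AuxLegs N)} := by
    rw [Finset.disjoint_singleton_right]
    simp [f]
  rw [Matrix.trace]
  refine Commute.sum_left _ _ _ fun I _ => ?_
  have e := congrFun (congrFun main (Sum.elim I fun _ => k)) (Sum.elim I fun _ => l)
  have e1 := placeFun_mul_of_disjoint hd (isPlace_embed f) (isPlace_leg (Sum.inr () : AuxLegs N)) U M
    (Sum.elim I fun _ => k) (Sum.elim I fun _ => l)
  have e2 := placeFun_mul_of_disjoint hd.symm (isPlace_leg (Sum.inr () : AuxLegs N)) (isPlace_embed f)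
    M U (Sum.elim I fun _ => k) (Sum.elim I fun _ => l)
  rw [if_pos] at e1 e2
  · rw [Matrix.smul_apply, Matrix.sub_apply] at e
    have e3 := hq _ e
    have e4 := sub_eq_zero.1 e3
    exact (e1.symm.trans e4).trans e2
  · rintro (c | ⟨⟩) h1 h2
    · rfl
    · exact absurd (Finset.mem_singleton_self _) h1
  · rintro (c | ⟨⟩) h1 h2
    · rfl
    · exact absurd (Finset.mem_singleton_self _) h2

end QuantumDeterminantCentral

/-! ### Fused series over a truncated algebra -/

section

open HahnSeries

section Transport

variable {R S : Type*} [Ring R] [Ring S] (φ : R →+* S) {N : ℕ}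

theorem leg1_map (M : Matrix (Fin N) (Fin N) R) : (leg1 M).map φ = leg1 (M.map φ) := by
  ext p q
  rw [Matrix.map_apply, leg1_apply, leg1_apply, map_mul, Matrix.map_apply]
  split_ifs <;> simp

theorem leg2_map (M : Matrix (Fin N) (Fin N) R) : (leg2 M).map φ = leg2 (M.map φ) := by
  ext p q
  rw [Matrix.map_apply, leg2_apply, leg2_apply, map_mul, Matrix.map_apply]
  split_ifs <;> simp

theorem leg_map {ι : Type*} [Fintype ι] [DecidableEq ι] (i : ι) (M : Matrix (Fin N) (Fin N) R) :
    φ.mapMatrix (leg i M) = leg i (M.map φ) := by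
  ext I J
  rw [RingHom.mapMatrix_apply, Matrix.map_apply, leg_apply, leg_apply]
  split_ifs <;> simp

variable [Algebra Coef R] [Algebra Coef S]

theorem cmat_map (hφ : ∀ r : Coef, φ (algebraMap Coef R r) = algebraMap Coef S r) {X : Type*}
    [Fintype X] [DecidableEq X] (M : Matrix X X ℂ) : (cmat R M).map φ = cmat S M := by
  ext p q
  rw [Matrix.map_apply, cmat_apply, cmat_apply, hφ]

theorem map_fused_trace (hφ : ∀ r : Coef, φ (algebraMap Coef R r) = algebraMap Coef S r)
    (g : LieType) {n : ℕ} (L : Fin n → Matrix (Fin N) (Fin N) R) :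
    (fuseK S g N n * legProd fun i => (L i).map φ).trace =
      φ (fuseK R g N n * legProd L).trace := by
  rw [show fuseK S g N n = (fuseK R g N n).map φ from (cmat_map φ hφ _).symm]
  have e : (legProd fun i => (L i).map φ) = (legProd L).map φ := by
    have := map_list_prod φ.mapMatrix ((List.finRange n).map fun i => leg i (L i))
    rw [List.map_map] at this
    refine Eq.trans ?_ this.symm
    rw [legProd]
    congr 2
    funext i
    exact (leg_map φ i (L i)).symm
  rw [e, ← Matrix.map_mul, Matrix.trace, Matrix.trace, map_sum]
  rfl

end Transport

section LSeries

variable {B : Type*} [Ring B] [Algebra Coef B] {N : ℕ}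

theorem zEmb_algebraMap (r : Coef) : zEmb B (algebraMap Coef _ r) = algebraMap Coef _ r := by
  rw [Algebra.algebraMap_eq_smul_one, zEmb_smul, map_one, Algebra.algebraMap_eq_smul_one]

theorem wEmb_algebraMap (r : Coef) : wEmb B (algebraMap Coef _ r) = algebraMap Coef _ r := by
  rw [Algebra.algebraMap_eq_smul_one, wEmb_smul, map_one, Algebra.algebraMap_eq_smul_one]

theorem mapSeq_oneSub {K : Type*} [Ring K] [Algebra Coef K] (φ : (ℤ → B) →ₗ[Coef] K)
    (hφ : φ (fun k => if k = 0 then 1 else 0) = 1) (μ : ℤ → Matrix (Fin N) (Fin N) B) :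
    mapSeq φ (oneSub μ) = 1 - h • mapSeq φ μ := by
  ext i j
  have e : (fun k => oneSub μ k i j) = (if i = j then fun k => if k = 0 then (1 : B) else 0 else 0)
      - h • fun k => μ k i j := by
    funext k
    by_cases hij : i = j <;> by_cases hk : k = 0 <;> simp [oneSub, hij, hk]
  rw [mapSeq, e, map_sub, map_smul, Matrix.sub_apply, Matrix.one_apply, Matrix.smul_apply]
  split_ifs
  · rw [hφ]; rfl
  · rw [map_zero]; rfl

theorem leg1_one_sub {K : Type*} [Ring K] [Algebra Coef K] (M : Matrix (Fin N) (Fin N) K) :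
    leg1 (1 - h • M) = 1 - h • leg1 M := by
  ext ⟨a, b⟩ ⟨c, d⟩
  by_cases h1 : a = c <;> by_cases h2 : b = d <;>
    simp [leg1_apply, h1, h2]

theorem leg2_one_sub {K : Type*} [Ring K] [Algebra Coef K] (M : Matrix (Fin N) (Fin N) K) :
    leg2 (1 - h • M) = 1 - h • leg2 M := by
  ext ⟨a, b⟩ ⟨c, d⟩
  by_cases h1 : a = c <;> by_cases h2 : b = d <;>
    simp [leg2_apply, h1, h2]

/-- The matrix `L(z + d h)` for `L(u) = 1 - h μ(u)`. -/
def zL (p : ℕ) (n : ℤ) (μ : ℤ → Matrix (Fin N) (Fin N) B) (d : ℂ) :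
    Matrix (Fin N) (Fin N) (HahnSeries ℤ B) := mapSeq (serz p (n + 2) d) (oneSub μ)

variable {p : ℕ} {n : ℤ} {μ : ℤ → Matrix (Fin N) (Fin N) B} {g : LieType}

section Generic

variable {K Z : Type*} [Ring K] [Algebra Coef K] [CommRing Z] [Algebra Coef Z] [Algebra Z K]
  [IsScalarTower Coef Z K]

/-- The relation between adjacent factors of a fused product. -/
theorem Evaluation.fused_rtt (E : Evaluation B K Z n) (hn : 0 < n) (hN : N ≠ 0)
    (hμ : Bd n μ) (hrel : ∀ k l, rttDiv g μ k l = 0)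
    (hx : E.a - E.b = -algebraMap Coef Z (cst (eta g) * h)) :
    cmat K (fuseIdem g N) * leg1 (mapSeq E.ev₁ (oneSub μ)) * leg2 (mapSeq E.ev₂ (oneSub μ)) =
      leg2 (mapSeq E.ev₂ (oneSub μ)) * leg1 (mapSeq E.ev₁ (oneSub μ)) * cmat K (fuseIdem g N) := by
  rw [mapSeq_oneSub _ E.ev_one₁, mapSeq_oneSub _ E.ev_one₂, leg1_one_sub, leg2_one_sub]
  by_cases hg : g = .gl
  · subst hg
    have e3 : E.a - E.b = algebraMap Coef _ h := by
      rw [hx, ← map_neg, ← neg_mul]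
      congr 1
      simp [eta, cst]
    have h1 := fused_rtt_gl e3 (E.eval_gl hμ hrel)
    rw [fuseIdem_gl, cmat_smul (Z := Z), map_sub, map_one, smul_mul_assoc, smul_mul_assoc, h1,
      mul_smul_comm]
  · have h2 := E.eval_osp hn hμ hg hrel
    rw [map_sub] at h2
    have h1 := fused_rtt_osp hg N hN hx h2
    have e4 : cmat K (fuseIdem g N) = cst (1 / 2) • (1 + cst (eta g) • cmat K (permOp N))
          - cst (1 / N) • cmat K (brauerOp g N) := by
      rw [fuseIdem, map_sub, cmat_smul (Z := Z), cmat_smul (Z := Z), map_add, map_one,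
        cmat_smul (Z := Z), brau_osp hg]
      simp only [cZ_apply, algebraMap_smul]
    rw [e4, h1]

/-- The exchange relation of the evaluated series `L(a)` and `L(b)`. -/
theorem Evaluation.rtt (E : Evaluation B K Z n) (hn : 0 < n)
    (hμ : Bd n μ) (hrel : ∀ k l, rttDiv g μ k l = 0) :
    RK K g N (E.a - E.b) * leg1 (mapSeq E.ev₁ (oneSub μ)) * leg2 (mapSeq E.ev₂ (oneSub μ)) =
      leg2 (mapSeq E.ev₂ (oneSub μ)) * leg1 (mapSeq E.ev₁ (oneSub μ)) * RK K g N (E.a - E.b) := by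
  rw [mapSeq_oneSub _ E.ev_one₁, mapSeq_oneSub _ E.ev_one₂, leg1_one_sub, leg2_one_sub]
  by_cases hg : g = .gl
  · subst hg
    have h1 := rtt_gl (cmat K (brau .gl N)) N (E.eval_gl hμ hrel)
    have e3 : RK K .gl N (E.a - E.b) =
        (E.a - E.b - algebraMap Coef _ h * (cZ _ (N / 2) - cZ _ (eta .gl))) •
          Rpoly .gl N (cmat _ (permOp N)) (cmat _ (brau .gl N)) (E.a - E.b) := by
      rw [RK, Rmat, Rpoly, brau_gl, map_zero, smul_zero, add_zero, smul_sub, smul_smul, smul_smul,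
        mul_comm, mul_comm (algebraMap Coef Z h) (E.a - E.b - _)]
    rw [e3, smul_mul_assoc, smul_mul_assoc, h1, mul_smul_comm]
  · have h2 := E.eval_osp hn hμ hg hrel
    rw [map_sub] at h2
    have h1 := rtt_osp hg N h2
    have e3 : RK K g N (E.a - E.b) =
        Rpoly g N (cmat _ (permOp N)) (cmat _ (brauerOp g N)) (E.a - E.b) := by
      rw [RK, Rmat, Rpoly_osp hg, brau_osp hg, ← map_sub, ← kappa_eq hg, cZ_apply, ← map_mul]
    rw [e3, h1]

/-- The exchange relation of `L(a)` and `h⁻¹ (1 - L(b))` for `gl_N`. -/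
theorem Evaluation.rtt_divided (E : Evaluation B K Z n)
    (hμ : Bd n μ) (hrel : ∀ k l, rttDiv .gl μ k l = 0) :
    Rpoly .gl N (cmat K (permOp N)) (cmat K (brau .gl N)) (E.a - E.b) *
        leg1 (mapSeq E.ev₁ (oneSub μ)) * leg2 (mapSeq E.ev₂ μ) =
      leg2 (mapSeq E.ev₂ μ) * leg1 (mapSeq E.ev₁ (oneSub μ)) *
        Rpoly .gl N (cmat K (permOp N)) (cmat K (brau .gl N)) (E.a - E.b) -
        (cmat K (permOp N) * leg1 (mapSeq E.ev₁ (oneSub μ)) -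
          leg1 (mapSeq E.ev₁ (oneSub μ)) * cmat K (permOp N)) := by
  rw [mapSeq_oneSub _ E.ev_one₁, leg1_one_sub]
  exact rtt_gl_divided _ N (E.eval_gl hμ hrel)

/-- The scalar by which the product `R(y) R(-y)` acts is a product of linear factors. -/
theorem regular_factors {y : Z} (hy : ∀ r : Coef, ∀ x : K, (y + algebraMap Coef Z r) • x = 0 → x = 0)
    (g : LieType) (N : ℕ) (x : K)
    (hx : ((y ^ 2 - algebraMap Coef Z h ^ 2) *
      (y ^ 2 - (algebraMap Coef Z h * (cZ Z (N / 2) - cZ Z (eta g))) ^ 2)) • x = 0) : x = 0 := by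
  rw [cZ_apply, cZ_apply, ← map_sub, ← map_mul] at hx
  generalize h * (cst (N / 2) - cst (eta g)) = s at hx
  have e : (y ^ 2 - algebraMap Coef Z h ^ 2) * (y ^ 2 - algebraMap Coef Z s ^ 2) =
      (y + algebraMap Coef Z h) * ((y + algebraMap Coef Z (-h)) *
        ((y + algebraMap Coef Z s) * (y + algebraMap Coef Z (-s)))) := by
    rw [map_neg, map_neg]
    ring
  rw [e, mul_smul, mul_smul, mul_smul] at hx
  exact hy _ _ (hy _ _ (hy _ _ (hy _ _ hx)))

theorem add_algebraMap_sub (a b : Z) (r r' : Coef) :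
    a + algebraMap Coef Z r - (b + algebraMap Coef Z r') = a - b + algebraMap Coef Z (r - r') := by
  rw [map_sub]
  ring

theorem offset_step (y : Z) {g : LieType} {d d' : ℂ} (hd : d' = d + eta g) :
    y + algebraMap Coef Z (cst d' * h) =
      y + algebraMap Coef Z (cst d * h) + cZ Z (eta g) * algebraMap Coef Z h := by
  rw [hd, cZ_apply, ← map_mul, add_assoc, ← map_add, ← add_mul, cst, cst, cst, map_add]

theorem offset_sub (y : Z) {g : LieType} {d d' : ℂ} (hd : d' = d + eta g) :
    y + algebraMap Coef Z (cst d * h) - (y + algebraMap Coef Z (cst d' * h)) =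
      -algebraMap Coef Z (cst (eta g) * h) := by
  rw [offset_step y hd, cZ_apply, ← map_mul]
  ring

theorem offset_step_gl (y y' : Z) (i : ℕ) :
    y + algebraMap Coef Z (cst (-((i + 1 : ℕ) : ℂ)) * h) - y' =
      y + algebraMap Coef Z (cst (-(i : ℂ)) * h) - y' - algebraMap Coef Z h := by
  rw [offset_step (g := .gl) (d := -(i : ℂ)) y (by rw [show eta .gl = -1 from rfl]; push_cast; ring), show eta .gl = -1 from rfl, map_neg,
    map_one]
  ring

end Generic

theorem fused_zL (hp : 0 < p) (hh : ∀ v : B, h ^ p • v = 0) (hn : 0 < n) (hN : N ≠ 0)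
    (hμ : Bd n μ) (hrel : ∀ k l, rttDiv g μ k l = 0) {d d' : ℂ} (hd : d' = d + eta g) :
    cmat (HahnSeries ℤ B) (fuseIdem g N) * leg1 (zL p n μ d) * leg2 (zL p n μ d') =
      leg2 (zL p n μ d') * leg1 (zL p n μ d) * cmat (HahnSeries ℤ B) (fuseIdem g N) := by
  refine (sameEval hp hh hn d d').fused_rtt hn hN hμ hrel ?_
  exact offset_sub (zC B) hd

/-- The matrix `L(z + d h)` over the ring of series in `w⁻¹` and `z⁻¹`. -/
def zzL (p : ℕ) (n : ℤ) (μ : ℤ → Matrix (Fin N) (Fin N) B) (d : ℂ) :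
    Matrix (Fin N) (Fin N) (HahnSeries ℤ (HahnSeries ℤ B)) := (zL p n μ d).map (zEmb B)

/-- The matrix `L(w + d h)` over the ring of series in `w⁻¹` and `z⁻¹`. -/
def wwL (p : ℕ) (n : ℤ) (μ : ℤ → Matrix (Fin N) (Fin N) B) (d : ℂ) :
    Matrix (Fin N) (Fin N) (HahnSeries ℤ (HahnSeries ℤ B)) := (zL p n μ d).map (wEmb B)

theorem fused_zL_map (φ : HahnSeries ℤ B →+* HahnSeries ℤ (HahnSeries ℤ B))
    (hφ : ∀ r : Coef, φ (algebraMap Coef _ r) = algebraMap Coef _ r)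
    (hp : 0 < p) (hh : ∀ v : B, h ^ p • v = 0) (hn : 0 < n) (hN : N ≠ 0)
    (hμ : Bd n μ) (hrel : ∀ k l, rttDiv g μ k l = 0) {d d' : ℂ} (hd : d' = d + eta g) :
    cmat _ (fuseIdem g N) * leg1 ((zL p n μ d).map φ) * leg2 ((zL p n μ d').map φ) =
      leg2 ((zL p n μ d').map φ) * leg1 ((zL p n μ d).map φ) * cmat _ (fuseIdem g N) := by
  have h1 := congrArg (fun M => M.map φ) (fused_zL hp hh hn hN hμ hrel hd)
  simpa only [Matrix.map_mul, leg1_map, leg2_map, cmat_map φ hφ] using h1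

theorem rtt_zzL_wwL (hp : 0 < p) (hh : ∀ v : B, h ^ p • v = 0) (hn : 0 < n)
    (hμ : Bd n μ) (hrel : ∀ k l, rttDiv g μ k l = 0) (d d' : ℂ) :
    RK _ g N ((mixEval hp hh hn d d').a - (mixEval hp hh hn d d').b) *
        leg1 (zzL p n μ d) * leg2 (wwL p n μ d') =
      leg2 (wwL p n μ d') * leg1 (zzL p n μ d) *
        RK _ g N ((mixEval hp hh hn d d').a - (mixEval hp hh hn d d').b) :=
  (mixEval hp hh hn d d').rtt hn hμ hrel

theorem mixEval_regular (hp : 0 < p) (hh : ∀ v : B, h ^ p • v = 0) (hn : 0 < n) (d d' : ℂ)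
    (r : Coef) (x : HahnSeries ℤ (HahnSeries ℤ B))
    (hx : ((mixEval hp hh hn d d').a - (mixEval hp hh hn d d').b + algebraMap Coef _ r) • x = 0) :
    x = 0 := by
  have e : (mixEval hp hh hn d d').a - (mixEval hp hh hn d d').b + algebraMap Coef _ r =
      zCtr B - wCtr B + algebraMap Coef (Ctr B) (cst d * h - cst d' * h + r) := by
    rw [map_add, ← add_assoc]
    exact congrArg (· + _) (add_algebraMap_sub (zCtr B) (wCtr B) _ _)
  rw [e] at hx
  exact zw_regular _ hx

/-- The series `tr E L_1(z + d_1 h) ⋯ L_m(z + d_m h)`. -/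
def fusedSeries (g : LieType) (p : ℕ) (n : ℤ) (μ : ℤ → Matrix (Fin N) (Fin N) B) (m : ℕ) :
    HahnSeries ℤ B :=
  (fuseK (HahnSeries ℤ B) g N m * legProd fun i => zL p n μ (offset g m i)).trace

theorem offset_succ (g : LieType) {m : ℕ} {i i' : Fin m} (hi : i.val + 1 = i'.val) :
    offset g m i' = offset g m i + eta g := by
  have : (i'.val : ℂ) = i.val + 1 := by exact_mod_cast hi.symm
  cases g <;> simp only [offset, eta, this] <;> ring

/-- The coefficients of the fused series commute with each other. -/
theorem commute_fusedSeries (hp : 0 < p) (hh : ∀ v : B, h ^ p • v = 0) (hn : 0 < n) (hN : N ≠ 0)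
    (hsp : g = .sp → Even N) (hμ : Bd n μ) (hrel : ∀ k l, rttDiv g μ k l = 0) (m m' : ℕ)
    (k l : ℤ) :
    Commute ((fusedSeries g p n μ m).coeff k) ((fusedSeries g p n μ m').coeff l) := by
  have : Nonempty (Fin N) := ⟨⟨0, Nat.pos_of_ne_zero hN⟩⟩
  have h1 := commute_fused_traces (K := HahnSeries ℤ (HahnSeries ℤ B)) (Z := Ctr B) g hN hsp
    (fun i : Fin m => zzL p n μ (offset g m i)) (fun i : Fin m' => wwL p n μ (offset g m' i))
    (fun i => zCtr B + algebraMap Coef _ (cst (offset g m i) * h))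
    (fun i => wCtr B + algebraMap Coef _ (cst (offset g m' i) * h))
    (fun i i' hi => offset_step (zCtr B) (offset_succ g hi))
    (fun i i' hi => offset_step (wCtr B) (offset_succ g hi))
    (fun i i' hi => fused_zL_map (zEmb B) zEmb_algebraMap hp hh hn hN hμ hrel (offset_succ g hi))
    (fun i i' hi => fused_zL_map (wEmb B) wEmb_algebraMap hp hh hn hN hμ hrel (offset_succ g hi))
    (fun i j => rtt_zzL_wwL hp hh hn hμ hrel _ _)
    (fun i j => regular_factors (mixEval_regular hp hh hn _ _) g N)
  have e1 := map_fused_trace (zEmb B) zEmb_algebraMap g fun i : Fin m => zL p n μ (offset g m i)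
  have e2 := map_fused_trace (wEmb B) wEmb_algebraMap g fun i : Fin m' => zL p n μ (offset g m' i)
  have h2 : Commute (zEmb B (fusedSeries g p n μ m)) (wEmb B (fusedSeries g p n μ m')) := by
    rw [fusedSeries, fusedSeries, ← e1, ← e2]
    exact h1
  have h3 := congrArg (fun x => (x.coeff l).coeff k) h2.eq
  beta_reduce at h3
  rwa [coeff_zEmb_mul_wEmb, coeff_wEmb_mul_zEmb] at h3

/-- For `gl_N` the coefficients of the quantum determinant commute with those of `μ(u)`. -/
theorem commute_fusedSeries_gl (hp : 0 < p) (hh : ∀ v : B, h ^ p • v = 0) (hn : 0 < n) (hN : N ≠ 0)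
    (hμ : Bd n μ) (hrel : ∀ k l, rttDiv .gl μ k l = 0) (k l : ℤ) (i j : Fin N) :
    Commute ((fusedSeries .gl p n μ N).coeff k) (μ l i j) := by
  have : Nonempty (Fin N) := ⟨⟨0, Nat.pos_of_ne_zero hN⟩⟩
  have h1 := commute_quantum_determinant (K := HahnSeries ℤ (HahnSeries ℤ B)) (Z := Ctr B)
    (fun i : Fin N => zzL p n μ (offset .gl N i)) ((mapSeq (serz p (n + 2) 0) μ).map (wEmb B))
    (fun i => (mixEval hp hh hn (-(i : ℂ)) 0).a - (mixEval hp hh hn (-(i : ℂ)) 0).b)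
    (fun i => offset_step_gl (zCtr B) _ i)
    (fun i i' hi => fused_zL_map (zEmb B) zEmb_algebraMap hp hh hn hN hμ hrel (offset_succ .gl hi))
    (fun i => (mixEval hp hh hn (-(i : ℂ)) 0).rtt_divided hμ hrel)
    (fun i x hx => mixEval_regular hp hh hn (-(i : ℂ)) 0 0 x (by rwa [map_zero, add_zero])) i j
  have e1 := map_fused_trace (zEmb B) zEmb_algebraMap .gl fun i : Fin N => zL p n μ (offset .gl N i)
  have h2 : Commute (zEmb B (fusedSeries .gl p n μ N))
      (wEmb B (mapSeq (serz p (n + 2) 0) μ i j)) := by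
    rw [fusedSeries, ← e1]
    exact h1
  have h3 := congrArg (fun x => (x.coeff (-l)).coeff k) h2.eq
  beta_reduce at h3
  rw [coeff_zEmb_mul_wEmb, coeff_wEmb_mul_zEmb] at h3
  have e3 : (mapSeq (serz p (n + 2) 0) μ i j).coeff (-l) = μ l i j := by
    rw [mapSeq, serz, LinearMap.comp_apply, coeff_lau_of_bd, neg_neg, sig_apply]
    · rw [Finset.sum_eq_single 0]
      · simp
      · intro b _ hb
        rw [cst, map_zero, zero_mul, zero_pow hb, zero_smul, smul_zero]
      · intro h0
        exact absurd (Finset.mem_range.2 hp) h0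
    · refine Bd.sig (fun k hk => ?_) _ _
      rw [hμ k (by omega)]
      rfl
  rwa [e3] at h3

end LSeries

end

/-! ### Products of Laurent series -/

section

open HahnSeries

section MultiIndex

/-- A sum over multi-indices, with the first index split off. -/
theorem sum_piFinset_succ {X V : Type*} [AddCommMonoid V] [DecidableEq X] {m : ℕ} (s : Finset X)
    (f : (Fin (m + 1) → X) → V) :
    ∑ a ∈ Fintype.piFinset (fun _ : Fin (m + 1) => s), f a =
      ∑ x ∈ s, ∑ a ∈ Fintype.piFinset (fun _ : Fin m => s), f (Fin.cons x a) := by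
  rw [← Finset.sum_product']
  refine Finset.sum_bij' (fun a _ => (a 0, Fin.tail a)) (fun q _ => Fin.cons q.1 q.2) ?_ ?_ ?_ ?_ ?_
  · intro a ha
    rw [Fintype.mem_piFinset] at ha
    rw [Finset.mem_product, Fintype.mem_piFinset]
    exact ⟨ha 0, fun i => ha i.succ⟩
  · intro q hq
    rw [Finset.mem_product, Fintype.mem_piFinset] at hq
    rw [Fintype.mem_piFinset]
    exact fun i => Fin.cases hq.1 (fun j => hq.2 j) i
  · intro a _
    exact Fin.cons_self_tail a
  · intro q _
    rfl
  · intro a _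
    rw [Fin.cons_self_tail]

theorem prod_ofFn_sum {X B : Type*} [DecidableEq X] [Ring B] {m : ℕ} (s : Finset X)
    (x : Fin m → X → B) : (List.ofFn fun i => ∑ b ∈ s, x i b).prod =
      ∑ b ∈ Fintype.piFinset (fun _ : Fin m => s), (List.ofFn fun i => x i (b i)).prod := by
  induction m with
  | zero => simp
  | succ m ih =>
    rw [List.ofFn_succ, List.prod_cons, ih, sum_piFinset_succ, Finset.sum_mul_sum]
    refine Finset.sum_congr rfl fun b _ => Finset.sum_congr rfl fun a _ => ?_
    rw [List.ofFn_succ, List.prod_cons]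
    rfl

theorem prod_ofFn_smul {B : Type*} [Ring B] [Algebra Coef B] {m : ℕ} (r : Fin m → Coef)
    (x : Fin m → B) :
    (List.ofFn fun i => r i • x i).prod = (∏ i, r i) • (List.ofFn x).prod := by
  induction m with
  | zero => simp
  | succ m ih =>
    rw [List.ofFn_succ, List.prod_cons, ih, Fin.prod_univ_succ, List.ofFn_succ, List.prod_cons,
      smul_mul_smul_comm]

theorem coeff_lau_mul_of_bd {B : Type*} [Ring B] [Algebra Coef B] (P Q : ℤ) (F : ℤ → B)
    {x : HahnSeries ℤ B} (hx : ∀ k, Q ≤ k → x.coeff (-k) = 0) (k M : ℤ) (hM : Q - k ≤ M) :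
    (lau P F * x).coeff (-k) = ∑ j ∈ Finset.Ioo (-M) P, F j * x.coeff (-(k - j)) := by
  have e : x = lau Q fun j => x.coeff (-j) := by
    ext n
    rw [coeff_lau, neg_neg]
    split_ifs with hn
    · rfl
    · rw [← neg_neg n]
      exact hx _ (by omega)
  conv_lhs => rw [e]
  rw [coeff_lau_mul, neg_neg]
  refine Finset.sum_subset (fun j hj => ?_) fun j hj hj' => ?_
  · rw [Finset.mem_Ioo] at *
    omega
  · rw [Finset.mem_Ioo] at *
    rw [hx _ (by omega), mul_zero]

/-- The multi-indices with all entries between `-M` and `P`. -/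
abbrev intBox (m : ℕ) (M P : ℤ) : Finset (Fin m → ℤ) :=
  Fintype.piFinset fun _ : Fin m => Finset.Ioo (-M) P

/-- The coefficients of a product of series in `z⁻¹`; the members of the sum with an index outside
of the box vanish. -/
theorem coeff_prod_lau {B : Type*} [Ring B] [Algebra Coef B] {P : ℤ} (hP : 0 < P) {m : ℕ}
    (F : Fin m → ℤ → B) (k M : ℤ) (hM : m * P - k ≤ M) :
    (List.ofFn fun i => lau P (F i)).prod.coeff (-k) =
      ∑ c ∈ intBox m M P, if ∑ i, c i = k then (List.ofFn fun i => F i (c i)).prod else 0 := by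
  induction m generalizing k M with
  | zero =>
    rw [List.ofFn_zero, List.prod_nil, coeff_one]
    simp [intBox, eq_comm]
  | succ m ih =>
    push_cast at hM
    rw [List.ofFn_succ, List.prod_cons, coeff_lau_mul_of_bd P (m * P + 1) _ _ k M (by linarith),
      intBox, sum_piFinset_succ]
    · refine Finset.sum_congr rfl fun j hj => ?_
      rw [Finset.mem_Ioo] at hj
      rw [ih (fun i => F i.succ) (k - j) M (by linarith), Finset.mul_sum]
      refine Finset.sum_congr rfl fun c _ => ?_
      rw [Fin.sum_univ_succ, Fin.cons_zero, List.ofFn_succ, List.prod_cons, Fin.cons_zero]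
      simp only [Fin.cons_succ, eq_sub_iff_add_eq', mul_ite, mul_zero]
    · intro k' hk'
      rw [ih (fun i => F i.succ) k' 0 (by linarith)]
      refine Finset.sum_eq_zero fun c hc => if_neg fun hsum => ?_
      have h1 : ∑ i, c i ≤ ∑ _i : Fin m, P := Finset.sum_le_sum fun i _ => by
        have := Fintype.mem_piFinset.1 hc i
        rw [Finset.mem_Ioo] at this
        exact this.2.le
      rw [Finset.sum_const, Finset.card_univ, Fintype.card_fin, nsmul_eq_mul] at h1
      linarith

theorem mem_intBox_of_sum {m : ℕ} {P k M : ℤ} (hP : 0 < P) (hM : m * P - k ≤ M) {c : Fin m → ℤ}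
    (hc : ∀ i, c i < P) (hk : ∑ i, c i = k) : c ∈ intBox m M P := by
  rw [Fintype.mem_piFinset]
  refine fun i => Finset.mem_Ioo.2 ⟨?_, hc i⟩
  have h1 : ∑ j ∈ Finset.univ.erase i, c j ≤ ∑ _j ∈ Finset.univ.erase i, P :=
    Finset.sum_le_sum fun j _ => (hc j).le
  rw [Finset.sum_const, Finset.card_erase_of_mem (Finset.mem_univ i), Finset.card_univ,
    Fintype.card_fin, nsmul_eq_mul, Nat.cast_sub (by have := i.2; omega)] at h1
  rw [← Finset.add_sum_erase _ _ (Finset.mem_univ i)] at hk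
  push_cast at h1
  linarith

/-- The coefficients of a product of the series `f_i(z + t_i)`. -/
theorem coeff_prod_shifted {B : Type*} [Ring B] [Algebra Coef B] {P : ℤ} (hP : 0 < P) {m : ℕ} (p : ℕ)
    (t : Fin m → Coef) (f : Fin m → ℤ → B) (k M : ℤ) (hM : m * P - k ≤ M) :
    (List.ofFn fun i => lau P (sig p (t i) (f i))).prod.coeff (-k) =
      ∑ b ∈ Fintype.piFinset fun _ : Fin m => Finset.range p, (∏ i, t i ^ b i) •
        ∑ c ∈ intBox m M P, if ∑ i, c i = k then
          ((∏ i, Ring.choose (c i + b i) (b i) : ℤ) : Coef) •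
            (List.ofFn fun i => f i (c i + b i)).prod else 0 := by
  rw [coeff_prod_lau hP _ k M hM]
  simp only [Finset.smul_sum]
  rw [Finset.sum_comm]
  refine Finset.sum_congr rfl fun c _ => ?_
  split_ifs
  · simp only [sig_apply]
    rw [prod_ofFn_sum]
    refine Finset.sum_congr rfl fun b _ => ?_
    simp only [smul_smul]
    rw [prod_ofFn_smul, Finset.prod_mul_distrib, mul_comm, Int.cast_prod]
  · simp

end MultiIndex

end

/-! ### The truncated Yangian -/

section

open HahnSeries

section RelationMap

variable {R S : Type*} [Ring R] [Ring S] [Algebra Coef R] [Algebra Coef S] (φ : R →ₐ[Coef] S) {N : ℕ}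

theorem mapMatrix_leg1 (M : Matrix (Fin N) (Fin N) R) :
    φ.mapMatrix (leg1 M) = leg1 (φ.mapMatrix M) := leg1_map φ.toRingHom M

theorem mapMatrix_leg2 (M : Matrix (Fin N) (Fin N) R) :
    φ.mapMatrix (leg2 M) = leg2 (φ.mapMatrix M) := leg2_map φ.toRingHom M

theorem mapMatrix_cmat {X : Type*} [Fintype X] [DecidableEq X] (M : Matrix X X ℂ) :
    φ.mapMatrix (cmat R M) = cmat S M := cmat_map φ.toRingHom φ.commutes M

theorem mapMatrix_legComm (μ : ℤ → Matrix (Fin N) (Fin N) R) (k l : ℤ) :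
    φ.mapMatrix (legComm μ k l) = legComm (fun k => φ.mapMatrix (μ k)) k l := by
  rw [legComm, legComm, map_sub, map_mul, map_mul, mapMatrix_leg1, mapMatrix_leg2]

theorem mapMatrix_legTwist (A : Matrix (Fin N × Fin N) (Fin N × Fin N) ℂ)
    (μ : ℤ → Matrix (Fin N) (Fin N) R) (k l : ℤ) :
    φ.mapMatrix (legTwist A μ k l) = legTwist A (fun k => φ.mapMatrix (μ k)) k l := by
  have e : ∀ P : Prop, [Decidable P] → φ.mapMatrix (if P then
      (1 : Matrix (Fin N × Fin N) (Fin N × Fin N) R) else 0) = if P then 1 else 0 := by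
    intro P _
    split_ifs
    · exact map_one _
    · exact map_zero _
  rw [legTwist, legTwist]
  simp only [map_sub, map_add, map_mul, map_smul, e, mapMatrix_leg1, mapMatrix_leg2, mapMatrix_cmat]

theorem mapMatrix_rttDiv (g : LieType) (μ : ℤ → Matrix (Fin N) (Fin N) R) (k l : ℤ) :
    φ.mapMatrix (rttDiv g μ k l) = rttDiv g (fun k => φ.mapMatrix (μ k)) k l := by
  cases g <;> simp only [rttDiv, mulDiff, map_sub, map_add, map_smul, mapMatrix_legComm,
    mapMatrix_legTwist]

end RelationMap

section Truncation

/-- The quotient of the generalized Yangian by the image of `G_p`. -/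
abbrev TruncY (g : LieType) (N p : ℕ) : Type := (truncIdeal g N p).ringCon.Quotient

/-- The reduction of the completed free algebra to the truncated Yangian. -/
def truncHom (g : LieType) (N p : ℕ) : ComplY N →ₐ[Coef] TruncY g N p where
  toFun := (truncIdeal g N p).ringCon.mk'
  map_one' := rfl
  map_zero' := rfl
  map_mul' _ _ := rfl
  map_add' _ _ := rfl
  commutes' _ := rfl

variable {g : LieType} {N p : ℕ}

theorem truncHom_eq_iff {x y : ComplY N} :
    truncHom g N p x = truncHom g N p y ↔ x - y ∈ truncIdeal g N p :=
  (RingCon.eq _).trans (TwoSidedIdeal.rel_iff _ _ _)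

theorem truncHom_surjective : Function.Surjective (truncHom g N p) := RingCon.mk'_surjective _

theorem truncHom_eq_zero {x : ComplY N} (hx : x ∈ truncIdeal g N p) : truncHom g N p x = 0 := by
  rw [← map_zero (truncHom g N p), truncHom_eq_iff, sub_zero]
  exact hx

theorem truncHom_eq_zero_of_proj {x : ComplY N} (hx : proj (filY N) p x = 0) :
    truncHom g N p x = 0 :=
  truncHom_eq_zero (TwoSidedIdeal.subset_span (Or.inr hx))

/-- The truncated Yangian depends only on the quotient by `G_p`. -/
theorem truncHom_congr_proj {x y : ComplY N} (hxy : proj (filY N) p x = proj (filY N) p y) :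
    truncHom g N p x = truncHom g N p y := by
  rw [← sub_eq_zero, ← map_sub]
  refine truncHom_eq_zero_of_proj ?_
  rw [← projHom_apply, map_sub, projHom_apply, projHom_apply, hxy, sub_self]

theorem trunc_pow_smul (v : TruncY g N p) : h ^ p • v = 0 := by
  obtain ⟨x, rfl⟩ := truncHom_surjective v
  rw [← map_smul]
  exact truncHom_eq_zero_of_proj ((hAdic_filY N).proj_smul le_rfl x)

/-- The matrices of the generators, such that `L(u) = 1 - h ∑_k λ_k u^k`. -/
def genMat (N : ℕ) (k : ℤ) : Matrix (Fin N) (Fin N) (ComplY N) :=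
  fun i j => toCompl (filY N) (FreeAlgebra.ι Coef (i, j, -k))

theorem serL_eq (N : ℕ) : serL N = oneSub (genMat N) := by
  funext k
  ext1 i j
  rw [oneSub, Matrix.sub_apply, Matrix.smul_apply, serL]
  congr 1
  by_cases hk : k = 0
  · simp [hk, Matrix.one_apply]
  · simp [hk]

theorem proj_genMat (N : ℕ) {q : ℕ} {k : ℤ} (hk : (q : ℤ) ≤ k) (i j : Fin N) :
    proj (filY N) q (genMat N k i j) = 0 := by
  refine (RingCon.eq _).2 ((TwoSidedIdeal.mem_iff _ _).1 ?_)
  exact TwoSidedIdeal.subset_span (Or.inr ⟨i, j, k, hk, rfl⟩)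

theorem proj_serL (N : ℕ) {q : ℕ} {k : ℤ} (hq : 0 < q) (hk : (q : ℤ) ≤ k) (i j : Fin N) :
    proj (filY N) q (serL N k i j) = 0 := by
  rw [serL_eq, oneSub, if_neg (by omega), zero_sub, Matrix.neg_apply, Matrix.smul_apply,
    ← projHom_apply, map_neg, map_smul, projHom_apply, proj_genMat N hk, smul_zero, neg_zero]

variable (g p) in
/-- The images of the matrices of generators in the truncated Yangian. -/
def truncMat (N : ℕ) (k : ℤ) : Matrix (Fin N) (Fin N) (TruncY g N p) :=
  (truncHom g N p).mapMatrix (genMat N k)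

/-- In the truncated Yangian the series `L(u)` is bounded above in `u`. -/
theorem bd_truncMat : Bd (p : ℤ) (truncMat g p N) := fun k hk => by
  ext i j
  exact truncHom_eq_zero_of_proj (proj_genMat N hk i j)

/-- The divided relations hold in the truncated Yangian. -/
theorem rttDiv_truncMat (k l : ℤ) : rttDiv g (truncMat g p N) k l = 0 := by
  have e := mapMatrix_rttDiv (truncHom g N p) g (genMat N) k l
  refine e.symm.trans ?_
  ext a b
  refine truncHom_eq_zero (TwoSidedIdeal.subset_span (Or.inl (Or.inl ⟨k, l, a, b, ?_⟩)))
  rw [serL_eq, rttDefect_eq]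
  rfl

theorem oneSub_truncMat (k : ℤ) (i j : Fin N) :
    oneSub (truncMat g p N) k i j = truncHom g N p (serL N k i j) := by
  have e : oneSub (truncMat g p N) k = (truncHom g N p).mapMatrix (oneSub (genMat N) k) := by
    rw [oneSub, oneSub, map_sub, map_smul]
    congr 1
    split_ifs
    · exact (map_one _).symm
    · exact (map_zero _).symm
  rw [e, serL_eq]
  rfl

end Truncation

end

/-! ### The coefficients of the fused series -/

section

open HahnSeries

section Coefficients

variable {g : LieType} {N p : ℕ}

/-- The summand of `multiL` with index `a`. -/
def multiTerm (N m : ℕ) (k : ℤ) (b : Fin m → ℕ) (I J : Fin m → Fin N) (a : Fin m → ℤ) : ComplY N :=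
  if ∑ i, (a i - b i) = k then ((∏ i, Ring.choose (a i) (b i) : ℤ) : Coef) •
    (List.ofFn fun i => serL N (a i) (I i) (J i)).prod else 0

/-- Modulo `G_q`, a summand of `multiL` vanishes if some index is at least `q`; as the sum of the indices
is prescribed, only finitely many summands remain. -/
theorem proj_multiTerm {q m : ℕ} (hq : 0 < q) {k : ℤ} {b : Fin m → ℕ} {I J : Fin m → Fin N}
    {P M : ℤ} (hP : (q : ℤ) ≤ P) (hM : m * P - k ≤ M) {a : Fin m → ℤ}
    (ha : a ∉ (intBox m M P).image fun c i => c i + (b i : ℤ)) :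
    proj (filY N) q (multiTerm N m k b I J a) = 0 := by
  rw [multiTerm]
  split_ifs with hk
  · have h1 : ∃ i, (q : ℤ) ≤ a i := by
      by_contra! hlt
      refine ha (Finset.mem_image.2 ⟨fun i => a i - b i, ?_, funext fun i => sub_add_cancel _ _⟩)
      exact mem_intBox_of_sum (by omega) hM (fun i => by have := hlt i; omega) hk
    obtain ⟨i, hi⟩ := h1
    rw [← projHom_apply, map_smul, map_list_prod, List.prod_eq_zero, smul_zero]
    rw [List.mem_map]
    exact ⟨_, (List.mem_ofFn' _ _).2 ⟨i, rfl⟩, proj_serL N hq hi _ _⟩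
  · exact map_zero (projHom (filY N) q)

theorem isNull_multiTerm (m : ℕ) (k : ℤ) (b : Fin m → ℕ) (I J : Fin m → Fin N) :
    IsNull (filY N) (multiTerm N m k b I J) := by
  intro q
  by_cases hq : q = 0
  · subst hq
    refine Set.finite_empty.subset fun a ha => ha ?_
    have := (hAdic_filY N).proj_smul le_rfl (multiTerm N m k b I J a) (p := 0)
    rwa [pow_zero, one_smul] at this
  · refine (((intBox m (m * q - k) q).image fun c i => c i + (b i : ℤ)).finite_toSet).subset
      fun a ha => ?_
    by_contra hne
    exact ha (proj_multiTerm (Nat.pos_of_ne_zero hq) le_rfl le_rfl hne)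

/-- The coefficients of `L_[m](u|z)` in the truncated Yangian, as finite sums. -/
theorem truncHom_multiL (hp : 0 < p) {m : ℕ} (k : ℤ) (b : Fin m → ℕ) (I J : Fin m → Fin N)
    {P M : ℤ} (hP : (p : ℤ) ≤ P) (hM : m * P - k ≤ M) :
    truncHom g N p (multiL N m k b I J) = ∑ c ∈ intBox m M P, if ∑ i, c i = k then
      ((∏ i, Ring.choose (c i + b i) (b i) : ℤ) : Coef) •
        (List.ofFn fun i => oneSub (truncMat g p N) (c i + b i) (I i) (J i)).prod else 0 := by
  have h1 := (isNull_multiTerm m k b I J).proj_tsum p _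
    fun a ha => proj_multiTerm hp hP hM ha
  refine (truncHom_congr_proj h1).trans ?_
  rw [Finset.sum_image fun c _ c' _ hcc => funext fun i => add_right_cancel (congrFun hcc i), map_sum]
  refine Finset.sum_congr rfl fun c _ => ?_
  rw [multiTerm]
  simp only [add_sub_cancel_right]
  split_ifs
  · rw [map_smul, map_list_prod, List.map_ofFn]
    congr 3
    funext i
    exact (oneSub_truncMat _ _ _).symm
  · exact map_zero _

/-- The coefficients of the fused series of the truncated Yangian are the images of those of
`𝕃_[m](z)`. -/
theorem coeff_fusedSeries_trunc (hp : 0 < p) (m : ℕ) (k : ℤ) :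
    (fusedSeries g p p (truncMat g p N) m).coeff (-k) =
      truncHom g N p (fusedTrace g N m (multiL N m k)) := by
  obtain ⟨y, hy⟩ := fusedTrace_eq_sum_add (hAdic_filY N) g N m (multiL N m k) p
  rw [hy, map_add, map_smul, trunc_pow_smul, add_zero, map_sum]
  simp only [fusedTerm, map_sum, map_smul]
  rw [Finset.sum_comm]
  have e1 : fusedSeries g p p (truncMat g p N) m = ∑ I, ∑ J, cst (fusionOp g N m I J) •
      (List.ofFn fun i => lau (p + 2) (sig p (cst (offset g m i) * h)
        fun a => oneSub (truncMat g p N) a (J i) (I i))).prod := by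
    rw [fusedSeries, Matrix.trace]
    refine Finset.sum_congr rfl fun I _ => ?_
    rw [Matrix.diag_apply, Matrix.mul_apply]
    refine Finset.sum_congr rfl fun J _ => ?_
    refine (congrArg₂ (· * ·) (cmat_apply _ _ _ _)
      (list_prod_leg_apply _ _ (List.nodup_finRange m) _ _)).trans ?_
    rw [if_pos fun c hc => absurd (List.mem_finRange c) hc, List.ofFn_eq_map]
    exact (Algebra.smul_def _ _).symm
  rw [e1, coeff_sum]
  refine Finset.sum_congr rfl fun I _ => ?_
  rw [coeff_sum, Finset.sum_comm]
  refine Finset.sum_congr rfl fun J _ => ?_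
  rw [coeff_smul, coeff_prod_shifted (by omega) p _ _ k _ le_rfl, Finset.smul_sum]
  symm
  refine Finset.sum_subset_zero_on_sdiff (Finset.filter_subset _ _) ?_ ?_
  · intro b hb
    have hb' : p ≤ ∑ i, b i := by
      by_contra hlt
      exact (Finset.mem_sdiff.1 hb).2 (mem_degBox.2 (not_le.1 hlt))
    rw [prod_offset_pow, ← Nat.sub_add_cancel hb', _root_.pow_add, mul_comm (h ^ _), mul_assoc, mul_smul,
      mul_smul, trunc_pow_smul, smul_zero]
  · intro b _
    rw [truncHom_multiL hp k b J I (P := (p : ℤ) + 2) (by omega) le_rfl, mul_smul]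

/-- The coefficients of the series `𝕃_[m](z)` commute. -/
theorem commute_serLL (hN : N ≠ 0) (hsp : g = .sp → Even N) (m m' : ℕ) (k l : ℤ) :
    Commute (serLL g N m k) (serLL g N m' l) := by
  change _ * _ = _ * _
  rw [serLL, serLL, ← toYang_mul, ← toYang_mul, toYang_eq_iff]
  intro p
  rw [← truncHom_eq_iff, map_mul, map_mul]
  rcases Nat.eq_zero_or_pos p with rfl | hp
  · have hz : ∀ x : TruncY g N 0, x = 0 := fun x => by
      have := trunc_pow_smul x
      rwa [pow_zero, one_smul] at this
    rw [hz (_ * _), hz (truncHom g N 0 (fusedTrace g N m' (multiL N m' l)) * _)]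
  · rw [← coeff_fusedSeries_trunc hp, ← coeff_fusedSeries_trunc hp]
    exact commute_fusedSeries hp (trunc_pow_smul (g := g) (N := N)) (by omega : (0 : ℤ) < p) hN hsp
      bd_truncMat rttDiv_truncMat m m' _ _

/-- The quantum determinant is central. -/
theorem serLL_gl_mem_center (hN : N ≠ 0) (k : ℤ) :
    serLL .gl N N k ∈ Subalgebra.center Coef (Yang .gl N) := by
  refine Subalgebra.mem_center_iff.2 fun x => ?_
  obtain ⟨x, rfl⟩ := toYang_surjective .gl N x
  rw [serLL, ← toYang_mul, ← toYang_mul, toYang_eq_iff]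
  intro p
  rw [← truncHom_eq_iff, map_mul, map_mul]
  rcases Nat.eq_zero_or_pos p with rfl | hp
  · have hz : ∀ x : TruncY .gl N 0, x = 0 := fun x => by
      have := trunc_pow_smul x
      rwa [pow_zero, one_smul] at this
    rw [hz (_ * _), hz (truncHom .gl N 0 (fusedTrace .gl N N (multiL N N k)) * _)]
  rw [← coeff_fusedSeries_trunc hp]
  set c := (fusedSeries .gl p p (truncMat .gl p N) N).coeff (-k)
  obtain ⟨a, ha⟩ := x.2 p
  rw [truncHom_congr_proj (y := toCompl (filY N) a) (ha p le_rfl)]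
  clear ha x
  change Commute _ _
  induction a using FreeAlgebra.induction with
  | grade0 r => exact Algebra.commutes r c
  | grade1 q =>
    obtain ⟨i, j, r⟩ := q
    have h1 := commute_fusedSeries_gl hp (trunc_pow_smul (g := .gl) (N := N)) (by omega : (0 : ℤ) < p) hN
      (bd_truncMat (g := .gl) (N := N) (p := p)) rttDiv_truncMat (-k) (-r) i j
    have e : truncMat .gl p N (-r) i j =
        truncHom .gl N p (toCompl (filY N) (FreeAlgebra.ι Coef (i, j, r))) := by
      conv_rhs => rw [← neg_neg r]
      rfl
    rw [e] at h1
    exact h1.symm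
  | mul a b ha hb => exact Commute.mul_left ha hb
  | add a b ha hb => exact Commute.add_left ha hb

end Coefficients

end

end GenYangian

end

theorem corollary4p2 (g : GenYangian.LieType) (N : ℕ) (hN : 2 ≤ N)
    (hsp : g = GenYangian.LieType.sp → Even N) :
    (∀ Y : GenYangian.Vac g N (GenYangian.critLevel g N) →ₗ[GenYangian.Coef]
        GenYangian.Yang g N →ₗ[GenYangian.Coef] (ℤ → GenYangian.Yang g N),
      GenYangian.IsModuleMap g N Y →
        ∀ n, GenYangian.Admissible g N n → ∀ (w : GenYangian.Yang g N) (k : ℤ),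
          Y (GenYangian.vecT g N n) w k = GenYangian.serLL g N n k * w) ∧
    (∀ x ∈ Algebra.adjoin GenYangian.Coef
        {a : GenYangian.Yang g N |
          ∃ n k, GenYangian.Admissible g N n ∧ a = GenYangian.serLL g N n k},
      ∀ y ∈ Algebra.adjoin GenYangian.Coef
        {a : GenYangian.Yang g N |
          ∃ n k, GenYangian.Admissible g N n ∧ a = GenYangian.serLL g N n k},
      x * y = y * x) ∧
    (g = GenYangian.LieType.gl → ∀ k : ℤ,
      GenYangian.serLL g N N k ∈ Subalgebra.center GenYangian.Coef (GenYangian.Yang g N)) := by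
  have hN0 : N ≠ 0 := by omega
  refine ⟨fun Y hY n _ w k => GenYangian.moduleMap_vecT g N Y hY n w k, fun x hx y hy => ?_, ?_⟩
  · have h1 := Algebra.commute_of_mem_adjoin_of_forall_mem_commute
      (R := GenYangian.Coef) (a := y) hx fun a ha => ?_
    · exact h1.symm
    obtain ⟨n, k, -, rfl⟩ := ha
    refine (Algebra.commute_of_mem_adjoin_of_forall_mem_commute hy fun a ha => ?_).symm
    obtain ⟨m, l, -, rfl⟩ := ha
    exact GenYangian.commute_serLL hN0 hsp n m k l
  · rintro rfl k
    exact GenYangian.serLL_gl_mem_center hN0 k
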